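/- Call an affine functional $f:\mathbb{R}^3\to\mathbb{R}$ \emph{integer} if $f(\mathbb{Z}^3)\subseteq\mathbb{Z}$ and \emph{primitive} if $f(\mathbb{Z}^3)=\mathbb{Z}$. The \emph{width} of a lattice polytope is the minimum of $\max f-\min f$ on it over all non-constant integer affine functionals $f$. A lattice $3$-polytope $P\subseteq\mathbb{R}^3$ (a full-dimensional convex hull of finitely many points of $\mathbb{Z}^3$) is \emph{boxed with respect to} a parallelepiped $Q$ if $P$ has width larger than one and there are primitive integer affine functionals $f_1,f_2,f_3$ with linearly independent linear parts such that $Q=\bigcap_{i=1}^3 f_i^{-1}([0,1])$ and $(P\cap\mathbb{Z}^3)\setminus Q=\{v_1,v_2,v_3\}$, where for all $i,j$ one has $f_i(v_j)\notin\{0,1\}$ if and only if $i=j$. It is \emph{boxed} if it is boxed with respect to some such $Q$. **Proposition.** Every boxed lattice $3$-polytope is boxed with respect to a parallelepiped that is unimodularly equivalent to the unit cube $[0,1]^3$, that is, one that is mapped onto $[0,1]^3$ by an affine bijection $t:\mathbb{R}^3\to\mathbb{R}^3$ with $t(\mathbb{Z}^3)=\mathbb{Z}^3$. -/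

import Mathlib

/-- The integer lattice `ℤ^d` inside `ℝ^d`. -/
def integerLattice (d : ℕ) : Set (Fin d → ℝ) :=
  {x | ∀ i, ∃ n : ℤ, x i = (n : ℝ)}

/-- A lattice `d`-polytope in `ℝ^d`: a full-dimensional convex hull of finitely many
lattice points. -/
def IsLatticePolytope {d : ℕ} (P : Set (Fin d → ℝ)) : Prop :=
  (∃ S : Set (Fin d → ℝ), S.Finite ∧ S ⊆ integerLattice d ∧ P = convexHull ℝ S) ∧
    affineSpan ℝ P = ⊤

/-- An affine functional is integer if it maps `ℤ^d` into `ℤ`. -/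
def IsIntegerFunctional {d : ℕ} (f : (Fin d → ℝ) →ᵃ[ℝ] ℝ) : Prop :=
  f '' integerLattice d ⊆ Set.range ((↑) : ℤ → ℝ)

/-- An affine functional is primitive (integer) if it maps `ℤ^d` onto `ℤ`. -/
def IsPrimitiveFunctional {d : ℕ} (f : (Fin d → ℝ) →ᵃ[ℝ] ℝ) : Prop :=
  f '' integerLattice d = Set.range ((↑) : ℤ → ℝ)

/-- The length `max f - min f` of the image of `K` under the functional `f`
(for `K` nonempty and compact). -/
noncomputable def widthAlong {d : ℕ} (f : (Fin d → ℝ) →ᵃ[ℝ] ℝ) (K : Set (Fin d → ℝ)) : ℝ :=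
  sSup (f '' K) - sInf (f '' K)

/-- The lattice width of `K`: the least `max f - min f` on `K` over all non-constant integer
affine functionals `f`. (If `K` is the convex hull of a nonempty finite set of lattice points
and `0 < d`, these numbers are non-negative integers, so that the infimum is a minimum.) -/
noncomputable def latticeWidth {d : ℕ} (K : Set (Fin d → ℝ)) : ℝ :=
  sInf {w : ℝ | ∃ f : (Fin d → ℝ) →ᵃ[ℝ] ℝ,
    IsIntegerFunctional f ∧ f.linear ≠ 0 ∧ w = widthAlong f K}

/-- The configuration `A` is boxed with respect to `Q`: `A` is a finite set of lattice points of
width larger than one, `Q` is the parallelepiped cut out by `0 ≤ f i ≤ 1` for primitive integer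
affine functionals `f i` with linearly independent linear parts, and
`A \ Q = {v 1, …, v d}` with `f i (v j) ∉ {0, 1}` if and only if `i = j`. -/
def IsBoxedWith {d : ℕ} (A Q : Set (Fin d → ℝ)) : Prop :=
  A.Finite ∧ A ⊆ integerLattice d ∧ 1 < latticeWidth (convexHull ℝ A) ∧
    ∃ f : Fin d → ((Fin d → ℝ) →ᵃ[ℝ] ℝ),
      (∀ i, IsPrimitiveFunctional (f i)) ∧
      LinearIndependent ℝ (fun i => (f i).linear) ∧
      Q = ⋂ i, f i ⁻¹' Set.Icc 0 1 ∧
      ∃ v : Fin d → (Fin d → ℝ),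
        A \ Q = Set.range v ∧ ∀ i j, f i (v j) ∉ ({0, 1} : Set ℝ) ↔ i = j

/-- A lattice polytope is boxed if its set of lattice points is boxed with respect to some
parallelepiped. -/
def IsBoxed {d : ℕ} (P : Set (Fin d → ℝ)) : Prop :=
  ∃ Q : Set (Fin d → ℝ), IsBoxedWith (P ∩ integerLattice d) Q

/-- Unimodular equivalence: some affine transformation preserving `ℤ^d` maps `K` onto `L`. -/
def UnimodularlyEquivalent {d : ℕ} (K L : Set (Fin d → ℝ)) : Prop :=
  ∃ t : (Fin d → ℝ) ≃ᵃ[ℝ] (Fin d → ℝ), t '' integerLattice d = integerLattice d ∧ t '' K = L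

/-- The unit cube `[0,1]^d`. -/
def unitCube (d : ℕ) : Set (Fin d → ℝ) :=
  Set.Icc 0 1

/-!
# Boxed lattice polytopes are boxed with respect to a unimodular parallelepiped

Let `A` be the set of lattice points of the polytope. The functionals of a box take values in
`{0, 1}` on `A`, except for `f i` at the exceptional point `v i`. If `f i` is replaced by another
integer functional with values in `{0, 1}` on `A` away from `v i`, then `v i` is still exceptional,
since otherwise the width would be one (`BoxedBy.update`). So it suffices to find three integer
functionals of determinant `± 1`, each with values in `{0, 1}` away from its own point of `A`.
The parallelepiped they cut out is then a unimodular copy of the cube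
(`unimodularlyEquivalent_unitCube`). Everything but this last step takes place in `ℤ³`
(`BoxedBy.unimodularlyBoxed`), where the index of a parallelepiped is the determinant of its
functionals and only two properties of `A` are used: width and lattice convexity.

The points of `A` other than `v 0`, `v 1`, `v 2` are vertices of the parallelepiped. Suppose that
its index is at least two.

*At least three vertices in `A`.* No three of them lie in a facet, since an empty lattice triangle
is unimodular in its plane (`EmptyTriangle.exists_det3_eq_one`). Hence three of them span a plane in
special position, which is the zero set of an integer functional `g` equal to a combination of the
`f i` with coefficients `± 1` divided by the index. An `f i` can be exchanged for `± g`, or for a sum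
of `± g` and some of the functionals, unless the exceptional points are far from the plane. In that
case empty triangles in the facet planes determine the coordinates of the exceptional points, and
then some convex combination of points of `A` is a lattice point that is not allowed in `A`
(`ProperBox.unimodularlyBoxed_of_edge`, `Tripod.unimodularlyBoxed`,
`ProperBox.unimodularlyBoxed_of_three`).

*At most two vertices in `A`.* Then `A` has at most five points, and the given box plays no further
role. By White's theorem (`EmptyTetrahedron.width_one`) empty tetrahedra have width one, so that `A`
has exactly five points; its proof is the arithmetic of `terminal_residues`. Five points have a
primitive affine dependence, and the signs of its coefficients are treated one by one
(`FivePoints.unimodularlyBoxed_of_antitone`). White's theorem for the tetrahedra that omit one of the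
points provides functionals that are in `{0, 1}` away from this point. These contradict the width or
yield the box. If one point is the barycentre of a triangle with the fourth point as apex, this is
`Pyramid.unimodularlyBoxed`. If one point lies inside the tetrahedron of the others, divisibilities
leave seven lists of barycentric coordinates (`InteriorPoint.barycentric`), and the determinant of
three functionals is the quotient of a minor of the matrix of their values by a volume
(`InteriorPoint.minor_eq`), which finite tables of minors show to be `± 1` for a suitable choice
(`InteriorPoint.unimodularlyBoxed`).
-/

open Matrix

/-! ### The arithmetic of residues behind White's theorem -/

/-- The identity of residues says that `⌊j (u + v - 1) / h⌋ = ⌊j u / h⌋ + ⌊j v / h⌋` for all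
`0 ≤ j < h`. The left side jumps too rarely for this if `2 u < h`. -/
theorem half_le_of_residue_sum (h u v : ℤ) (hv : 2 ≤ v) (huv : v ≤ u) (hs : u + v - 1 ≤ h - 1)
    (H : ∀ j, 0 < j → j < h → j + (j * (u + v - 1)) % h = (j * u) % h + (j * v) % h) :
    h ≤ 2 * u := by
  by_contra hcon
  push Not at hcon
  have hpos : 0 < h := by linarith
  have hfl : ∀ j, 0 ≤ j → j < h → j * (u + v - 1) / h = j * u / h + j * v / h := by
    intro j hj hjh
    rcases hj.eq_or_lt with rfl | hj
    · simp
    have e := H j hj hjh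
    have e1 := Int.mul_ediv_add_emod (j * (u + v - 1)) h
    have e2 := Int.mul_ediv_add_emod (j * u) h
    have e3 := Int.mul_ediv_add_emod (j * v) h
    have : h * (j * (u + v - 1) / h) = h * (j * u / h + j * v / h) := by
      linear_combination e1 - e2 - e3 - e
    exact mul_left_cancel₀ hpos.ne' this
  have hceil : ∀ w q : ℤ, 0 < w → ∃ c, q ≤ c * w ∧ (c - 1) * w < q := by
    intro w q hw
    refine ⟨-(-q / w), ?_, ?_⟩
    · have := Int.ediv_mul_le (-q) hw.ne'
      linarith
    · have := Int.lt_ediv_add_one_mul_self (-q) hw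
      linarith
  have hge : ∀ a q : ℤ, q ≤ a / h ↔ q * h ≤ a := fun a q => Int.le_ediv_iff_mul_le hpos
  have hlt : ∀ a q : ℤ, a / h < q ↔ a < q * h := fun a q => Int.ediv_lt_iff_lt_mul hpos
  -- `c` and `d` are the places of the first jumps of the two summands
  obtain ⟨c, hc1, hc2⟩ := hceil u h (by linarith)
  obtain ⟨d, hd1, hd2⟩ := hceil v h (by linarith)
  have hc3 : 3 ≤ c := by
    by_contra hc
    have : c ≤ 2 := by linarith
    nlinarith
  have hdh : 2 * d < h + 2 := by
    by_contra hd
    have : 0 < d := by nlinarith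
    nlinarith
  have hcd : c ≤ d := by
    by_contra hd
    have h1 : d ≤ c - 1 := by linarith
    have : 0 < d := by nlinarith
    nlinarith
  have a1 : (c - 1) * (u + v - 1) < h := by
    have e := hfl (c - 1) (by linarith) (by linarith)
    have e1 : (c - 1) * u / h < 1 := (hlt _ _).2 (by linarith)
    have e2 : (c - 1) * v / h < 1 := (hlt _ _).2 (by nlinarith)
    have := (hlt ((c - 1) * (u + v - 1)) 1).1 (by linarith)
    linarith
  have a2 : c * v < h := by
    have e := hfl c (by linarith) (by linarith)
    have e1 : 1 ≤ c * u / h := (hge _ _).2 (by linarith)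
    have e2 : c * (u + v - 1) / h < 2 := (hlt _ _).2 (by linarith)
    have := (hlt (c * v) 1).1 (by linarith)
    linarith
  have hcd' : c < d := by
    rcases hcd.lt_or_eq with h1 | rfl
    · exact h1
    · linarith
  have huv' : v < u := by
    rcases huv.lt_or_eq with h1 | rfl
    · exact h1
    · linarith
  -- the sum jumps by at most one in each step, so the summand of `u` does not jump at `d`
  set k := (d - 1) * u / h with hk
  have hk1 : 1 ≤ k := (hge _ _).2 (by nlinarith)
  have hdk : d * u / h = k ∧ d * (u + v - 1) / h = k + 1 := by
    have e := hfl d (by linarith) (by linarith)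
    have e' := hfl (d - 1) (by linarith) (by linarith)
    have e1 : 1 ≤ d * v / h := (hge _ _).2 (by linarith)
    have e2 : (d - 1) * v / h < 1 := (hlt _ _).2 (by linarith)
    have e3 : 0 ≤ (d - 1) * v / h := (hge _ _).2 (by nlinarith)
    have e4 : k ≤ d * u / h := (hge _ _).2 (by
      have := (hge ((d - 1) * u) k).1 le_rfl
      linarith)
    have e5 : d * (u + v - 1) / h < k + 2 := (hlt _ _).2 (by
      have := (hlt ((d - 1) * (u + v - 1)) (k + 1)).1 (by linarith)
      linarith)
    constructor <;> linarith
  obtain ⟨hdk1, hdk2⟩ := hdk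
  have b1 : k * h ≤ (d - 1) * u := (hge _ _).1 le_rfl
  have b2 : d * u < (k + 1) * h := (hlt _ _).1 (by linarith)
  have hu0 : 0 < u := by linarith
  have hmu : ∀ p q : ℤ, p * u < q * u → p < q := fun p q hpq => lt_of_mul_lt_mul_right hpq hu0.le
  -- `x` and `y` are the places of the jumps of the summand of `u` before and after `d`: the sum
  -- jumps three times on the way from `x - 1` to `y`, which leads to a contradiction
  obtain ⟨x, hx1, hx2⟩ := hceil u (k * h) hu0
  obtain ⟨y, hy1, hy2⟩ := hceil u ((k + 1) * h) hu0
  have hkh : h ≤ k * h := le_mul_of_one_le_left hpos.le hk1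
  have hx0 : 0 < x := hmu 0 x (by linarith)
  have hxd : x - 1 < d - 1 := hmu _ _ (by linarith)
  have hyd : d < y := hmu _ _ (by linarith)
  have a3 : (x - 1) * (u + v - 1) < k * h := by
    have e := hfl (x - 1) (by linarith) (by linarith)
    have e1 : (x - 1) * u / h < k := (hlt _ _).2 (by linarith)
    have e2 : (x - 1) * v / h < 1 := (hlt _ _).2 (by
      have : (x - 1) * v ≤ (d - 1) * v := mul_le_mul_of_nonneg_right (by linarith) (by linarith)
      linarith)
    exact (hlt _ _).1 (by linarith)
  by_cases hyh : y < h
  · have e := hfl y (by linarith) hyh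
    have e1 : k + 1 ≤ y * u / h := (hge _ _).2 (by linarith)
    have e2 : 1 ≤ y * v / h := (hge _ _).2 (by
      have : d * v ≤ y * v := mul_le_mul_of_nonneg_right (by linarith) (by linarith)
      linarith)
    have e3 := (hge (y * (u + v - 1)) (k + 2)).1 (by linarith)
    have e4 : y - 1 - x < c := hmu _ _ (by linarith)
    have e5 : 2 * h < (y - x + 1) * (u + v - 1) := by linarith
    have e6 : (y - x + 1) * (u + v - 1) ≤ (2 * (c - 1)) * (u + v - 1) :=
      mul_le_mul_of_nonneg_right (by linarith) (by linarith)
    linarith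
  · have e1 : (h - 1) * u ≤ (y - 1) * u := mul_le_mul_of_nonneg_right (by linarith) hu0.le
    have e2 : u < k + 2 := by
      by_contra hh
      have : (k + 2) * h ≤ u * h := mul_le_mul_of_nonneg_right (by linarith) hpos.le
      linarith
    have e3 : (u - 1) * h ≤ k * h := mul_le_mul_of_nonneg_right (by linarith) hpos.le
    have e4 : 3 ≤ u := by linarith
    have e5 : 3 * (h - d) ≤ u * (h - d) := mul_le_mul_of_nonneg_right e4 (by linarith)
    linarith

/-- The arithmetic of White's theorem: if the sum of `j` and of the residues of `j r` and `j s`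
modulo `h` exceeds `h` for all `0 < j < h`, then two of the three numbers `1`, `r`, `s` have
sum zero modulo `h`. -/
theorem terminal_residues (h r s : ℤ) (hr0 : 0 < r) (hr : r < h) (hs0 : 0 < s) (hs : s < h)
    (H : ∀ j, 0 < j → j < h → h < j + (j * r) % h + (j * s) % h) :
    r = h - 1 ∨ s = h - 1 ∨ r + s = h := by
  have hpos : 0 < h := by linarith
  have hneg : ∀ a : ℤ, a % h ≠ 0 → (-a) % h = h - a % h := by
    intro a ha
    have h1 := Int.emod_nonneg a hpos.ne'
    have h2 := Int.emod_lt_of_pos a hpos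
    have : (-a) % h = (h - a % h) % h := by
      have : h ∣ (-a) - (h - a % h) := by
        have := Int.mul_ediv_add_emod a h
        exact ⟨-(a / h) - 1, by linear_combination this⟩
      exact Int.emod_eq_emod_iff_emod_sub_eq_zero.2 (Int.emod_eq_zero_of_dvd this)
    rw [this, Int.emod_eq_of_lt] <;> omega
  have hrefl : ∀ j a : ℤ, ((h - j) * a) % h = (-(j * a)) % h := by
    intro j a
    rw [show (h - j) * a = -(j * a) + h * a by ring, Int.add_mul_emod_self_left]
  have hb : ∀ a : ℤ, 0 ≤ a % h ∧ a % h < h := fun a =>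
    ⟨Int.emod_nonneg a hpos.ne', Int.emod_lt_of_pos a hpos⟩
  have key : ∀ r s : ℤ, (∀ j, 0 < j → j < h → h < j + (j * r) % h + (j * s) % h) →
      ∀ j, 0 < j → j < h → (j * r) % h ≠ 0 := by
    intro r s H j hj hjh h0
    have h1 := H j hj hjh
    have h2 := H (h - j) (by linarith) (by linarith)
    rw [hrefl, hrefl] at h2
    have h3 : (-(j * r)) % h = 0 := by
      rw [Int.emod_eq_zero_of_dvd]; exact (Int.dvd_neg).2 (Int.dvd_of_emod_eq_zero h0)
    by_cases h4 : (j * s) % h = 0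
    · omega
    · rw [hneg _ h4] at h2
      omega
  have hrn := key r s H
  have hsn := key s r (fun j a b => by have := H j a b; omega)
  have hup : ∀ j, 0 < j → j < h → j + (j * r) % h + (j * s) % h < 2 * h := by
    intro j hj hjh
    have h2 := H (h - j) (by linarith) (by linarith)
    rw [hrefl, hrefl, hneg _ (hrn j hj hjh), hneg _ (hsn j hj hjh)] at h2
    omega
  by_contra hcon
  push Not at hcon
  obtain ⟨c1, c2, c3⟩ := hcon
  have hw : h < 1 + r + s := by
    have := H 1 one_pos (by linarith)
    rw [one_mul, one_mul, Int.emod_eq_of_lt hr0.le hr, Int.emod_eq_of_lt hs0.le hs] at this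
    exact this
  have hmod : ∀ a b : ℤ, 0 ≤ b → b < h → h ∣ a - b → a % h = b := by
    intro a b h0 h1 hd
    rw [Int.emod_eq_emod_iff_emod_sub_eq_zero.2 (Int.emod_eq_zero_of_dvd hd),
      Int.emod_eq_of_lt h0 h1]
  obtain ⟨w, hwdef⟩ : ∃ w, w = r + s + 1 - h := ⟨_, rfl⟩
  obtain ⟨r', hr'⟩ : ∃ r', r' = h - r := ⟨_, rfl⟩
  have hwmod : ∀ j, 0 < j → j < h → (j * w) % h = j + (j * r) % h + (j * s) % h - h := by
    intro j hj hjh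
    have e1 := H j hj hjh
    have e2 := hup j hj hjh
    apply hmod _ _ (by omega) (by omega)
    have f1 := Int.mul_ediv_add_emod (j * r) h
    have f2 := Int.mul_ediv_add_emod (j * s) h
    exact ⟨j * r / h + j * s / h + 1 - j, by rw [hwdef]; linear_combination -f1 - f2⟩
  have hr'mod : ∀ j, 0 < j → j < h → (j * r') % h = h - (j * r) % h := by
    intro j hj hjh
    rw [hr', show j * (h - r) = -(j * r) + h * j by ring, Int.add_mul_emod_self_left,
      hneg _ (hrn j hj hjh)]
  -- `half_le_of_residue_sum` applied to `u`, `v` and to the complementary identity, in which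
  -- `h - u` takes the place of `s`: the two bounds exclude each other
  have main : ∀ u v : ℤ, 2 ≤ v → v ≤ u → s = u + v - 1 →
      (∀ j, 0 < j → j < h → j + (j * s) % h = (j * u) % h + (j * v) % h) →
      (∀ j, 0 < j → j < h → (j * u) % h ≠ 0) → False := by
    intro u v hv huv hsuv Hj hun
    have g1 := half_le_of_residue_sum h u v hv huv (by linarith)
      (by intro j hj hjh; rw [← hsuv]; exact Hj j hj hjh)
    have Hj' : ∀ j, 0 < j → j < h →
        j + (j * (h - u)) % h = (j * (h - s)) % h + (j * v) % h := by
      intro j hj hjh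
      have := Hj j hj hjh
      rw [show j * (h - u) = -(j * u) + h * j by ring, Int.add_mul_emod_self_left,
        hneg _ (hun j hj hjh), show j * (h - s) = -(j * s) + h * j by ring,
        Int.add_mul_emod_self_left, hneg _ (hsn j hj hjh)]
      linarith
    have hs2 : s ≤ h - 2 := by omega
    rcases le_total v (h - s) with h1 | h1
    · have := half_le_of_residue_sum h (h - s) v hv h1 (by linarith)
        (by intro j hj hjh
            rw [show h - s + v - 1 = h - u by linarith]; exact Hj' j hj hjh)
      linarith
    · have := half_le_of_residue_sum h v (h - s) (by linarith) h1 (by linarith)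
        (by intro j hj hjh
            rw [show v + (h - s) - 1 = h - u by linarith, Hj' j hj hjh]; ring)
      linarith
  have Hid : ∀ j, 0 < j → j < h → j + (j * s) % h = (j * r') % h + (j * w) % h := by
    intro j hj hjh
    rw [hr'mod j hj hjh, hwmod j hj hjh]; ring
  rcases le_total w r' with h1 | h1
  · refine main r' w (by omega) h1 (by omega) Hid ?_
    intro j hj hjh
    have := hb (j * r)
    rw [hr'mod j hj hjh]; omega
  · refine main w r' (by omega) h1 (by omega) (fun j hj hjh => by rw [Hid j hj hjh]; ring) ?_
    intro j hj hjh
    have := H j hj hjh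
    rw [hwmod j hj hjh]; omega

/-! ### Determinants and empty lattice triangles -/

/-- The determinant of three vectors of `ℤ³`. -/
def det3 (a b c : Fin 3 → ℤ) : ℤ :=
  a 0 * (b 1 * c 2 - b 2 * c 1) - a 1 * (b 0 * c 2 - b 2 * c 0) + a 2 * (b 0 * c 1 - b 1 * c 0)

/-- The cross product, as the functional `det3 a b`. -/
def cross3 (a b : Fin 3 → ℤ) : Fin 3 → ℤ :=
  ![a 1 * b 2 - a 2 * b 1, a 2 * b 0 - a 0 * b 2, a 0 * b 1 - a 1 * b 0]

theorem dot3 (n x : Fin 3 → ℤ) : n ⬝ᵥ x = n 0 * x 0 + n 1 * x 1 + n 2 * x 2 := by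
  simp [dotProduct, Fin.sum_univ_three]

theorem cross3_dot (a b x : Fin 3 → ℤ) : cross3 a b ⬝ᵥ x = det3 a b x := by
  rw [dot3]; simp [cross3, det3]; ring

theorem det3_mul_det3 (f g h a b c : Fin 3 → ℤ) :
    det3 f g h * det3 a b c = det3 ![f ⬝ᵥ a, f ⬝ᵥ b, f ⬝ᵥ c] ![g ⬝ᵥ a, g ⬝ᵥ b, g ⬝ᵥ c]
      ![h ⬝ᵥ a, h ⬝ᵥ b, h ⬝ᵥ c] := by
  simp [dot3, det3]; ring

theorem exists_ne_zero_of_det3_eq_zero (a b c : Fin 3 → ℤ) (h : det3 a b c = 0) :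
    ∃ n : Fin 3 → ℤ, n ≠ 0 ∧ n ⬝ᵥ a = 0 ∧ n ⬝ᵥ b = 0 ∧ n ⬝ᵥ c = 0 := by
  have hd : (Matrix.of ![a, b, c]).det = 0 := by
    rw [Matrix.det_fin_three]; simp only [det3] at h
    simp; linarith
  obtain ⟨n, hn, h0⟩ := Matrix.exists_mulVec_eq_zero_iff.2 hd
  refine ⟨n, hn, ?_, ?_, ?_⟩
  · have := congrFun h0 0; simp [Matrix.mulVec] at this; rwa [dotProduct_comm]
  · have := congrFun h0 1; simp [Matrix.mulVec] at this; rwa [dotProduct_comm]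
  · have := congrFun h0 2; simp [Matrix.mulVec] at this; rwa [dotProduct_comm]

/-- Vectors with nonzero determinant are linearly independent. -/
theorem eq_zero_of_det3_ne_zero {a b c : Fin 3 → ℤ} (h : det3 a b c ≠ 0) {α β γ : ℤ}
    (h0 : ∀ i, α * a i + β * b i + γ * c i = 0) : α = 0 ∧ β = 0 ∧ γ = 0 := by
  have e0 := h0 0
  have e1 := h0 1
  have e2 := h0 2
  refine ⟨?_, ?_, ?_⟩ <;> refine (mul_eq_zero.1 ?_).resolve_right h <;> unfold det3
  · linear_combination (b 1 * c 2 - b 2 * c 1) * e0 - (b 0 * c 2 - b 2 * c 0) * e1 +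
      (b 0 * c 1 - b 1 * c 0) * e2
  · linear_combination (c 1 * a 2 - c 2 * a 1) * e0 - (c 0 * a 2 - c 2 * a 0) * e1 +
      (c 0 * a 1 - c 1 * a 0) * e2
  · linear_combination (a 1 * b 2 - a 2 * b 1) * e0 - (a 0 * b 2 - a 2 * b 0) * e1 +
      (a 0 * b 1 - a 1 * b 0) * e2

/-- A unimodular basis of `ℤ³` takes prescribed integer values under some integer functional. -/
theorem exists_dot_eq_of_det3_eq_one {a b q : Fin 3 → ℤ} (h : det3 a b q = 1) (α β γ : ℤ) :
    ∃ n : Fin 3 → ℤ, n ⬝ᵥ a = α ∧ n ⬝ᵥ b = β ∧ n ⬝ᵥ q = γ := by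
  refine ⟨fun i => α * cross3 b q i + β * cross3 q a i + γ * cross3 a b i, ?_⟩
  unfold det3 at h
  simp only [dot3, cross3]
  simp
  refine ⟨?_, ?_, ?_⟩
  · linear_combination α * h
  · linear_combination β * h
  · linear_combination γ * h

/-- Coordinates with respect to a unimodular basis. -/
theorem exists_coords_of_det3_eq_one {a b q : Fin 3 → ℤ} (h : det3 a b q = 1) (c : Fin 3 → ℤ) :
    ∃ x y : ℤ, ∀ i, c i = x * a i + y * b i + det3 a b c * q i := by
  refine ⟨det3 c b q, det3 a c q, ?_⟩
  unfold det3 at *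
  intro i
  fin_cases i <;> simp
  · linear_combination (-c 0) * h
  · linear_combination (-c 1) * h
  · linear_combination (-c 2) * h

/-- The set `A` contains every lattice point that is a convex combination of four of its points;
by Carathéodory's theorem this is lattice convexity in `ℤ³`. Weights are integers with
arbitrary positive sum. -/
def LatticeConvex (A : Set (Fin 3 → ℤ)) : Prop :=
  ∀ o ∈ A, ∀ a ∈ A, ∀ b ∈ A, ∀ c ∈ A, ∀ w α β γ : ℤ, 0 ≤ w → 0 ≤ α → 0 ≤ β → 0 ≤ γ →
    0 < w + α + β + γ → ∀ z : Fin 3 → ℤ,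
      (∀ i, (w + α + β + γ) * z i = w * o i + α * a i + β * b i + γ * c i) → z ∈ A

/-- The only lattice points of the tetrahedron `o a b c` are its vertices. -/
def EmptyTetrahedron (o a b c : Fin 3 → ℤ) : Prop :=
  ∀ w α β γ : ℤ, 0 ≤ w → 0 ≤ α → 0 ≤ β → 0 ≤ γ →
    0 < w + α + β + γ → ∀ z : Fin 3 → ℤ,
      (∀ i, (w + α + β + γ) * z i = w * o i + α * a i + β * b i + γ * c i) →
        z = o ∨ z = a ∨ z = b ∨ z = c

/-- The only lattice points of the triangle `o a b` are its vertices. -/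
def EmptyTriangle (o a b : Fin 3 → ℤ) : Prop :=
  ∀ w α β : ℤ, 0 ≤ w → 0 ≤ α → 0 ≤ β →
    0 < w + α + β → ∀ z : Fin 3 → ℤ,
      (∀ i, (w + α + β) * z i = w * o i + α * a i + β * b i) → z = o ∨ z = a ∨ z = b

/-- An empty lattice triangle is unimodular in its plane: its edge vectors extend to a basis. -/
theorem EmptyTriangle.exists_det3_eq_one {o a b : Fin 3 → ℤ} (hT : EmptyTriangle o a b)
    (hab : cross3 (a - o) (b - o) ≠ 0) : ∃ q, det3 (a - o) (b - o) q = 1 := by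
  set u := a - o with hu
  set v := b - o with hv
  have hind : ∀ α β : ℤ, (∀ i, α * u i + β * v i = 0) → α = 0 ∧ β = 0 := by
    intro α β h
    have e0 := h 0
    have e1 := h 1
    have e2 := h 2
    obtain ⟨i, hi⟩ := Function.ne_iff.1 hab
    have : α * cross3 u v i = 0 ∧ β * cross3 u v i = 0 := by
      fin_cases i <;> simp [cross3, -mul_eq_zero] <;> constructor
      · linear_combination v 2 * e1 - v 1 * e2
      · linear_combination u 1 * e2 - u 2 * e1
      · linear_combination v 0 * e2 - v 2 * e0
      · linear_combination u 2 * e0 - u 0 * e2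
      · linear_combination v 1 * e0 - v 0 * e1
      · linear_combination u 0 * e1 - u 1 * e0
    exact ⟨(mul_eq_zero.1 this.1).resolve_right hi, (mul_eq_zero.1 this.2).resolve_right hi⟩
  by_cases hg : ∃ p : ℕ, p.Prime ∧ ∀ i, (p : ℤ) ∣ cross3 u v i
  · exfalso
    obtain ⟨p, hp, hdvd⟩ := hg
    have hp0 : (0 : ℤ) < p := by exact_mod_cast hp.pos
    have hpp : Prime (p : ℤ) := Nat.prime_iff_prime_int.1 hp
    have hminor : ∀ i j, (p : ℤ) ∣ u i * v j - u j * v i := by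
      have d0 := hdvd 0
      have d1 := hdvd 1
      have d2 := hdvd 2
      simp [cross3] at d0 d1 d2
      intro i j
      fin_cases i <;> fin_cases j <;> simp
      · exact d2
      · rw [← dvd_neg]; simpa using d1
      · rw [← dvd_neg]; simpa using d2
      · exact d0
      · exact d1
      · rw [← dvd_neg]; simpa using d0
    -- modulo `p` the two edge vectors are dependent
    obtain ⟨α, β, h1, h2, h3, h4, hne, hdv⟩ : ∃ α β : ℤ, 0 ≤ α ∧ α < p ∧ 0 ≤ β ∧ β < p ∧
        ¬(α = 0 ∧ β = 0) ∧ ∀ i, (p : ℤ) ∣ α * u i + β * v i := by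
      by_cases hall : ∀ i, (p : ℤ) ∣ u i
      · refine ⟨1, 0, by norm_num, by exact_mod_cast hp.one_lt, le_rfl, hp0, by norm_num, ?_⟩
        intro i; simpa using hall i
      · push Not at hall
        obtain ⟨i, hi⟩ := hall
        refine ⟨(-v i) % p, u i % p, Int.emod_nonneg _ hp0.ne', Int.emod_lt_of_pos _ hp0,
          Int.emod_nonneg _ hp0.ne', Int.emod_lt_of_pos _ hp0, ?_, ?_⟩
        · rintro ⟨-, h⟩
          exact hi (Int.dvd_of_emod_eq_zero h)
        · intro j
          have e1 := Int.mul_ediv_add_emod (-v i) p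
          have e2 := Int.mul_ediv_add_emod (u i) p
          obtain ⟨k, hk⟩ := hminor i j
          exact ⟨k - (-v i / p) * u j - (u i / p) * v j, by
            linear_combination hk + u j * e1 + v j * e2⟩
    choose k hk using hdv
    by_cases hle : α + β ≤ p
    · have := hT (p - α - β) α β (by linarith) h1 h3 (by linarith) (fun i => o i + k i) (by
        intro i
        have := hk i
        simp only [hu, hv, Pi.sub_apply] at this
        linear_combination -this)
      have hz : ∀ x y : ℤ, (fun i => o i + k i) = (fun i => o i + (x * u i + y * v i)) →
          α = p * x ∧ β = p * y := by
        intro x y h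
        have := hind (α - p * x) (β - p * y) (by
          intro i
          have := congrFun h i
          linear_combination hk i + (p : ℤ) * this)
        exact ⟨by linarith [this.1], by linarith [this.2]⟩
      rcases this with h | h | h
      · have := hz 0 0 (by rw [h]; funext i; simp)
        apply hne; simpa using this
      · have := hz 1 0 (by rw [h]; funext i; simp [hu])
        linarith [this.1]
      · have := hz 0 1 (by rw [h]; funext i; simp [hv])
        linarith [this.2]
    · have := hT (α + β - p) (p - α) (p - β) (by linarith) (by linarith) (by linarith)
        (by linarith) (fun i => a i + v i - k i) (by
        intro i
        have := hk i
        simp only [hu, hv, Pi.sub_apply] at this ⊢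
        linear_combination this)
      have hz : ∀ x y : ℤ, (fun i => a i + v i - k i) = (fun i => o i + (x * u i + y * v i)) →
          p - α = p * x ∧ p - β = p * y := by
        intro x y h
        have := hind (p - α - p * x) (p - β - p * y) (by
          intro i
          have h5 := congrFun h i
          have h6 : u i = a i - o i := rfl
          linear_combination (p : ℤ) * h5 - hk i + (p : ℤ) * h6)
        exact ⟨by linarith [this.1], by linarith [this.2]⟩
      rcases this with h | h | h
      · have := hz 0 0 (by rw [h]; funext i; simp)
        linarith [this.1]
      · have := hz 1 0 (by rw [h]; funext i; simp [hu])
        linarith [this.2]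
      · have := hz 0 1 (by rw [h]; funext i; simp [hv])
        linarith [this.1]
  · push Not at hg
    have hgcd : Int.gcd (Int.gcd (cross3 u v 0) (cross3 u v 1)) (cross3 u v 2) = 1 := by
      by_contra hne
      obtain ⟨p, hp, hpd⟩ := Nat.exists_prime_and_dvd hne
      obtain ⟨i, hi⟩ := hg p hp
      apply hi
      have h1 : (p : ℤ) ∣ _ := (Int.natCast_dvd_natCast.2 hpd).trans (Int.gcd_dvd_left ..)
      have h2 : (p : ℤ) ∣ _ := (Int.natCast_dvd_natCast.2 hpd).trans (Int.gcd_dvd_right ..)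
      fin_cases i
      · exact h1.trans (Int.gcd_dvd_left ..)
      · exact h1.trans (Int.gcd_dvd_right ..)
      · exact h2
    have e1 := Int.gcd_eq_gcd_ab (Int.gcd (cross3 u v 0) (cross3 u v 1)) (cross3 u v 2)
    have e2 := Int.gcd_eq_gcd_ab (cross3 u v 0) (cross3 u v 1)
    rw [hgcd] at e1
    rw [e2] at e1
    generalize Int.gcdA (_ + _) _ = x at e1
    generalize Int.gcdB (_ + _) _ = y at e1
    refine ⟨![x * Int.gcdA (cross3 u v 0) (cross3 u v 1),
      x * Int.gcdB (cross3 u v 0) (cross3 u v 1), y], ?_⟩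
    rw [← cross3_dot, dot3]
    push_cast at e1
    simp
    linear_combination -e1

/-! ### White's theorem on empty lattice tetrahedra -/

/-- Some integer functional vanishing at `o` takes the values `α, β, γ` at `a, b, c`. -/
def HasValues (o a b c : Fin 3 → ℤ) (α β γ : ℤ) : Prop :=
  ∃ n : Fin 3 → ℤ, n ⬝ᵥ (a - o) = α ∧ n ⬝ᵥ (b - o) = β ∧ n ⬝ᵥ (c - o) = γ

theorem cross3_ne_zero_of_det3_ne_zero {a b c : Fin 3 → ℤ} (h : det3 a b c ≠ 0) :
    cross3 a b ≠ 0 := by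
  intro h0
  apply h
  rw [← cross3_dot, h0, zero_dotProduct]

theorem EmptyTetrahedron.emptyTriangle {o a b c : Fin 3 → ℤ} (hT : EmptyTetrahedron o a b c)
    (hD : det3 (a - o) (b - o) (c - o) ≠ 0) : EmptyTriangle o a b := by
  intro w α β hw hα hβ hpos z hz
  rcases hT w α β 0 hw hα hβ le_rfl (by linarith) z (by
    intro i; linear_combination hz i) with h | h | h | h
  · exact Or.inl h
  · exact Or.inr (Or.inl h)
  · exact Or.inr (Or.inr h)
  · have := eq_zero_of_det3_ne_zero hD (α := α) (β := β) (γ := -(w + α + β)) (by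
      intro i
      have := hz i
      rw [h] at this
      simp only [Pi.sub_apply]
      linear_combination -this)
    linarith [this.2.2]

/-- An empty lattice tetrahedron of normalized volume `h` is, in a lattice basis, the one with
vertices `0, e₁, e₂, (x, y, h)`. Emptiness at height `j` is a condition on the residues of
`j * x` and `j * y` modulo `h`. -/
theorem EmptyTetrahedron.exists_residues {o a b c : Fin 3 → ℤ} (hT : EmptyTetrahedron o a b c)
    (hD : det3 (a - o) (b - o) (c - o) ≠ 0) :
    ∃ x y : ℤ, (∀ α β γ : ℤ, det3 (a - o) (b - o) (c - o) ∣ γ - α * x - β * y →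
        HasValues o a b c α β γ) ∧
      ∀ j, 0 < j → j < |det3 (a - o) (b - o) (c - o)| →
        |det3 (a - o) (b - o) (c - o)| < j + (j * -x) % |det3 (a - o) (b - o) (c - o)| +
          (j * -y) % |det3 (a - o) (b - o) (c - o)| := by
  obtain ⟨q, hq⟩ := (hT.emptyTriangle hD).exists_det3_eq_one (cross3_ne_zero_of_det3_ne_zero hD)
  obtain ⟨x, y, hc⟩ := exists_coords_of_det3_eq_one hq (c - o)
  set D := det3 (a - o) (b - o) (c - o) with hDdef
  refine ⟨x, y, ?_, ?_⟩
  · rintro α β γ ⟨k, hk⟩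
    obtain ⟨n, h1, h2, h3⟩ := exists_dot_eq_of_det3_eq_one hq α β k
    refine ⟨n, h1, h2, ?_⟩
    rw [dot3] at h1 h2 h3 ⊢
    rw [hc 0, hc 1, hc 2]
    linear_combination x * h1 + y * h2 + D * h3 - hk
  · intro j hj hjh
    set h := |D| with hh
    have hpos : 0 < h := abs_pos.2 hD
    obtain ⟨ε, hε⟩ : ∃ ε : ℤ, ε * h = D ∧ ε * ε = 1 := by
      rcases abs_choice D with h1 | h1
      · exact ⟨1, by rw [hh, h1]; ring, by ring⟩
      · exact ⟨-1, by rw [hh, h1]; ring, by ring⟩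
    by_contra hle
    push Not at hle
    have hA0 := Int.emod_nonneg (j * -x) hpos.ne'
    have hA1 := Int.emod_lt_of_pos (j * -x) hpos
    have hB0 := Int.emod_nonneg (j * -y) hpos.ne'
    have hB1 := Int.emod_lt_of_pos (j * -y) hpos
    have hA := Int.mul_ediv_add_emod (j * -x) h
    have hB := Int.mul_ediv_add_emod (j * -y) h
    set A := (j * -x) % h
    set B := (j * -y) % h
    -- the lattice point of the tetrahedron at height `j`
    have hz : ∀ i, h * (o i - (j * -x / h) * (a i - o i) - (j * -y / h) * (b i - o i) +
        j * ε * q i) = (h - A - B - j) * o i + A * a i + B * b i + j * c i := by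
      intro i
      have := hc i
      simp only [Pi.sub_apply] at this
      linear_combination (-j) * this + (j * q i) * hε.1 - (a i - o i) * hA - (b i - o i) * hB
    have := hT (h - A - B - j) A B j (by linarith) hA0 hB0 hj.le (by linarith)
      (fun i => o i - (j * -x / h) * (a i - o i) - (j * -y / h) * (b i - o i) + j * ε * q i)
      (by intro i; rw [← hz i]; ring)
    have key : ∀ s t u : ℤ, (∀ i, o i - (j * -x / h) * (a i - o i) - (j * -y / h) * (b i - o i) +
        j * ε * q i = o i + s * (a i - o i) + t * (b i - o i) + u * (c i - o i)) →
        A = h * s ∧ B = h * t ∧ j = h * u := by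
      intro s t u hi
      have := eq_zero_of_det3_ne_zero hD (α := A - h * s) (β := B - h * t) (γ := j - h * u) (by
        intro i
        have h1 := hz i
        rw [hi i] at h1
        simp only [Pi.sub_apply]
        linear_combination -h1)
      exact ⟨by linarith [this.1], by linarith [this.2.1], by linarith [this.2.2]⟩
    rcases this with h1 | h1 | h1 | h1
    · have := key 0 0 0 (fun i => by rw [congrFun h1 i]; ring)
      linarith [this.2.2]
    · have := key 1 0 0 (fun i => by rw [congrFun h1 i]; ring)
      linarith [this.1]
    · have := key 0 1 0 (fun i => by rw [congrFun h1 i]; ring)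
      linarith [this.2.1]
    · have := key 0 0 1 (fun i => by rw [congrFun h1 i]; ring)
      linarith [this.2.2]

/-- Common form of the consequences of emptiness: residues `r, s` of `-x, -y`. -/
theorem EmptyTetrahedron.exists_pos_residues {o a b c : Fin 3 → ℤ} (hT : EmptyTetrahedron o a b c)
    (hD : det3 (a - o) (b - o) (c - o) ≠ 0) :
    ∃ h r s : ℤ, h = |det3 (a - o) (b - o) (c - o)| ∧
      (∀ α β γ : ℤ, h ∣ γ + α * r + β * s → HasValues o a b c α β γ) ∧
      (1 < h → 0 < r ∧ r < h ∧ 0 < s ∧ s < h ∧ h < 1 + r + s ∧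
        (r = h - 1 ∨ s = h - 1 ∨ r + s = h)) := by
  obtain ⟨x, y, h1, h2⟩ := hT.exists_residues hD
  set h := |det3 (a - o) (b - o) (c - o)| with hh
  have hpos : 0 < h := abs_pos.2 hD
  have hr1 := Int.emod_lt_of_pos (-x) hpos
  have hs1 := Int.emod_lt_of_pos (-y) hpos
  have hr := Int.mul_ediv_add_emod (-x) h
  have hs := Int.mul_ediv_add_emod (-y) h
  refine ⟨h, (-x) % h, (-y) % h, rfl, ?_, ?_⟩
  · rintro α β γ ⟨k, hk⟩
    apply h1
    rw [← abs_dvd, ← hh]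
    exact ⟨k + α * (-x / h) + β * (-y / h), by linear_combination hk - α * hr - β * hs⟩
  · intro hgt
    have h3 := h2 1 one_pos hgt
    rw [one_mul, one_mul] at h3
    refine ⟨by linarith, hr1, by linarith, hs1, h3, ?_⟩
    apply terminal_residues h _ _ (by linarith) hr1 (by linarith) hs1
    intro j hj hjh
    have := h2 j hj hjh
    have e : ∀ t : ℤ, (j * (t % h)) % h = (j * t) % h := fun t => by
      rw [Int.mul_emod, Int.emod_emod_of_dvd _ (dvd_refl h), ← Int.mul_emod]
    rwa [e, e]

/-- **White's theorem**: an empty lattice tetrahedron has lattice width one, with two vertices on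
each of two consecutive lattice planes. -/
theorem EmptyTetrahedron.width_one {o a b c : Fin 3 → ℤ} (hT : EmptyTetrahedron o a b c)
    (hD : det3 (a - o) (b - o) (c - o) ≠ 0) :
    HasValues o a b c 0 1 1 ∨ HasValues o a b c 1 0 1 ∨ HasValues o a b c 1 1 0 := by
  obtain ⟨h, r, s, hh, hV, hrs⟩ := hT.exists_pos_residues hD
  have hpos : 0 < h := hh ▸ abs_pos.2 hD
  rcases (show 1 ≤ h from hpos).eq_or_lt with h1 | h1
  · exact Or.inl (hV _ _ _ (h1 ▸ one_dvd _))
  · obtain ⟨-, -, -, -, -, h2 | h2 | h2⟩ := hrs h1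
    · exact Or.inr (Or.inl (hV _ _ _ ⟨1, by linarith⟩))
    · exact Or.inl (hV _ _ _ ⟨1, by linarith⟩)
    · exact Or.inr (Or.inr (hV _ _ _ ⟨1, by linarith⟩))

/-- In normalized volume at most two all three patterns of White's theorem occur. -/
theorem EmptyTetrahedron.hasValues_of_dvd_two {o a b c : Fin 3 → ℤ}
    (hT : EmptyTetrahedron o a b c) (hD : det3 (a - o) (b - o) (c - o) ∣ 2) :
    HasValues o a b c 0 1 1 ∧ HasValues o a b c 1 0 1 ∧ HasValues o a b c 1 1 0 := by
  have hD0 : det3 (a - o) (b - o) (c - o) ≠ 0 := ne_zero_of_dvd_ne_zero two_ne_zero hD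
  obtain ⟨h, r, s, hh, hV, hrs⟩ := hT.exists_pos_residues hD0
  have hpos : 0 < h := hh ▸ abs_pos.2 hD0
  have hle : h ≤ 2 := Int.le_of_dvd two_pos (hh ▸ (abs_dvd _ _).2 hD)
  rcases (show 1 ≤ h from hpos).eq_or_lt with h1 | h1
  · exact ⟨hV _ _ _ (h1 ▸ one_dvd _), hV _ _ _ (h1 ▸ one_dvd _), hV _ _ _ (h1 ▸ one_dvd _)⟩
  · obtain ⟨e1, e2, e3, e4, -⟩ := hrs h1
    refine ⟨hV _ _ _ ⟨1, by omega⟩, hV _ _ _ ⟨1, by omega⟩, hV _ _ _ ⟨1, by omega⟩⟩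

/-- In normalized volume three, or one, at least two of the three patterns of White's theorem
occur. -/
theorem EmptyTetrahedron.hasValues_of_dvd_three {o a b c : Fin 3 → ℤ}
    (hT : EmptyTetrahedron o a b c) (hD : det3 (a - o) (b - o) (c - o) ∣ 3) :
    (HasValues o a b c 0 1 1 ∨ HasValues o a b c 1 0 1) ∧
      (HasValues o a b c 0 1 1 ∨ HasValues o a b c 1 1 0) ∧
      (HasValues o a b c 1 0 1 ∨ HasValues o a b c 1 1 0) := by
  have hD0 : det3 (a - o) (b - o) (c - o) ≠ 0 := ne_zero_of_dvd_ne_zero three_ne_zero hD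
  obtain ⟨h, r, s, hh, hV, hrs⟩ := hT.exists_pos_residues hD0
  have hpos : 0 < h := hh ▸ abs_pos.2 hD0
  have hd : h ∣ 3 := hh ▸ (abs_dvd _ _).2 hD
  have hle : h ≤ 3 := Int.le_of_dvd three_pos hd
  rcases (show 1 ≤ h from hpos).eq_or_lt with h1 | h1
  · exact ⟨Or.inl (hV _ _ _ (h1 ▸ one_dvd _)), Or.inl (hV _ _ _ (h1 ▸ one_dvd _)),
      Or.inl (hV _ _ _ (h1 ▸ one_dvd _))⟩
  · obtain ⟨e1, e2, e3, e4, e5, -⟩ := hrs h1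
    have h3 : h = 3 := by
      rcases (show h = 2 ∨ h = 3 by omega) with h3 | h3
      · rw [h3] at hd; norm_num at hd
      · exact h3
    subst h3
    rcases (show (r = 2 ∧ s = 2) ∨ (r = 1 ∧ s = 2) ∨ (r = 2 ∧ s = 1) by omega) with
      ⟨rfl, rfl⟩ | ⟨rfl, rfl⟩ | ⟨rfl, rfl⟩
    · have p1 := hV 0 1 1 ⟨1, by norm_num⟩
      have p2 := hV 1 0 1 ⟨1, by norm_num⟩
      exact ⟨Or.inl p1, Or.inl p1, Or.inl p2⟩
    · have p1 := hV 0 1 1 ⟨1, by norm_num⟩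
      have p2 := hV 1 1 0 ⟨1, by norm_num⟩
      exact ⟨Or.inl p1, Or.inl p1, Or.inr p2⟩
    · have p1 := hV 1 0 1 ⟨1, by norm_num⟩
      have p2 := hV 1 1 0 ⟨1, by norm_num⟩
      exact ⟨Or.inr p1, Or.inr p2, Or.inl p1⟩

theorem EmptyTetrahedron.hasValues_of_isUnit {o a b c : Fin 3 → ℤ}
    (hT : EmptyTetrahedron o a b c) (hD : IsUnit (det3 (a - o) (b - o) (c - o))) (α β γ : ℤ) :
    HasValues o a b c α β γ := by
  obtain ⟨x, y, h1, -⟩ := hT.exists_residues hD.ne_zero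
  exact h1 _ _ _ hD.dvd

/-! ### Boxes in integer terms -/

/-- Every nonzero integer functional takes two values on `A` that differ by at least two. -/
def Wide (A : Set (Fin 3 → ℤ)) : Prop :=
  ∀ n : Fin 3 → ℤ, n ≠ 0 → ∃ x ∈ A, ∃ y ∈ A, n ⬝ᵥ y + 2 ≤ n ⬝ᵥ x

/-- The value at `x` of the `i`-th of three affine functionals with linear parts `F` and
constant terms `k`. -/
def val (F : Fin 3 → Fin 3 → ℤ) (k : Fin 3 → ℤ) (i : Fin 3) (x : Fin 3 → ℤ) : ℤ :=
  F i ⬝ᵥ x + k i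

/-- The integer form of being boxed: the functional `i` takes values in `{0, 1}` on all points of
`A` except `v i`. -/
structure BoxedBy (A : Set (Fin 3 → ℤ)) (F : Fin 3 → Fin 3 → ℤ) (k : Fin 3 → ℤ)
    (v : Fin 3 → Fin 3 → ℤ) : Prop where
  mem : ∀ i, v i ∈ A
  inj : Function.Injective v
  bit : ∀ i, ∀ x ∈ A, x ≠ v i → val F k i x = 0 ∨ val F k i x = 1
  out : ∀ i, ¬(val F k i (v i) = 0 ∨ val F k i (v i) = 1)

/-- The points of `A` are boxed with respect to a unimodular parallelepiped. -/
def UnimodularlyBoxed (A : Set (Fin 3 → ℤ)) : Prop :=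
  ∃ F k v, BoxedBy A F k v ∧ IsUnit (det3 (F 0) (F 1) (F 2))

theorem val_combination (F : Fin 3 → Fin 3 → ℤ) (k : Fin 3 → ℤ) (i : Fin 3)
    {o a b c z : Fin 3 → ℤ} {w α β γ : ℤ}
    (hz : ∀ t, (w + α + β + γ) * z t = w * o t + α * a t + β * b t + γ * c t) :
    (w + α + β + γ) * val F k i z =
      w * val F k i o + α * val F k i a + β * val F k i b + γ * val F k i c := by
  simp only [val, dot3]
  linear_combination F i 0 * hz 0 + F i 1 * hz 1 + F i 2 * hz 2

theorem Wide.not_bit {A : Set (Fin 3 → ℤ)} (hW : Wide A) {n : Fin 3 → ℤ} (hn : n ≠ 0) (κ : ℤ) :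
    ¬ ∀ x ∈ A, n ⬝ᵥ x + κ = 0 ∨ n ⬝ᵥ x + κ = 1 := by
  intro h
  obtain ⟨x, hx, y, hy, hxy⟩ := hW n hn
  rcases h x hx with h1 | h1 <;> rcases h y hy with h2 | h2 <;> linarith

theorem ne_zero_of_det3_update {F : Fin 3 → Fin 3 → ℤ} {i : Fin 3} {n : Fin 3 → ℤ}
    (h : det3 (Function.update F i n 0) (Function.update F i n 1) (Function.update F i n 2) ≠ 0) :
    n ≠ 0 := by
  rintro rfl
  apply h
  fin_cases i <;> simp [det3]

/-- Replacing the functional `i` by another one that takes values in `{0, 1}` away from `v i`. -/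
theorem BoxedBy.update {A : Set (Fin 3 → ℤ)} {F k v} (hb : BoxedBy A F k v) (hW : Wide A)
    (i : Fin 3) (n : Fin 3 → ℤ) (κ : ℤ)
    (hn : ∀ x ∈ A, x ≠ v i → n ⬝ᵥ x + κ = 0 ∨ n ⬝ᵥ x + κ = 1)
    (hd : IsUnit (det3 (Function.update F i n 0) (Function.update F i n 1)
      (Function.update F i n 2))) : UnimodularlyBoxed A := by
  refine ⟨Function.update F i n, Function.update k i κ, v, ⟨hb.mem, hb.inj, ?_, ?_⟩, hd⟩
  · intro j x hx hxj
    rcases eq_or_ne j i with rfl | hj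
    · simpa [val] using hn x hx hxj
    · simpa [val, hj] using hb.bit j x hx hxj
  · intro j
    rcases eq_or_ne j i with rfl | hj
    · simp only [val, Function.update_self]
      intro h0
      refine hW.not_bit (ne_zero_of_det3_update hd.ne_zero) κ (fun x hx => ?_)
      by_cases hxj : x = v j
      · rwa [hxj]
      · exact hn x hx hxj
    · simpa [val, hj] using hb.out j

theorem BoxedBy.perm {A : Set (Fin 3 → ℤ)} {F k v} (hb : BoxedBy A F k v)
    (σ : Equiv.Perm (Fin 3)) : BoxedBy A (F ∘ σ) (k ∘ σ) (v ∘ σ) :=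
  ⟨fun _ => hb.mem _, hb.inj.comp σ.injective, fun i => hb.bit (σ i), fun i => hb.out (σ i)⟩

theorem abs_det3_perm (F : Fin 3 → Fin 3 → ℤ) {i j l : Fin 3} (hij : i ≠ j) (hil : i ≠ l)
    (hjl : j ≠ l) : |det3 (F i) (F j) (F l)| = |det3 (F 0) (F 1) (F 2)| := by
  have h : det3 (F i) (F j) (F l) = det3 (F 0) (F 1) (F 2) ∨
      det3 (F i) (F j) (F l) = -det3 (F 0) (F 1) (F 2) := by
    fin_cases i <;> fin_cases j <;> fin_cases l <;> simp at hij hil hjl <;>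
      first
        | (left; simp only [det3, Fin.zero_eta, Fin.mk_one, Fin.reduceFinMk] <;> ring1)
        | (right; simp only [det3, Fin.zero_eta, Fin.mk_one, Fin.reduceFinMk]; ring1)
  rcases h with h | h <;> rw [h]
  exact abs_neg _

/-- The plane coordinates `j, l` of the edge vectors `a - o` and `b - o` of a triangle in a plane
where the functional `i` is constant compute the determinant of the edge vectors. -/
theorem det3_mul_det3_of_val_eq (F : Fin 3 → Fin 3 → ℤ) (k : Fin 3 → ℤ) (i j l : Fin 3)
    {o a b : Fin 3 → ℤ} (c : Fin 3 → ℤ) (ha : val F k i a = val F k i o)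
    (hb : val F k i b = val F k i o) :
    det3 (F i) (F j) (F l) * det3 (a - o) (b - o) c =
      ((val F k j a - val F k j o) * (val F k l b - val F k l o) -
        (val F k j b - val F k j o) * (val F k l a - val F k l o)) * (F i ⬝ᵥ c) := by
  rw [det3_mul_det3]
  have e1 : F i ⬝ᵥ (a - o) = 0 := by
    simp only [val] at ha; rw [dotProduct_sub]; linarith
  have e2 : F i ⬝ᵥ (b - o) = 0 := by
    simp only [val] at hb; rw [dotProduct_sub]; linarith
  rw [e1, e2]
  simp only [val, det3, dotProduct_sub]
  simp
  ring

theorem eq_of_val_eq {F : Fin 3 → Fin 3 → ℤ} {k : Fin 3 → ℤ}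
    (hD : det3 (F 0) (F 1) (F 2) ≠ 0) {x y : Fin 3 → ℤ} (h : ∀ i, val F k i x = val F k i y) :
    x = y := by
  have hD' : det3 (fun i => F i 0) (fun i => F i 1) (fun i => F i 2) ≠ 0 := by
    intro h0; apply hD; rw [← h0]; simp only [det3]; ring
  have := eq_zero_of_det3_ne_zero hD' (α := x 0 - y 0) (β := x 1 - y 1) (γ := x 2 - y 2) (by
    intro i
    have := h i
    simp only [val, dot3] at this
    linear_combination this)
  funext t
  fin_cases t
  · exact sub_eq_zero.1 this.1
  · exact sub_eq_zero.1 this.2.1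
  · exact sub_eq_zero.1 this.2.2

theorem bits_det_eq {a b c d e f : ℤ} (ha : a = 0 ∨ a = 1) (hb : b = 0 ∨ b = 1)
    (hc : c = 0 ∨ c = 1) (hd : d = 0 ∨ d = 1) (he : e = 0 ∨ e = 1) (hf : f = 0 ∨ f = 1)
    (h1 : ¬(a = c ∧ b = d)) (h2 : ¬(a = e ∧ b = f)) (h3 : ¬(c = e ∧ d = f)) :
    (c - a) * (f - b) - (e - a) * (d - b) = 1 ∨ (c - a) * (f - b) - (e - a) * (d - b) = -1 := by
  rcases ha with rfl | rfl <;> rcases hb with rfl | rfl <;> rcases hc with rfl | rfl <;>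
    rcases hd with rfl | rfl <;> rcases he with rfl | rfl <;> rcases hf with rfl | rfl <;>
    simp at h1 h2 h3 ⊢

theorem fin_three_eq {i j l : Fin 3} (hij : i ≠ j) (hil : i ≠ l) (hjl : j ≠ l) (t : Fin 3) :
    t = i ∨ t = j ∨ t = l := by
  revert i j l t; decide

/-- Three points at vertices of a common facet of the parallelepiped form a unimodular triangle,
so the parallelepiped is unimodular. -/
theorem isUnit_of_three_in_facet {F : Fin 3 → Fin 3 → ℤ} {k : Fin 3 → ℤ}
    (hprim : ∀ i, ∃ c, F i ⬝ᵥ c = 1) (hD : det3 (F 0) (F 1) (F 2) ≠ 0) {i : Fin 3}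
    {s t r : Fin 3 → ℤ} (hst : s ≠ t) (hsr : s ≠ r) (htr : t ≠ r)
    (hs : ∀ i, val F k i s = 0 ∨ val F k i s = 1) (ht : ∀ i, val F k i t = 0 ∨ val F k i t = 1)
    (hr : ∀ i, val F k i r = 0 ∨ val F k i r = 1) (h1 : val F k i t = val F k i s)
    (h2 : val F k i r = val F k i s) : IsUnit (det3 (F 0) (F 1) (F 2)) := by
  obtain ⟨j, l, hij, hil, hjl⟩ : ∃ j l : Fin 3, i ≠ j ∧ i ≠ l ∧ j ≠ l := by
    clear h1 h2; revert i; decide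
  obtain ⟨c, hc⟩ := hprim i
  have key := det3_mul_det3_of_val_eq F k i j l c h1 h2
  rw [hc, mul_one] at key
  have hne : ∀ x y : Fin 3 → ℤ, x ≠ y → val F k i x = val F k i y →
      ¬(val F k j x = val F k j y ∧ val F k l x = val F k l y) := by
    rintro x y hxy hi ⟨hj, hl⟩
    apply hxy
    apply eq_of_val_eq hD (k := k)
    intro t
    rcases fin_three_eq hij hil hjl t with rfl | rfl | rfl <;> assumption
  have hu : IsUnit (det3 (F i) (F j) (F l)) := by
    have := bits_det_eq (hs j) (hs l) (ht j) (ht l) (hr j) (hr l) (hne s t hst h1.symm)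
      (hne s r hsr h2.symm) (hne t r htr (h1.trans h2.symm))
    rw [← key] at this
    have h3 : IsUnit (det3 (F i) (F j) (F l) * det3 (t - s) (r - s) c) := by
      rcases this with h | h <;> rw [h] <;> simp
    exact isUnit_of_mul_isUnit_left h3
  rw [Int.isUnit_iff_abs_eq] at hu ⊢
  rw [← hu]; exact (abs_det3_perm F hij hil hjl).symm

/-- A lattice triangle with vertices in `A` that lies in a facet plane of the parallelepiped and
contains no further vertex of the parallelepiped in `A` is degenerate or unimodular in its plane;
in the second case its area in the coordinates `j, l` is the index of the parallelepiped. -/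
theorem BoxedBy.triangle {A : Set (Fin 3 → ℤ)} {F k v} (hb : BoxedBy A F k v)
    (hA : LatticeConvex A) (hprim : ∀ i, ∃ c, F i ⬝ᵥ c = 1) {i j l : Fin 3} (hij : i ≠ j)
    (hil : i ≠ l) (hjl : j ≠ l) {o a b : Fin 3 → ℤ} (ho : o ∈ A) (ha : a ∈ A) (hbA : b ∈ A)
    (hia : val F k i a = val F k i o)
    (hib : val F k i b = val F k i o)
    (hU : ∀ z ∈ A, (∀ t, z ≠ v t) → val F k i z = val F k i o → z = o ∨ z = a ∨ z = b) {Δ : ℤ}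
    (hΔ : Δ = (val F k j a - val F k j o) * (val F k l b - val F k l o) -
        (val F k j b - val F k j o) * (val F k l a - val F k l o)) :
    Δ = 0 ∨ |Δ| = |det3 (F 0) (F 1) (F 2)| := by
  have key := fun c => det3_mul_det3_of_val_eq F k i j l c hia hib
  obtain ⟨c, hc⟩ := hprim i
  rw [← hΔ] at key
  have hkc := key c
  rw [hc, mul_one] at hkc
  by_cases hcr : cross3 (a - o) (b - o) = 0
  · left
    rw [← hkc, ← cross3_dot (a - o), hcr, zero_dotProduct, mul_zero]
  · right
    have hT : EmptyTriangle o a b := by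
      intro w α β hw hα hβ hpos z hz
      have hz' : ∀ i, (w + α + β + 0) * z i = w * o i + α * a i + β * b i + 0 * o i := by
        intro i; linear_combination hz i
      have hzA : z ∈ A := hA o ho a ha b hbA o ho w α β 0 hw hα hβ le_rfl (by linarith) z hz'
      have hval := fun t => val_combination F k t hz'
      have hzi : val F k i z = val F k i o := by
        have := hval i
        rw [hia, hib] at this
        have h2 : (w + α + β) * (val F k i z - val F k i o) = 0 := by linear_combination this
        rcases mul_eq_zero.1 h2 with h3 | h3 <;> linarith
      by_contra hne
      push Not at hne
      obtain ⟨n1, n2, n3⟩ := hne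
      -- the points `v t` are vertices of the convex hull, so `z` is none of them
      have hv : ∀ t, z ≠ v t := by
        rintro t rfl
        rcases hb.bit t o ho (Ne.symm n1) with b1 | b1 <;>
          rcases hb.bit t a ha (Ne.symm n2) with b2 | b2 <;>
          rcases hb.bit t b hbA (Ne.symm n3) with b3 | b3 <;>
          · have h4 := hval t
            rw [b1, b2, b3] at h4
            apply hb.out t
            have h5 : 0 ≤ (w + α + β) * val F k t (v t) := by linarith
            have h6 : (w + α + β) * val F k t (v t) ≤ (w + α + β) * 1 := by linarith
            have h7 := nonneg_of_mul_nonneg_right h5 hpos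
            have h8 := le_of_mul_le_mul_left h6 hpos
            omega
      rcases hU z hzA hv hzi with h | h | h
      · exact n1 h
      · exact n2 h
      · exact n3 h
    obtain ⟨q, hq⟩ := hT.exists_det3_eq_one hcr
    have hkq := key q
    rw [hq, mul_one] at hkq
    rw [← abs_det3_perm F hij hil hjl]
    have h1 : Δ ∣ det3 (F i) (F j) (F l) := ⟨_, hkq⟩
    have h2 : det3 (F i) (F j) (F l) ∣ Δ := ⟨_, hkc.symm⟩
    rw [Int.abs_eq_natAbs, Int.abs_eq_natAbs, Nat.dvd_antisymm (Int.natAbs_dvd_natAbs.2 h1)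
      (Int.natAbs_dvd_natAbs.2 h2)]

/-! ### Boxes of index at least two and the exchange of a functional -/

/-- An integer-valued function on `ℤ³` that is affine with integer coefficients. -/
def IsIntAffine (h : (Fin 3 → ℤ) → ℤ) : Prop :=
  ∃ n κ, ∀ x, h x = n ⬝ᵥ x + κ

theorem isIntAffine_const (c : ℤ) : IsIntAffine fun _ => c :=
  ⟨0, c, fun x => by simp⟩

theorem isIntAffine_val (F : Fin 3 → Fin 3 → ℤ) (k : Fin 3 → ℤ) (i : Fin 3) :
    IsIntAffine (val F k i) :=
  ⟨F i, k i, fun _ => rfl⟩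

theorem IsIntAffine.add {g h : (Fin 3 → ℤ) → ℤ} (hg : IsIntAffine g) (hh : IsIntAffine h) :
    IsIntAffine fun x => g x + h x := by
  obtain ⟨n, κ, h1⟩ := hg
  obtain ⟨n', κ', h2⟩ := hh
  exact ⟨n + n', κ + κ', fun x => by simp only [h1, h2, add_dotProduct]; ring⟩

theorem IsIntAffine.const_mul {g : (Fin 3 → ℤ) → ℤ} (hg : IsIntAffine g) (c : ℤ) :
    IsIntAffine fun x => c * g x := by
  obtain ⟨n, κ, h1⟩ := hg
  exact ⟨c • n, c * κ, fun x => by simp only [h1, smul_dotProduct, smul_eq_mul]; ring⟩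

theorem IsIntAffine.det3_sub (a b o : Fin 3 → ℤ) : IsIntAffine fun x => det3 a b (x - o) :=
  ⟨cross3 a b, -(cross3 a b ⬝ᵥ o), fun x => by simp only [← cross3_dot, dotProduct_sub]; ring⟩

/-- A set of lattice points of width at least two, containing the lattice points of its convex
hull, that is boxed with respect to a parallelepiped of index at least two. -/
structure ProperBox (A : Set (Fin 3 → ℤ)) (F : Fin 3 → Fin 3 → ℤ) (k : Fin 3 → ℤ)
    (v : Fin 3 → Fin 3 → ℤ) : Prop extends BoxedBy A F k v where
  wide : Wide A
  conv : LatticeConvex A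
  prim : ∀ i, ∃ c, F i ⬝ᵥ c = 1
  two_le : 2 ≤ |det3 (F 0) (F 1) (F 2)|

section ProperBox

variable {A : Set (Fin 3 → ℤ)} {F : Fin 3 → Fin 3 → ℤ} {k : Fin 3 → ℤ} {v : Fin 3 → Fin 3 → ℤ}

theorem ProperBox.det_ne_zero (hb : ProperBox A F k v) : det3 (F 0) (F 1) (F 2) ≠ 0 := by
  intro h
  have := hb.two_le
  rw [h] at this
  norm_num at this

theorem ProperBox.not_isUnit (hb : ProperBox A F k v) : ¬ IsUnit (det3 (F 0) (F 1) (F 2)) := by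
  rw [Int.isUnit_iff_abs_eq]
  have := hb.two_le
  omega

theorem ProperBox.perm (hb : ProperBox A F k v) (σ : Equiv.Perm (Fin 3)) :
    ProperBox A (F ∘ σ) (k ∘ σ) (v ∘ σ) := by
  refine ⟨hb.toBoxedBy.perm σ, hb.wide, hb.conv, fun i => hb.prim _, ?_⟩
  have h : ∀ i j : Fin 3, i ≠ j → σ i ≠ σ j := fun i j hij h => hij (σ.injective h)
  have := abs_det3_perm F (h 0 1 (by decide)) (h 0 2 (by decide)) (h 1 2 (by decide))
  simpa [this] using hb.two_le

/-- Replacing chosen functionals `f` by `1 - f` gives the same parallelepiped. -/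
theorem ProperBox.flip (hb : ProperBox A F k v) (ε : Fin 3 → Bool) :
    ProperBox A (fun i => if ε i then -F i else F i) (fun i => if ε i then 1 - k i else k i) v := by
  have hv : ∀ i x, val (fun i => if ε i then -F i else F i) (fun i => if ε i then 1 - k i else k i)
      i x = if ε i then 1 - val F k i x else val F k i x := by
    intro i x
    simp only [val]
    split_ifs
    · rw [neg_dotProduct]; ring
    · rfl
  refine ⟨⟨hb.mem, hb.inj, ?_, ?_⟩, hb.wide, hb.conv, ?_, ?_⟩
  · intro i x hx hxi
    rw [hv]
    have := hb.bit i x hx hxi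
    split_ifs <;> omega
  · intro i
    rw [hv]
    have := hb.out i
    split_ifs <;> omega
  · intro i
    obtain ⟨c, hc⟩ := hb.prim i
    by_cases h : ε i
    · exact ⟨-c, by simp [h, hc]⟩
    · exact ⟨c, by simp [h, hc]⟩
  · have h2 := hb.two_le
    convert h2 using 1
    rw [abs_eq_abs]
    cases ε 0 <;> cases ε 1 <;> cases ε 2 <;> simp only [det3, if_true, if_false, Pi.neg_apply,
      Bool.false_eq_true, true_or] <;>
      first
        | (left; ring1)
        | (right; ring1)

/-- Replacing the functional `i` by an integer functional `h` with values in `{0, 1}` away from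
`v i`, where the coefficient of `h` at that functional is `± 1` over the index: the new
parallelepiped is unimodular. -/
theorem ProperBox.swap (hb : ProperBox A F k v) (i : Fin 3) {h : (Fin 3 → ℤ) → ℤ}
    (hh : IsIntAffine h) (p : Fin 3 → ℤ) (c e : ℤ) (he : |e| = |det3 (F 0) (F 1) (F 2)|)
    (hp : IsUnit (p i)) (heq : ∀ x, e * h x = ∑ j, p j * val F k j x + c)
    (hbit : ∀ x ∈ A, x ≠ v i → h x = 0 ∨ h x = 1) : UnimodularlyBoxed A := by
  obtain ⟨n, κ, hn⟩ := hh
  refine hb.toBoxedBy.update hb.wide i n κ (fun x hx hxi => by rw [← hn]; exact hbit x hx hxi) ?_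
  have hlin : ∀ t, e * n t = p 0 * F 0 t + p 1 * F 1 t + p 2 * F 2 t := by
    intro t
    have h0 := heq 0
    have h1 := heq (Pi.single t 1)
    simp [hn, val, Fin.sum_univ_three] at h0 h1
    linear_combination h1 - h0
  have h0 := hlin 0
  have h1 := hlin 1
  have h2 := hlin 2
  have he0 : e ≠ 0 := by
    rintro rfl
    have := hb.two_le
    rw [← he] at this
    norm_num at this
  have key : e * det3 (Function.update F i n 0) (Function.update F i n 1) (Function.update F i n 2) =
      p i * det3 (F 0) (F 1) (F 2) := by
    fin_cases i <;> simp [det3]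
    · linear_combination (F 1 1 * F 2 2 - F 1 2 * F 2 1) * h0 - (F 1 0 * F 2 2 - F 1 2 * F 2 0) * h1 +
        (F 1 0 * F 2 1 - F 1 1 * F 2 0) * h2
    · linear_combination (F 2 1 * F 0 2 - F 2 2 * F 0 1) * h0 - (F 2 0 * F 0 2 - F 2 2 * F 0 0) * h1 +
        (F 2 0 * F 0 1 - F 2 1 * F 0 0) * h2
    · linear_combination (F 0 1 * F 1 2 - F 0 2 * F 1 1) * h0 - (F 0 0 * F 1 2 - F 0 2 * F 1 0) * h1 +
        (F 0 0 * F 1 1 - F 0 1 * F 1 0) * h2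
  rw [Int.isUnit_iff_abs_eq] at hp ⊢
  have h3 := congrArg abs key
  rw [abs_mul, abs_mul, hp, one_mul, ← he] at h3
  have := abs_pos.2 he0
  nlinarith

/-- Lattice convexity, with the convex combination read off from the three functionals. -/
theorem ProperBox.mem_of_val (hb : ProperBox A F k v) {o a b c z : Fin 3 → ℤ} (ho : o ∈ A)
    (ha : a ∈ A) (hbA : b ∈ A) (hc : c ∈ A) (w α β γ : ℤ) (hw : 0 ≤ w) (hα : 0 ≤ α) (hβ : 0 ≤ β)
    (hγ : 0 ≤ γ) (hpos : 0 < w + α + β + γ) (hz : ∀ i, (w + α + β + γ) * val F k i z =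
      w * val F k i o + α * val F k i a + β * val F k i b + γ * val F k i c) : z ∈ A := by
  refine hb.conv o ho a ha b hbA c hc w α β γ hw hα hβ hγ hpos z ?_
  set r : Fin 3 → ℤ := fun t => (w + α + β + γ) * z t - (w * o t + α * a t + β * b t + γ * c t)
    with hr
  have h0 : ∀ i, F i ⬝ᵥ r = 0 := by
    intro i
    have := hz i
    simp only [val, dot3] at this
    simp only [dot3, hr]
    linear_combination this
  have : r = 0 := by
    have h1 := eq_of_val_eq (k := 0) hb.det_ne_zero (x := r) (y := 0) (by intro i; simp [val, h0])
    exact h1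
  intro t
  have h1 := congrFun this t
  simp only [hr, Pi.zero_apply] at h1
  linarith

/-- At most two points of `A` other than the `v i` lie in a common facet: three of them form a
unimodular triangle, which forces the index to be one. -/
theorem ProperBox.facet (hb : ProperBox A F k v) {i : Fin 3} {s t r : Fin 3 → ℤ} (hst : s ≠ t)
    (hs : ∀ i, val F k i s = 0 ∨ val F k i s = 1) (ht : ∀ i, val F k i t = 0 ∨ val F k i t = 1)
    (hr : ∀ i, val F k i r = 0 ∨ val F k i r = 1) (h1 : val F k i t = val F k i s)
    (h2 : val F k i r = val F k i s) : r = s ∨ r = t := by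
  by_contra! h
  exact hb.not_isUnit (isUnit_of_three_in_facet hb.prim hb.det_ne_zero hst h.1.symm h.2.symm hs ht
    hr h1 h2)

theorem ProperBox.bits (hb : ProperBox A F k v) {z : Fin 3 → ℤ} (hz : z ∈ A)
    (hv : ∀ t, z ≠ v t) (i : Fin 3) : val F k i z = 0 ∨ val F k i z = 1 :=
  hb.bit i z hz (hv i)

/-- The case of `BoxedBy.triangle` in which two of the three points are vertices of the
parallelepiped. By `ProperBox.facet` the plane contains no further vertex in `A`. -/
theorem ProperBox.triangle (hb : ProperBox A F k v) {i j l : Fin 3} (hij : i ≠ j)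
    (hil : i ≠ l) (hjl : j ≠ l) {o a b : Fin 3 → ℤ} (ho : o ∈ A) (ha : a ∈ A) (hbA : b ∈ A)
    (hoa : o ≠ a) (hoU : ∀ i, val F k i o = 0 ∨ val F k i o = 1)
    (haU : ∀ i, val F k i a = 0 ∨ val F k i a = 1)
    (hia : val F k i a = val F k i o)
    (hib : val F k i b = val F k i o) :
    (val F k j a - val F k j o) * (val F k l b - val F k l o) -
        (val F k j b - val F k j o) * (val F k l a - val F k l o) = 0 ∨
      |(val F k j a - val F k j o) * (val F k l b - val F k l o) -
        (val F k j b - val F k j o) * (val F k l a - val F k l o)| =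
          |det3 (F 0) (F 1) (F 2)| := by
  refine hb.toBoxedBy.triangle hb.conv hb.prim hij hil hjl ho ha hbA hia hib ?_ rfl
  intro z hz hv hzi
  rcases hb.facet hoa hoU haU (hb.bits hz hv) hia hzi with h | h
  · exact Or.inl h
  · exact Or.inr (Or.inl h)

end ProperBox

/-! ### Three vertices, two of them on an edge -/

theorem abs_le_one_of_mul_eq {D γ Δ : ℤ} (hD : D ≠ 0) (h : Δ = D * γ) (hΔ : Δ = 0 ∨ |Δ| = |D|) :
    γ = 0 ∨ γ = 1 ∨ γ = -1 := by
  subst h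
  rcases hΔ with h | h
  · exact Or.inl ((mul_eq_zero.1 h).resolve_left hD)
  · rw [abs_mul] at h
    have h1 : |D| * (|γ| - 1) = 0 := by linarith
    have h2 := (mul_eq_zero.1 h1).resolve_left (abs_pos.2 hD).ne'
    rcases abs_cases γ with h3 | h3 <;> omega

section ProperBox

variable {A : Set (Fin 3 → ℤ)} {F : Fin 3 → Fin 3 → ℤ} {k : Fin 3 → ℤ} {v : Fin 3 → Fin 3 → ℤ}

theorem ne_of_val_ne {i : Fin 3} {x y : Fin 3 → ℤ} (h : val F k i x ≠ val F k i y) : x ≠ y :=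
  fun e => h (congrArg _ e)

/-- The vertices `(0, 0, 1)`, `(1, 1, 0)`, `(1, 1, 1)` of the parallelepiped belong to `A`. They
span the plane where the functionals `0` and `1` agree, and their difference is the index times an
integer functional `g`. This `g` can replace one of the two as soon as it is small at the
exceptional point of the other. -/
theorem ProperBox.unimodularlyBoxed_of_edge (hb : ProperBox A F k v) {s t r : Fin 3 → ℤ}
    (hs : s ∈ A) (ht : t ∈ A) (hr : r ∈ A) (s0 : val F k 0 s = 0) (s1 : val F k 1 s = 0)
    (s2 : val F k 2 s = 1) (t0 : val F k 0 t = 1) (t1 : val F k 1 t = 1) (t2 : val F k 2 t = 0)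
    (r0 : val F k 0 r = 1) (r1 : val F k 1 r = 1) (r2 : val F k 2 r = 1) :
    UnimodularlyBoxed A := by
  have hsU : ∀ i, val F k i s = 0 ∨ val F k i s = 1 := by
    intro i; fin_cases i <;> simp [s0, s1, s2]
  have htU : ∀ i, val F k i t = 0 ∨ val F k i t = 1 := by
    intro i; fin_cases i <;> simp [t0, t1, t2]
  have hrU : ∀ i, val F k i r = 0 ∨ val F k i r = 1 := by
    intro i; fin_cases i <;> simp [r0, r1, r2]
  have hD := hb.det_ne_zero
  have h2D := hb.two_le
  obtain ⟨g, hga, hg⟩ : ∃ g, IsIntAffine g ∧ ∀ x, det3 (F 0) (F 1) (F 2) * g x =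
      val F k 1 x - val F k 0 x := by
    refine ⟨_, IsIntAffine.det3_sub (r - t) (r - s) s, fun x => ?_⟩
    rw [det3_mul_det3]
    simp only [val] at s0 s1 s2 t0 t1 t2 r0 r1 r2 ⊢
    have e : ∀ i a b, F i ⬝ᵥ (a - b) = (F i ⬝ᵥ a + k i) - (F i ⬝ᵥ b + k i) := by
      intro i a b; rw [dotProduct_sub]; ring
    simp only [e, s0, s1, s2, t0, t1, t2, r0, r1, r2]
    simp [det3]
    ring
  set D := det3 (F 0) (F 1) (F 2) with hDdef
  have hgneg : IsIntAffine fun x => (-1) * g x := hga.const_mul _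
  have hsmall : ∀ x ∈ A, x ≠ v 0 → x ≠ v 1 → g x = 0 := by
    intro x hx hx0 hx1
    by_contra hne
    have h1 := hg x
    have h2 : |D| * |g x| ≤ 1 := by
      rw [← abs_mul, h1, abs_le]
      rcases hb.bit 0 x hx hx0 with h | h <;> rcases hb.bit 1 x hx hx1 with h' | h' <;>
        rw [h, h'] <;> norm_num
    have h3 := Int.one_le_abs hne
    nlinarith
  -- an exchange is possible as soon as `g` is small at one of `v 0`, `v 1`
  have hswap : ∀ i j : Fin 3, (i = 0 ∧ j = 1 ∨ i = 1 ∧ j = 0) →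
      (g (v j) = 0 ∨ g (v j) = 1 ∨ g (v j) = -1) → UnimodularlyBoxed A := by
    intro i j hij hj
    have hx : ∀ x ∈ A, x ≠ v i → x = v j ∨ g x = 0 := by
      intro x hx hxi
      by_cases hxj : x = v j
      · exact Or.inl hxj
      · right
        rcases hij with ⟨rfl, rfl⟩ | ⟨rfl, rfl⟩
        · exact hsmall x hx hxi hxj
        · exact hsmall x hx hxj hxi
    have hu : IsUnit (![-1, 1, 0] i : ℤ) ∧ IsUnit (![1, -1, 0] i : ℤ) := by
      rcases hij with ⟨rfl, rfl⟩ | ⟨rfl, rfl⟩ <;> simp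
    by_cases h1 : g (v j) = -1
    · refine hb.swap i hgneg ![1, -1, 0] 0 D rfl hu.2 (fun x => ?_) (fun x hxA hxi => ?_)
      · simp only [Fin.sum_univ_three]
        simp
        linear_combination -(hg x)
      · rcases hx x hxA hxi with rfl | h
        · simp [h1]
        · simp [h]
    · refine hb.swap i hga ![-1, 1, 0] 0 D rfl hu.1 (fun x => ?_) (fun x hxA hxi => ?_)
      · simp only [Fin.sum_univ_three]
        simp
        linear_combination (hg x)
      · rcases hx x hxA hxi with rfl | h
        · rcases hj with h | h | h
          · exact Or.inl h
          · exact Or.inr h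
          · exact absurd h h1
        · exact Or.inl h
  have hst : s ≠ r := ne_of_val_ne (i := 0) (by rw [s0, r0]; norm_num)
  have htr : t ≠ r := ne_of_val_ne (i := 2) (by rw [t2, r2]; norm_num)
  -- a vertex in the upper facet
  have hup : ∀ j, val F k 2 (v j) = 1 → g (v j) = 0 ∨ g (v j) = 1 ∨ g (v j) = -1 := by
    intro j hj
    refine abs_le_one_of_mul_eq hD ?_ (hb.triangle (i := 2) (j := 0) (l := 1) (by decide) (by decide)
      (by decide) hs hr (hb.mem j) hst hsU hrU (by rw [s2, r2]) (by rw [s2, hj]))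
    rw [hg, s0, s1, r0, r1]; ring
  by_cases h01 : val F k 2 (v 1) = 1
  · exact hswap 0 1 (by simp) (hup 1 h01)
  by_cases h00 : val F k 2 (v 0) = 1
  · exact hswap 1 0 (by simp) (hup 0 h00)
  have hne : ∀ i j : Fin 3, i ≠ j → v i ≠ v j := fun i j h e => h (hb.inj e)
  have h01' := (hb.bit 2 _ (hb.mem 1) (hne 1 2 (by decide))).resolve_right h01
  have h00' := (hb.bit 2 _ (hb.mem 0) (hne 0 2 (by decide))).resolve_right h00
  by_cases hy : ∃ y ∈ A, val F k 0 y = 0 ∧ val F k 1 y = 0 ∧ val F k 2 y = 0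
  · obtain ⟨y, hyA, y0, y1, y2⟩ := hy
    refine hswap 0 1 (by simp) ?_
    refine abs_le_one_of_mul_eq hD ?_ (hb.triangle (i := 2) (j := 0) (l := 1) (by decide) (by decide)
      (by decide) hyA ht (hb.mem 1) (ne_of_val_ne (i := 0) (by rw [y0, t0]; norm_num))
      (by intro i; fin_cases i <;> simp [y0, y1, y2]) htU (by rw [y2, t2]) (by rw [y2, h01']))
    rw [hg, y0, y1, t0, t1]; ring
  · push Not at hy
    have htri := hb.toBoxedBy.triangle hb.conv hb.prim (i := 2) (j := 0) (l := 1) (by decide)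
      (by decide) (by decide) ht (hb.mem 0) (hb.mem 1) (by rw [h00', t2]) (by rw [h01', t2])
      (by
        intro z hz hv hz2
        have hzU := hb.bits hz hv
        left
        rw [t2] at hz2
        by_cases hz0 : val F k 0 z = 1
        · rcases hb.facet (i := 0) htr htU hrU hzU (by rw [t0, r0]) (by rw [hz0, t0]) with h | h
          · exact h
          · exfalso; rw [h, r2] at hz2; norm_num at hz2
        by_cases hz1 : val F k 1 z = 1
        · rcases hb.facet (i := 1) htr htU hrU hzU (by rw [t1, r1]) (by rw [hz1, t1]) with h | h
          · exact h
          · exfalso; rw [h, r2] at hz2; norm_num at hz2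
        exact absurd hz2 (hy z hz ((hzU 0).resolve_right hz0) ((hzU 1).resolve_right hz1))) rfl
    by_cases hs1 : g (v 1) = 0 ∨ g (v 1) = 1 ∨ g (v 1) = -1
    · exact hswap 0 1 (by simp) hs1
    by_cases hs0 : g (v 0) = 0 ∨ g (v 0) = 1 ∨ g (v 0) = -1
    · exact hswap 1 0 (by simp) hs0
    exfalso
    -- both `v 0` and `v 1` are far away, so the triangle `t`, `v 0`, `v 1` is too large
    have b0 := hb.bit 0 _ (hb.mem 1) (hne 1 0 (by decide))
    have b1 := hb.bit 1 _ (hb.mem 0) (hne 0 1 (by decide))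
    have g0 := hg (v 0)
    have g1 := hg (v 1)
    have l0 : 2 ≤ |g (v 0)| := by rcases abs_cases (g (v 0)) with h | h <;> omega
    have l1 : 2 ≤ |g (v 1)| := by rcases abs_cases (g (v 1)) with h | h <;> omega
    have L0 : 2 * |D| ≤ |val F k 1 (v 0) - val F k 0 (v 0)| := by
      rw [← g0, abs_mul]; nlinarith [abs_nonneg D]
    have L1 : 2 * |D| ≤ |val F k 1 (v 1) - val F k 0 (v 1)| := by
      rw [← g1, abs_mul]; nlinarith [abs_nonneg D]
    rw [t0, t1] at htri
    generalize val F k 0 (v 0) = p at *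
    generalize val F k 1 (v 0) = b at *
    generalize val F k 0 (v 1) = c at *
    generalize val F k 1 (v 1) = q at *
    generalize |D| = m at *
    have P : 2 * m - 1 ≤ |p - 1| := by
      rcases abs_cases (b - p) with h | h <;> rcases abs_cases (p - 1) with h' | h' <;> omega
    have Q : 2 * m - 1 ≤ |q - 1| := by
      rcases abs_cases (q - c) with h | h <;> rcases abs_cases (q - 1) with h' | h' <;> omega
    have hPQ : (2 * m - 1) * (2 * m - 1) ≤ |(p - 1) * (q - 1)| := by
      rw [abs_mul]; exact mul_le_mul P Q (by linarith) (abs_nonneg _)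
    have hcb : 0 ≤ (c - 1) * (b - 1) ∧ (c - 1) * (b - 1) ≤ 1 := by
      rcases b0 with rfl | rfl <;> rcases b1 with rfl | rfl <;> norm_num
    have hle : |(p - 1) * (q - 1) - (c - 1) * (b - 1)| ≤ m := by
      rcases htri with h | h
      · rw [h]; simp; linarith
      · exact h.le
    rw [abs_le] at hle
    rcases abs_cases ((p - 1) * (q - 1)) with h | h <;> nlinarith

end ProperBox

/-! ### Tripods: three vertices, no two of them on an edge -/

/-- A proper box for which `A` contains the three vertices `u i` of the parallelepiped at which
exactly the functional `i` vanishes. The plane through them is the zero plane of the integer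
functional `g`. -/
structure Tripod (A : Set (Fin 3 → ℤ)) (F : Fin 3 → Fin 3 → ℤ) (k : Fin 3 → ℤ)
    (v u : Fin 3 → Fin 3 → ℤ) (g : (Fin 3 → ℤ) → ℤ) : Prop extends ProperBox A F k v where
  u_mem : ∀ i, u i ∈ A
  u_val : ∀ i j, val F k j (u i) = if j = i then 0 else 1
  affine : IsIntAffine g
  g_eq : ∀ x, |det3 (F 0) (F 1) (F 2)| * g x = ∑ j, val F k j x - 2

section Tripod

variable {A : Set (Fin 3 → ℤ)} {F : Fin 3 → Fin 3 → ℤ} {k : Fin 3 → ℤ} {v u : Fin 3 → Fin 3 → ℤ}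
  {g : (Fin 3 → ℤ) → ℤ}

theorem ProperBox.exists_tripod (hb : ProperBox A F k v) (hu : ∀ i, u i ∈ A)
    (huv : ∀ i j, val F k j (u i) = if j = i then 0 else 1) : ∃ g, Tripod A F k v u g := by
  have hg := fun x => det3_mul_det3 (F 0) (F 1) (F 2) (u 0 - u 2) (u 1 - u 2) (x - u 2)
  have e : ∀ i a b, F i ⬝ᵥ (a - b) = val F k i a - val F k i b := by
    intro i a b; simp only [val]; rw [dotProduct_sub]; ring
  have ha := IsIntAffine.det3_sub (u 0 - u 2) (u 1 - u 2) (u 2)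
  have hg' : ∀ x, det3 (F 0) (F 1) (F 2) * det3 (u 0 - u 2) (u 1 - u 2) (x - u 2) =
      ∑ j, val F k j x - 2 := by
    intro x
    rw [hg]
    simp only [e, huv, Fin.sum_univ_three]
    simp [det3]
    ring
  rcases abs_choice (det3 (F 0) (F 1) (F 2)) with h | h
  · exact ⟨_, hb, hu, huv, ha, fun x => by rw [h]; exact hg' x⟩
  · refine ⟨_, hb, hu, huv, ha.const_mul (-1), fun x => ?_⟩
    rw [h, ← hg' x]
    ring

theorem Tripod.perm (T : Tripod A F k v u g) (σ : Equiv.Perm (Fin 3)) :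
    Tripod A (F ∘ σ) (k ∘ σ) (v ∘ σ) (u ∘ σ) g := by
  refine ⟨T.toProperBox.perm σ, fun i => T.u_mem _, fun i j => ?_, T.affine, fun x => ?_⟩
  · have := T.u_val (σ i) (σ j)
    simpa [val] using this
  · have h : ∀ i j : Fin 3, i ≠ j → σ i ≠ σ j := fun i j hij h => hij (σ.injective h)
    have h1 := abs_det3_perm F (h 0 1 (by decide)) (h 0 2 (by decide)) (h 1 2 (by decide))
    have h2 := T.g_eq x
    rw [← h1, ← Equiv.sum_comp σ] at h2
    exact h2

theorem Tripod.g_eq' (T : Tripod A F k v u g) {i j l : Fin 3} (hij : i ≠ j) (hil : i ≠ l)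
    (hjl : j ≠ l) (x : Fin 3 → ℤ) : |det3 (F 0) (F 1) (F 2)| * g x =
      val F k i x + val F k j x + val F k l x - 2 := by
  rw [T.g_eq, Fin.sum_univ_three]
  fin_cases i <;> fin_cases j <;> fin_cases l <;> simp at hij hil hjl ⊢ <;> ring

theorem Tripod.u_self (T : Tripod A F k v u g) (i : Fin 3) : val F k i (u i) = 0 := by
  simp [T.u_val]

theorem Tripod.u_of_ne (T : Tripod A F k v u g) {i j : Fin 3} (h : j ≠ i) :
    val F k j (u i) = 1 := by
  simp [T.u_val, h]

theorem Tripod.u_bits (T : Tripod A F k v u g) (i j : Fin 3) :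
    val F k j (u i) = 0 ∨ val F k j (u i) = 1 := by
  rw [T.u_val]; split_ifs <;> simp

theorem Tripod.u_ne (T : Tripod A F k v u g) {i j : Fin 3} (h : i ≠ j) : u i ≠ u j :=
  ne_of_val_ne (i := i) (by rw [T.u_self, T.u_of_ne h]; norm_num)

theorem Tripod.v_bit (T : Tripod A F k v u g) {i j : Fin 3} (h : i ≠ j) :
    val F k j (v i) = 0 ∨ val F k j (v i) = 1 :=
  T.bit j _ (T.mem i) fun e => h (T.inj e)

/-- A vertex of the parallelepiped in `A` is one of the `u i` or the vertex opposite to their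
common neighbour, since no facet contains three vertices in `A`. -/
theorem Tripod.mem_cases (T : Tripod A F k v u g) {z : Fin 3 → ℤ} (hz : z ∈ A)
    (hv : ∀ t, z ≠ v t) : (∃ i, z = u i) ∨ ∀ i, val F k i z = 0 := by
  have hU := T.bits hz hv
  by_cases h : ∃ i, val F k i z = 1
  · obtain ⟨i, hi⟩ := h
    obtain ⟨j, l, hij, hil, hjl⟩ : ∃ j l : Fin 3, i ≠ j ∧ i ≠ l ∧ j ≠ l := by
      clear hi; revert i; decide
    left
    rcases T.facet (T.u_ne hjl) (T.u_bits j) (T.u_bits l) hU (i := i)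
      (by rw [T.u_of_ne hij, T.u_of_ne hil]) (by rw [T.u_of_ne hij, hi]) with h | h
    · exact ⟨j, h⟩
    · exact ⟨l, h⟩
  · push Not at h
    exact Or.inr fun i => (hU i).resolve_right (h i)

theorem Tripod.g_u (T : Tripod A F k v u g) (i : Fin 3) : g (u i) = 0 := by
  obtain ⟨j, l, hij, hil, hjl⟩ : ∃ j l : Fin 3, i ≠ j ∧ i ≠ l ∧ j ≠ l := by
    revert i; decide
  have := T.g_eq' hij hil hjl (u i)
  rw [T.u_self, T.u_of_ne hij.symm, T.u_of_ne hil.symm] at this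
  exact (mul_eq_zero.1 (this.trans (by norm_num))).resolve_left (by linarith [T.two_le])

/-- An exchange with a functional that is an integer combination of the box functionals
and `g`. -/
theorem Tripod.swap (T : Tripod A F k v u g) (l : Fin 3) (a : Fin 3 → ℤ) (b c : ℤ)
    (hp : IsUnit (|det3 (F 0) (F 1) (F 2)| * a l + b))
    (hu : ∀ i, ∑ j, a j - a i + c = 0 ∨ ∑ j, a j - a i + c = 1)
    (hv : ∀ t, t ≠ l → ∑ j, a j * val F k j (v t) + b * g (v t) + c = 0 ∨
      ∑ j, a j * val F k j (v t) + b * g (v t) + c = 1)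
    (hy : ∀ y ∈ A, (∀ i, val F k i y = 0) → b * g y + c = 0 ∨ b * g y + c = 1) :
    UnimodularlyBoxed A := by
  refine T.toProperBox.swap l (h := fun x => ∑ j, a j * val F k j x + b * g x + c) ?_
    (fun j => |det3 (F 0) (F 1) (F 2)| * a j + b) (|det3 (F 0) (F 1) (F 2)| * c - 2 * b)
    |det3 (F 0) (F 1) (F 2)| (abs_abs _) hp ?_ ?_
  · simp only [Fin.sum_univ_three]
    exact (((((isIntAffine_val F k 0).const_mul _).add ((isIntAffine_val F k 1).const_mul _)).add
      ((isIntAffine_val F k 2).const_mul _)).add (T.affine.const_mul _)).add (isIntAffine_const c)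
  · intro x
    have := T.g_eq x
    simp only [Fin.sum_univ_three] at this ⊢
    linear_combination b * this
  · intro x hx hxl
    by_cases hxv : ∃ t, x = v t
    · obtain ⟨t, rfl⟩ := hxv
      exact hv t fun e => hxl (by rw [e])
    · push Not at hxv
      rcases T.mem_cases hx hxv with ⟨i, rfl⟩ | h
      · have h1 := hu i
        have h2 : ∑ j, a j * val F k j (u i) + b * g (u i) + c = ∑ j, a j - a i + c := by
          rw [T.g_u]
          simp only [T.u_val, Fin.sum_univ_three]
          fin_cases i <;> simp <;> ring
        simpa only [h2] using h1
      · simpa [h] using hy x hx h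

/-- A point `v i` in the upper facet of another functional lies on a plane next to the plane of
the tripod. -/
theorem Tripod.g_of_val_eq_one (T : Tripod A F k v u g) {i j l : Fin 3} (hij : i ≠ j)
    (hil : i ≠ l) (hjl : j ≠ l) (h : val F k l (v i) = 1) : g (v i) = 1 ∨ g (v i) = -1 := by
  have hg := T.g_eq' hij hil hjl (v i)
  have htri := T.triangle hil.symm hjl.symm hij (T.u_mem i) (T.u_mem j) (T.mem i) (T.u_ne hij)
    (T.u_bits i) (T.u_bits j) (by rw [T.u_of_ne hjl.symm, T.u_of_ne hil.symm])
    (by rw [h, T.u_of_ne hil.symm])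
  rw [T.u_self, T.u_self, T.u_of_ne hij, T.u_of_ne hij.symm, ← abs_abs (det3 _ _ _)] at htri
  have h0 := abs_le_one_of_mul_eq (by linarith [T.two_le]) (by rw [hg, h]; ring) htri
  refine h0.resolve_left fun h0 => ?_
  rw [h0, h] at hg
  have := T.out i
  have := T.v_bit hij
  omega

/-- The conditions on the coordinates of the points `v i` if `A` also contains the vertex at
which all three functionals vanish. -/
theorem Tripod.val_of_vertex (T : Tripod A F k v u g) {y : Fin 3 → ℤ} (hy : y ∈ A)
    (hy0 : ∀ i, val F k i y = 0) : |det3 (F 0) (F 1) (F 2)| = 2 ∧ g y = -1 ∧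
    ∀ i j l, i ≠ j → i ≠ l → j ≠ l →
      (val F k j (v i) = 0 → val F k i (v i) - val F k l (v i) = 2 ∨
        val F k i (v i) - val F k l (v i) = -2) ∧
      (val F k j (v i) = 1 → val F k i (v i) + val F k l (v i) - 1 = 2 ∨
        val F k i (v i) + val F k l (v i) - 1 = -2) := by
  have h2 := T.two_le
  have hgy := T.g_eq y
  simp only [hy0, Finset.sum_const_zero, zero_sub] at hgy
  have hm : |det3 (F 0) (F 1) (F 2)| = 2 := by
    have : |det3 (F 0) (F 1) (F 2)| ∣ 2 := ⟨-g y, by linarith⟩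
    exact le_antisymm (Int.le_of_dvd two_pos this) h2
  refine ⟨hm, by rw [hm] at hgy; linarith, ?_⟩
  intro i j l hij hil hjl
  have hout := T.out i
  have hbit := T.v_bit hil
  constructor
  · intro h
    have htri := T.triangle (i := j) (j := i) (l := l) hij.symm hjl hil hy (T.u_mem j) (T.mem i)
      (ne_of_val_ne (i := i) (by rw [hy0, T.u_of_ne hij]; norm_num)) (fun i => Or.inl (hy0 i))
      (T.u_bits j) (by rw [hy0, T.u_self]) (by rw [hy0, h])
    rw [hm, hy0, hy0, T.u_of_ne hij, T.u_of_ne hjl.symm] at htri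
    rcases htri with h | h
    · omega
    · rcases abs_cases ((1 - 0) * (val F k l (v i) - 0) - (val F k i (v i) - 0) * (1 - 0))
        with h' | h' <;> omega
  · intro h
    have htri := T.triangle (i := j) (j := i) (l := l) hij.symm hjl hil (T.u_mem i) (T.u_mem l)
      (T.mem i) (T.u_ne hil) (T.u_bits i) (T.u_bits l)
      (by rw [T.u_of_ne hij.symm, T.u_of_ne hjl]) (by rw [T.u_of_ne hij.symm, h])
    rw [hm, T.u_self, T.u_self, T.u_of_ne hil, T.u_of_ne hil.symm] at htri
    rcases htri with h | h
    · omega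
    · rcases abs_cases ((1 - 0) * (val F k l (v i) - 1) - (val F k i (v i) - 0) * (0 - 1))
        with h' | h' <;> omega

/-- Translates by lattice vectors, in terms of the three functionals. -/
theorem exists_val_eq (F : Fin 3 → Fin 3 → ℤ) (k : Fin 3 → ℤ) (x p q r : Fin 3 → ℤ) (a b : ℤ) :
    ∃ z, ∀ j, val F k j z = val F k j x + a * (val F k j p - val F k j r) +
      b * (val F k j q - val F k j r) :=
  ⟨fun t => x t + a * (p t - r t) + b * (q t - r t), fun j => by simp only [val, dot3]; ring⟩

end Tripod

/-! ### Tripods with the opposite vertex -/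

/-- The possible positions of the three exceptional points, given by their coordinates, for a
tripod together with the opposite vertex (then the index is two). Either one of the functionals
`g + 1` and `g + 1 - X i`, which are bits on the tripod and on the opposite vertex, is a bit at two
of the points, or some point with even coordinate sum in the triangle spanned by them is not
allowed. -/
theorem tripod_vertex_table :
    ∀ p ∈ [((2 : ℤ), (0 : ℤ), (0 : ℤ)), (-2, 0, 0), (3, 1, 0), (-1, 1, 0), (3, 0, 1), (-1, 0, 1),
      (2, 1, 1), (-2, 1, 1)],
    ∀ q ∈ [((0 : ℤ), (2 : ℤ), (0 : ℤ)), (0, -2, 0), (1, 3, 0), (1, -1, 0), (0, 3, 1), (0, -1, 1),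
      (1, 2, 1), (1, -2, 1)],
    ∀ r ∈ [((0 : ℤ), (0 : ℤ), (2 : ℤ)), (0, 0, -2), (1, 0, 3), (1, 0, -1), (0, 1, 3), (0, 1, -1),
      (1, 1, 2), (1, 1, -2)],
    (∃ s ∈ [((0 : ℤ), (0 : ℤ), (0 : ℤ)), (1, 0, 0), (0, 1, 0), (0, 0, 1)],
      let h : ℤ × ℤ × ℤ → ℤ := fun p =>
        p.1 + p.2.1 + p.2.2 - 2 * (s.1 * p.1 + s.2.1 * p.2.1 + s.2.2 * p.2.2)
      ((h p = 0 ∨ h p = 2) ∧ (h q = 0 ∨ h q = 2)) ∨ ((h p = 0 ∨ h p = 2) ∧ (h r = 0 ∨ h r = 2)) ∨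
        ((h q = 0 ∨ h q = 2) ∧ (h r = 0 ∨ h r = 2))) ∨
    ∃ w ∈ [((1 : ℤ), (1 : ℤ), (0 : ℤ)), (1, 0, 1), (0, 1, 1), (1, 4, 2), (1, 2, 4)],
      let S := w.1 + w.2.1 + w.2.2
      let z0 := (w.1 * p.1 + w.2.1 * q.1 + w.2.2 * r.1) / S
      let z1 := (w.1 * p.2.1 + w.2.1 * q.2.1 + w.2.2 * r.2.1) / S
      let z2 := (w.1 * p.2.2 + w.2.1 * q.2.2 + w.2.2 * r.2.2) / S
      S * z0 = w.1 * p.1 + w.2.1 * q.1 + w.2.2 * r.1 ∧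
      S * z1 = w.1 * p.2.1 + w.2.1 * q.2.1 + w.2.2 * r.2.1 ∧
      S * z2 = w.1 * p.2.2 + w.2.1 * q.2.2 + w.2.2 * r.2.2 ∧ (z0 + z1 + z2) % 2 = 0 ∧
      (¬(z0 = 0 ∨ z0 = 1) ∧ ¬(z0 = p.1 ∧ z1 = p.2.1 ∧ z2 = p.2.2) ∨
       ¬(z1 = 0 ∨ z1 = 1) ∧ ¬(z0 = q.1 ∧ z1 = q.2.1 ∧ z2 = q.2.2) ∨
       ¬(z2 = 0 ∨ z2 = 1) ∧ ¬(z0 = r.1 ∧ z1 = r.2.1 ∧ z2 = r.2.2)) := by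
  decide +kernel

section Tripod

variable {A : Set (Fin 3 → ℤ)} {F : Fin 3 → Fin 3 → ℤ} {k : Fin 3 → ℤ} {v u : Fin 3 → Fin 3 → ℤ}
  {g : (Fin 3 → ℤ) → ℤ}

/-- A tripod together with the vertex at which all three functionals vanish. The index is two, so
that lattice points are the points with even coordinate sum, and each exceptional point has eight
possible positions. -/
theorem Tripod.unimodularlyBoxed_of_vertex (T : Tripod A F k v u g) {y : Fin 3 → ℤ} (hy : y ∈ A)
    (hy0 : ∀ i, val F k i y = 0) : UnimodularlyBoxed A := by
  obtain ⟨hm, hgy, hval⟩ := T.val_of_vertex hy hy0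
  have hg : ∀ x, 2 * g x = val F k 0 x + val F k 1 x + val F k 2 x - 2 := by
    intro x
    have := T.g_eq x
    rwa [hm, Fin.sum_univ_three] at this
  have hout := T.out
  have p1 := T.v_bit (i := 0) (j := 1) (by decide)
  have p2 := T.v_bit (i := 0) (j := 2) (by decide)
  have q0 := T.v_bit (i := 1) (j := 0) (by decide)
  have q2 := T.v_bit (i := 1) (j := 2) (by decide)
  have r0 := T.v_bit (i := 2) (j := 0) (by decide)
  have r1 := T.v_bit (i := 2) (j := 1) (by decide)
  have hp : (val F k 0 (v 0), val F k 1 (v 0), val F k 2 (v 0)) ∈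
      [((2 : ℤ), (0 : ℤ), (0 : ℤ)), (-2, 0, 0), (3, 1, 0), (-1, 1, 0), (3, 0, 1), (-1, 0, 1),
      (2, 1, 1), (-2, 1, 1)] := by
    have h1 := hval 0 1 2 (by decide) (by decide) (by decide)
    simp only [List.mem_cons, Prod.mk.injEq, List.not_mem_nil, or_false]
    rcases p1 with e1 | e1 <;> rcases p2 with e2 | e2 <;> simp [e1, e2] at h1 ⊢ <;> omega
  have hq : (val F k 0 (v 1), val F k 1 (v 1), val F k 2 (v 1)) ∈
      [((0 : ℤ), (2 : ℤ), (0 : ℤ)), (0, -2, 0), (1, 3, 0), (1, -1, 0), (0, 3, 1), (0, -1, 1),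
      (1, 2, 1), (1, -2, 1)] := by
    have h1 := hval 1 0 2 (by decide) (by decide) (by decide)
    simp only [List.mem_cons, Prod.mk.injEq, List.not_mem_nil, or_false]
    rcases q0 with e1 | e1 <;> rcases q2 with e2 | e2 <;> simp [e1, e2] at h1 ⊢ <;> omega
  have hr : (val F k 0 (v 2), val F k 1 (v 2), val F k 2 (v 2)) ∈
      [((0 : ℤ), (0 : ℤ), (2 : ℤ)), (0, 0, -2), (1, 0, 3), (1, 0, -1), (0, 1, 3), (0, 1, -1),
      (1, 1, 2), (1, 1, -2)] := by
    have h1 := hval 2 0 1 (by decide) (by decide) (by decide)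
    simp only [List.mem_cons, Prod.mk.injEq, List.not_mem_nil, or_false]
    rcases r0 with e1 | e1 <;> rcases r1 with e2 | e2 <;> simp [e1, e2] at h1 ⊢ <;> omega
  rcases tripod_vertex_table _ hp _ hq _ hr with ⟨s, hs, h⟩ | ⟨w, hw, h⟩
  · have hs' : (s = (0, 0, 0) ∨ s = (1, 0, 0) ∨ s = (0, 1, 0) ∨ s = (0, 0, 1)) := by
      simpa using hs
    have key : ∀ l : Fin 3, (∀ t ≠ l, val F k 0 (v t) + val F k 1 (v t) + val F k 2 (v t) -
        2 * (s.1 * val F k 0 (v t) + s.2.1 * val F k 1 (v t) + s.2.2 * val F k 2 (v t)) = 0 ∨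
        val F k 0 (v t) + val F k 1 (v t) + val F k 2 (v t) -
        2 * (s.1 * val F k 0 (v t) + s.2.1 * val F k 1 (v t) + s.2.2 * val F k 2 (v t)) = 2) →
        UnimodularlyBoxed A := by
      intro l hl
      refine T.swap l ![-s.1, -s.2.1, -s.2.2] 1 1 ?_ ?_ ?_ ?_
      · rw [hm]
        rcases hs' with rfl | rfl | rfl | rfl <;> fin_cases l <;> simp
      · intro i
        rw [Fin.sum_univ_three]
        rcases hs' with rfl | rfl | rfl | rfl <;> fin_cases i <;> simp
      · intro t ht
        have h1 := hl t ht
        have h2 := hg (v t)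
        rw [Fin.sum_univ_three]
        simp
        rcases hs' with rfl | rfl | rfl | rfl <;> simp at h1 ⊢ <;> omega
      · intro z hz hz0
        have := hg z
        simp only [hz0] at this
        omega
    simp only at h
    rcases h with ⟨h1, h2⟩ | ⟨h1, h2⟩ | ⟨h1, h2⟩
    · refine key 2 fun t ht => ?_
      fin_cases t
      · exact h1
      · exact h2
      · exact absurd rfl ht
    · refine key 1 fun t ht => ?_
      fin_cases t
      · exact h1
      · exact absurd rfl ht
      · exact h2
    · refine key 0 fun t ht => ?_
      fin_cases t
      · exact absurd rfl ht
      · exact h1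
      · exact h2
  · exfalso
    simp only at h
    obtain ⟨e0, e1, e2, hev, h⟩ := h
    have hw' : 0 ≤ w.1 ∧ 0 ≤ w.2.1 ∧ 0 ≤ w.2.2 ∧ 0 < w.1 + w.2.1 + w.2.2 := by
      simp only [List.mem_cons, List.not_mem_nil, or_false] at hw
      rcases hw with rfl | rfl | rfl | rfl | rfl <;> norm_num
    generalize (w.1 * val F k 0 (v 0) + w.2.1 * val F k 0 (v 1) + w.2.2 * val F k 0 (v 2)) /
      (w.1 + w.2.1 + w.2.2) = z0 at *
    generalize (w.1 * val F k 1 (v 0) + w.2.1 * val F k 1 (v 1) + w.2.2 * val F k 1 (v 2)) /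
      (w.1 + w.2.1 + w.2.2) = z1 at *
    generalize (w.1 * val F k 2 (v 0) + w.2.1 * val F k 2 (v 1) + w.2.2 * val F k 2 (v 2)) /
      (w.1 + w.2.1 + w.2.2) = z2 at *
    -- the lattice consists of the points with even coordinate sum
    obtain ⟨d, hd⟩ : ∃ d, z0 + z1 + z2 = 2 * d := ⟨(z0 + z1 + z2) / 2, by omega⟩
    obtain ⟨x, hx⟩ := exists_val_eq F k y (u 0) (u 1) y (d - z0) (d - z1)
    obtain ⟨z, hz⟩ := exists_val_eq F k x (u 2) y y (d - z2) 0
    have hz0 : val F k 0 z = z0 := by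
      rw [hz, hx]; simp [T.u_val, hy0]; linarith
    have hz1 : val F k 1 z = z1 := by
      rw [hz, hx]; simp [T.u_val, hy0]; linarith
    have hz2 : val F k 2 z = z2 := by
      rw [hz, hx]; simp [T.u_val, hy0]; linarith
    have hzA : z ∈ A := by
      refine T.mem_of_val (T.mem 0) (T.mem 1) (T.mem 2) hy _ _ _ 0 hw'.1 hw'.2.1 hw'.2.2.1 le_rfl
        (by rw [add_zero]; exact hw'.2.2.2) fun i => ?_
      fin_cases i
      · simpa [hz0] using e0
      · simpa [hz1] using e1
      · simpa [hz2] using e2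
    have hne : ∀ t, z = v t → z0 = val F k 0 (v t) ∧ z1 = val F k 1 (v t) ∧ z2 = val F k 2 (v t) := by
      rintro t rfl; exact ⟨hz0.symm, hz1.symm, hz2.symm⟩
    rcases h with ⟨h, h'⟩ | ⟨h, h'⟩ | ⟨h, h'⟩
    · rw [← hz0] at h
      exact h (T.bit 0 z hzA fun e => h' (hne 0 e))
    · rw [← hz1] at h
      exact h (T.bit 1 z hzA fun e => h' (hne 1 e))
    · rw [← hz2] at h
      exact h (T.bit 2 z hzA fun e => h' (hne 2 e))

end Tripod

/-! ### Tripods without the opposite vertex, and any three vertices -/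

/-- The triangle with vertices `u l`, `v i`, `v j` in a facet plane has area zero or the index `m`.
After division by `m`, where `γ₀` and `γ` are the values of `g` at `v i` and `v j`, this leaves only
values that are excluded because `v j` is exceptional. -/
theorem far_triangle_arith {m γ₀ γ Q : ℤ} (hm : 2 ≤ m) (h0 : 2 ≤ |γ₀|) (hQ : Q = 0 ∨ Q = 1)
    (h : γ + Q * γ₀ + m * γ₀ * γ = 0 ∨ γ + Q * γ₀ + m * γ₀ * γ = 1 ∨
      γ + Q * γ₀ + m * γ₀ * γ = -1) : Q + m * γ = 0 ∨ Q + m * γ = -1 := by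
  obtain ⟨M, rfl⟩ : ∃ M, m = M + 2 := ⟨m - 2, by ring⟩
  have hbig : 2 ≤ |1 + (M + 2) * γ₀| := by
    rcases le_abs'.1 h0 with h1 | h1
    · rw [abs_of_nonpos (by nlinarith)]; nlinarith
    · rw [abs_of_nonneg (by nlinarith)]; nlinarith
  rcases hQ with rfl | rfl
  · have h1 : γ = 0 := by
      by_contra hne
      have h2 : |γ * (1 + (M + 2) * γ₀)| ≤ 1 := by
        have : γ * (1 + (M + 2) * γ₀) = γ + 0 * γ₀ + (M + 2) * γ₀ * γ := by ring
        rw [this]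
        rcases h with h | h | h <;> rw [h] <;> norm_num
      rw [abs_mul] at h2
      have := Int.one_le_abs hne
      nlinarith
    left; rw [h1]; ring
  · have hγ : |γ * (1 + (M + 2) * γ₀)| ≤ |γ₀| + 1 := by
      have : γ * (1 + (M + 2) * γ₀) = (γ + 1 * γ₀ + (M + 2) * γ₀ * γ) - γ₀ := by ring
      rw [this]
      refine (abs_sub _ _).trans ?_
      rcases h with h | h | h <;> rw [h] <;> norm_num <;> linarith
    have hlow : (M + 2) * |γ₀| - 1 ≤ |1 + (M + 2) * γ₀| := by
      have h1 : |(M + 2) * γ₀| = (M + 2) * |γ₀| := by rw [abs_mul, abs_of_nonneg (by linarith)]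
      have h2 := abs_sub (1 + (M + 2) * γ₀) 1
      rw [add_sub_cancel_left, h1] at h2
      norm_num at h2; linarith
    rw [abs_mul] at hγ
    have hle : |γ| ≤ 1 := by
      by_contra! hlt
      have : 2 ≤ |γ| := hlt
      nlinarith
    rcases abs_le.1 hle with ⟨h1, h2⟩
    obtain h3 | h3 | h3 : γ = 0 ∨ γ = 1 ∨ γ = -1 := by omega
    · subst h3
      rcases abs_cases γ₀ with h4 | h4 <;> omega
    · subst h3
      exfalso
      rcases le_abs'.1 h0 with h1 | h1 <;> rcases h with h | h | h <;> nlinarith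
    · subst h3
      have hM : M = 0 := by
        by_contra hne
        have : 1 ≤ M := by omega
        rcases le_abs'.1 h0 with h1 | h1 <;> rcases h with h | h | h <;> nlinarith
      subst hM; right; norm_num

section Tripod

variable {A : Set (Fin 3 → ℤ)} {F : Fin 3 → Fin 3 → ℤ} {k : Fin 3 → ℤ} {v u : Fin 3 → Fin 3 → ℤ}
  {g : (Fin 3 → ℤ) → ℤ}

/-- If `g` or `-g` takes values in `{0, 1}` at two of the exceptional points, then it can replace
the functional of the third one. -/
theorem Tripod.unimodularlyBoxed_of_pair (T : Tripod A F k v u g)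
    (hA : ∀ y ∈ A, ¬ ∀ i, val F k i y = 0) (l : Fin 3)
    (h : (∀ t, t ≠ l → g (v t) = 0 ∨ g (v t) = 1) ∨ ∀ t, t ≠ l → g (v t) = 0 ∨ g (v t) = -1) :
    UnimodularlyBoxed A := by
  rcases h with h | h
  · exact T.swap l 0 1 0 (by simp) (by simp) (by simpa using h) fun y hy h0 => absurd h0 (hA y hy)
  · refine T.swap l 0 (-1) 0 (by simp) (by simp) ?_ fun y hy h0 => absurd h0 (hA y hy)
    intro t ht
    rcases h t ht with h | h <;> simp [h]

/-- If `v i` is far from the plane of the tripod, then it lies on two lower facets, and the other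
two exceptional points lie on upper facets, next to the plane of the tripod. -/
theorem Tripod.val_of_far (T : Tripod A F k v u g) (hA : ∀ y ∈ A, ¬ ∀ i, val F k i y = 0)
    {i j l : Fin 3} (hij : i ≠ j) (hil : i ≠ l) (hjl : j ≠ l) (hg : 2 ≤ |g (v i)|) :
    val F k j (v i) = 0 ∧ val F k l (v i) = 0 ∧ val F k l (v j) = 1 ∧
      (g (v j) = 1 ∨ g (v j) = -1) := by
  have hj : val F k j (v i) = 0 := by
    refine (T.v_bit hij).resolve_right fun h => ?_
    rcases T.g_of_val_eq_one hil hij hjl.symm h with h | h <;> rw [h] at hg <;> norm_num at hg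
  have hl : val F k l (v i) = 0 := by
    refine (T.v_bit hil).resolve_right fun h => ?_
    rcases T.g_of_val_eq_one hij hil hjl h with h | h <;> rw [h] at hg <;> norm_num at hg
  have hone : val F k l (v j) = 1 := by
    refine (T.v_bit hjl).resolve_left fun h => ?_
    have gi := T.g_eq' hij hil hjl (v i)
    have gj := T.g_eq' hij hil hjl (v j)
    rw [hj, hl] at gi
    rw [h] at gj
    have h2 := T.two_le
    have hbit := T.v_bit hij.symm
    have hout := T.out j
    have htri := T.toBoxedBy.triangle T.conv T.prim (i := l) (j := i) (l := j) hil.symm hjl.symm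
      hij (T.u_mem l) (T.mem i) (T.mem j) (by rw [hl, T.u_self]) (by rw [h, T.u_self])
      (by
        intro z hz hv hzl
        rw [T.u_self] at hzl
        left
        rcases T.mem_cases hz hv with ⟨t, rfl⟩ | h0
        · by_cases e : l = t
          · rw [e]
          · rw [T.u_of_ne e] at hzl; norm_num at hzl
        · exact absurd h0 (hA z hz)) rfl
    rw [T.u_of_ne hil, T.u_of_ne hjl, hj, ← abs_abs (det3 _ _ _)] at htri
    set m := |det3 (F 0) (F 1) (F 2)|
    have key := abs_le_one_of_mul_eq (D := m) (γ := g (v j) + (1 - val F k i (v j)) * g (v i) +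
      m * g (v i) * g (v j)) (by linarith) (by
        have e1 : val F k i (v i) = m * g (v i) + 2 := by linarith
        have e2 : val F k j (v j) = m * g (v j) + 2 - val F k i (v j) := by linarith
        rw [e1, e2]; ring) htri
    have := far_triangle_arith h2 hg (Q := 1 - val F k i (v j)) (by omega) key
    omega
  exact ⟨hj, hl, hone, T.g_of_val_eq_one hij.symm hjl hil hone⟩

/-- If `v 0` is far from the plane of the tripod and `v 1`, `v 2` lie on different sides of it,
then the tetrahedron `u 0`, `v 0`, `v 1`, `v 2` contains a forbidden lattice point, except in two
cases of index two. -/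
theorem Tripod.unimodularlyBoxed_of_far (T : Tripod A F k v u g)
    (hA : ∀ y ∈ A, ¬ ∀ i, val F k i y = 0) (hg : 2 ≤ |g (v 0)|) (h1 : g (v 1) = 1)
    (h2 : g (v 2) = -1) : UnimodularlyBoxed A := by
  obtain ⟨a1, a2, b2, -⟩ := T.val_of_far hA (i := 0) (j := 1) (l := 2) (by decide) (by decide)
    (by decide) hg
  obtain ⟨-, -, c1, -⟩ := T.val_of_far hA (i := 0) (j := 2) (l := 1) (by decide) (by decide)
    (by decide) hg
  have b0 := T.v_bit (i := 1) (j := 0) (by decide)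
  have c0 := T.v_bit (i := 2) (j := 0) (by decide)
  have g0 := T.g_eq (v 0)
  have g1 := T.g_eq (v 1)
  have g2 := T.g_eq (v 2)
  have hm := T.two_le
  have hswap := T.swap
  rw [Fin.sum_univ_three] at g0 g1 g2
  rw [h1] at g1
  rw [h2] at g2
  have u00 := T.u_val 0 0
  have u01 := T.u_val 0 1
  have u02 := T.u_val 0 2
  simp at u00 u01 u02
  set m := |det3 (F 0) (F 1) (F 2)| with hmdef
  obtain ⟨M, hM, hM0⟩ : ∃ M, m = M + 2 ∧ 0 ≤ M := ⟨m - 2, by ring, by linarith⟩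
  have a0 : val F k 0 (v 0) = m * g (v 0) + 2 := by linarith
  have b1 : val F k 1 (v 1) = m + 1 - val F k 0 (v 1) := by linarith
  have c2 : val F k 2 (v 2) = 1 - val F k 0 (v 2) - m := by linarith
  have hno : ∀ x0, (x0 < 0 ∨ 1 < x0) → ∀ z ∈ A, val F k 0 z = x0 → val F k 1 z = 1 → False := by
    intro x0 hx0 z hz e0 e1
    have := T.bit 0 z hz (by rintro rfl; rw [e1] at a1; norm_num at a1)
    omega
  -- the lattice points `(1 + m, 1, 0)` and `(1 - m, 1, 0)`
  obtain ⟨z, hz⟩ := exists_val_eq F k (v 1) (u 0) (u 1) (u 2) (val F k 0 (v 1) - 1 - m)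
    (m - val F k 0 (v 1))
  have z0 : val F k 0 z = M + 3 := by
    rw [hz]; simp [T.u_val]; linarith
  have z1 : val F k 1 z = 1 := by
    rw [hz]; simp [T.u_val]; linarith
  have z2 : val F k 2 z = 0 := by
    rw [hz, b2]; simp [T.u_val]; ring
  obtain ⟨z', hz'⟩ := exists_val_eq F k (v 2) (u 0) (u 1) (u 2) (m - 1 + val F k 0 (v 2)) 0
  have z0' : val F k 0 z' = -M - 1 := by
    rw [hz']; simp [T.u_val]; linarith
  have z1' : val F k 1 z' = 1 := by
    rw [hz']; simp [T.u_val]; linarith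
  have z2' : val F k 2 z' = 0 := by
    rw [hz', c2]; simp [T.u_val]; ring
  -- neither of them belongs to `A`. With `M = m - 2` and `G = |g (v 0)| - 2`, the weights below are
  -- the barycentric coordinates that Cramer's rule gives for them, without denominators
  have hplus := fun (w α β γ : ℤ) hw hα hβ hγ hpos h => hno _ (Or.inr (by linarith)) z
    (T.mem_of_val (T.u_mem 0) (T.mem 0) (T.mem 1) (T.mem 2) w α β γ hw hα hβ hγ hpos h) z0 z1
  have hminus := fun (w α β γ : ℤ) hw hα hβ hγ hpos h => hno _ (Or.inl (by linarith)) z'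
    (T.mem_of_val (T.u_mem 0) (T.mem 0) (T.mem 1) (T.mem 2) w α β γ hw hα hβ hγ hpos h) z0' z1'
  rw [hM] at a0 b1 c2
  have hmono : ∀ M G : ℤ, 0 ≤ M → 0 ≤ G → 0 ≤ M * G ∧ 0 ≤ M ^ 2 ∧ 0 ≤ M ^ 2 * G ∧ 0 ≤ M ^ 3 ∧
      0 ≤ M ^ 3 * G := fun M G h1 h2 => by
    refine ⟨?_, ?_, ?_, ?_, ?_⟩ <;> positivity
  rcases le_abs'.1 hg with hneg | hpos
  · obtain ⟨G, hG, hG0⟩ : ∃ G, g (v 0) = -G - 2 ∧ 0 ≤ G := ⟨-g (v 0) - 2, by ring, by linarith⟩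
    rw [hG] at a0
    obtain ⟨m1, m2, m3, m4, m5⟩ := hmono M G hM0 hG0
    rcases b0 with b0 | b0 <;> rcases c0 with c0 | c0 <;> rw [b0] at b1 <;> rw [c0] at c2
    · exfalso
      refine hminus (4*G+2*M+8*M*G+3*M^2+5*M^2*G+M^3+M^3*G) (4+8*M+5*M^2+M^3) (2+3*M+M^2)
        (2+4*G+3*M+4*M*G+M^2+M^2*G) (by linarith) (by linarith) (by linarith) (by linarith)
        (by linarith) fun i => ?_
      fin_cases i <;> simp only [Fin.zero_eta, Fin.mk_one, Fin.reduceFinMk, a0, a1, a2, b0, b1, b2,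
        c0, c1, c2, u00, u01, u02, z0', z1', z2'] <;> ring
    · exfalso
      refine hminus (8*G+4*M+12*M*G+4*M^2+6*M^2*G+M^3+M^3*G) (8+12*M+6*M^2+M^3) (4+4*M+M^2)
        (2+4*G+3*M+4*M*G+M^2+M^2*G) (by linarith) (by linarith) (by linarith) (by linarith)
        (by linarith) fun i => ?_
      fin_cases i <;> simp only [Fin.zero_eta, Fin.mk_one, Fin.reduceFinMk, a0, a1, a2, b0, b1, b2,
        c0, c1, c2, u00, u01, u02, z0', z1', z2'] <;> ring
    · rcases hM0.eq_or_lt with rfl | hM1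
      · refine hswap 0 ![-1, 0, 0] 1 1 (by simp [hM]) (fun i => ?_) (fun t ht => ?_)
          (fun y hy h0 => absurd h0 (hA y hy))
        · fin_cases i <;> simp [Fin.sum_univ_three]
        · fin_cases t
          · exact absurd rfl ht
          · simp [Fin.sum_univ_three, b0, h1]
          · simp [Fin.sum_univ_three, c0, h2]
      · exfalso
        obtain ⟨N, rfl, hN⟩ : ∃ N, M = N + 1 ∧ 0 ≤ N := ⟨M - 1, by ring, by omega⟩
        obtain ⟨n1, n2, n3, n4, n5⟩ := hmono N G hN hG0
        refine hminus (-2+2*G-(N+1)+5*(N+1)*G+2*(N+1)^2+4*(N+1)^2*G+(N+1)^3+(N+1)^3*G)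
          (2+5*(N+1)+4*(N+1)^2+(N+1)^3) (2+3*(N+1)+(N+1)^2)
          (2*G+2*(N+1)+3*(N+1)*G+(N+1)^2+(N+1)^2*G) (by linarith) (by linarith)
          (by linarith) (by linarith) (by linarith) fun i => ?_
        fin_cases i <;> simp only [Fin.zero_eta, Fin.mk_one, Fin.reduceFinMk, a0, a1, a2, b0, b1,
          b2, c0, c1, c2, u00, u01, u02, z0', z1', z2'] <;> ring
    · by_cases hMG : M = 0 ∧ G = 0
      · obtain ⟨rfl, rfl⟩ := hMG
        refine hswap 2 ![1, 0, 0] (-1) 0 (by simp) (fun i => ?_) (fun t ht => ?_)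
          (fun y hy h0 => absurd h0 (hA y hy))
        · fin_cases i <;> simp [Fin.sum_univ_three]
        · fin_cases t
          · simp [Fin.sum_univ_three, a0, hG]
          · simp [Fin.sum_univ_three, b0, h1]
          · exact absurd rfl ht
      · exfalso
        have hw : 0 ≤ -4+4*G+8*M*G+3*M^2+5*M^2*G+M^3+M^3*G := by
          rcases hM0.eq_or_lt with rfl | hM1
          · have : 1 ≤ G := by omega
            linarith
          · obtain ⟨N, rfl, hN⟩ : ∃ N, M = N + 1 ∧ 0 ≤ N := ⟨M - 1, by ring, by omega⟩
            have := hmono N G hN hG0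
            linarith
        refine hminus (-4+4*G+8*M*G+3*M^2+5*M^2*G+M^3+M^3*G) (4+8*M+5*M^2+M^3) (4+4*M+M^2)
          (2*G+2*M+3*M*G+M^2+M^2*G) hw (by linarith) (by linarith) (by linarith)
          (by linarith) fun i => ?_
        fin_cases i <;> simp only [Fin.zero_eta, Fin.mk_one, Fin.reduceFinMk, a0, a1, a2, b0, b1,
          b2, c0, c1, c2, u00, u01, u02, z0', z1', z2'] <;> ring
  · obtain ⟨G, hG, hG0⟩ : ∃ G, g (v 0) = G + 2 ∧ 0 ≤ G := ⟨g (v 0) - 2, by ring, by linarith⟩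
    rw [hG] at a0
    obtain ⟨m1, m2, m3, m4, m5⟩ := hmono M G hM0 hG0
    rcases b0 with b0 | b0 <;> rcases c0 with c0 | c0 <;> rw [b0] at b1 <;> rw [c0] at c2
    · exfalso
      refine hplus (4*G+6*M+8*M*G+5*M^2+5*M^2*G+M^3+M^3*G) (12+16*M+7*M^2+M^3) (6+5*M+M^2)
        (6+4*G+5*M+4*M*G+M^2+M^2*G) (by linarith) (by linarith) (by linarith) (by linarith)
        (by linarith) fun i => ?_
      fin_cases i <;> simp only [Fin.zero_eta, Fin.mk_one, Fin.reduceFinMk, a0, a1, a2, b0, b1, b2,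
        c0, c1, c2, u00, u01, u02, z0, z1, z2] <;> ring
    · exfalso
      refine hplus (4+8*G+10*M+12*M*G+6*M^2+6*M^2*G+M^3+M^3*G) (16+20*M+8*M^2+M^3) (8+6*M+M^2)
        (6+4*G+5*M+4*M*G+M^2+M^2*G) (by linarith) (by linarith) (by linarith) (by linarith)
        (by linarith) fun i => ?_
      fin_cases i <;> simp only [Fin.zero_eta, Fin.mk_one, Fin.reduceFinMk, a0, a1, a2, b0, b1, b2,
        c0, c1, c2, u00, u01, u02, z0, z1, z2] <;> ring
    · rcases hM0.eq_or_lt with rfl | hM1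
      · refine hswap 0 ![-1, 0, 0] 1 1 (by simp [hM]) (fun i => ?_) (fun t ht => ?_)
          (fun y hy h0 => absurd h0 (hA y hy))
        · fin_cases i <;> simp [Fin.sum_univ_three]
        · fin_cases t
          · exact absurd rfl ht
          · simp [Fin.sum_univ_three, b0, h1]
          · simp [Fin.sum_univ_three, c0, h2]
      · exfalso
        obtain ⟨N, rfl, hN⟩ : ∃ N, M = N + 1 ∧ 0 ≤ N := ⟨M - 1, by ring, by omega⟩
        obtain ⟨n1, n2, n3, n4, n5⟩ := hmono N G hN hG0
        refine hplus (-2+2*G+3*(N+1)+5*(N+1)*G+4*(N+1)^2+4*(N+1)^2*G+(N+1)^3+(N+1)^3*G)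
          (6+11*(N+1)+6*(N+1)^2+(N+1)^3) (6+5*(N+1)+(N+1)^2)
          (4+2*G+4*(N+1)+3*(N+1)*G+(N+1)^2+(N+1)^2*G) (by linarith) (by linarith)
          (by linarith) (by linarith) (by linarith) fun i => ?_
        fin_cases i <;> simp only [Fin.zero_eta, Fin.mk_one, Fin.reduceFinMk, a0, a1, a2, b0, b1,
          b2, c0, c1, c2, u00, u01, u02, z0, z1, z2] <;> ring
    · exfalso
      refine hplus (4*G+6*M+8*M*G+5*M^2+5*M^2*G+M^3+M^3*G) (8+14*M+7*M^2+M^3) (8+6*M+M^2)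
        (4+2*G+4*M+3*M*G+M^2+M^2*G) (by linarith) (by linarith) (by linarith) (by linarith)
        (by linarith) fun i => ?_
      fin_cases i <;> simp only [Fin.zero_eta, Fin.mk_one, Fin.reduceFinMk, a0, a1, a2, b0, b1, b2,
        c0, c1, c2, u00, u01, u02, z0, z1, z2] <;> ring

theorem Tripod.unimodularlyBoxed (T : Tripod A F k v u g) : UnimodularlyBoxed A := by
  by_cases hA : ∃ y ∈ A, ∀ i, val F k i y = 0
  · obtain ⟨y, hy, hy0⟩ := hA
    exact T.unimodularlyBoxed_of_vertex hy hy0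
  · replace hA : ∀ y ∈ A, ¬ ∀ i, val F k i y = 0 := fun y hy h => hA ⟨y, hy, h⟩
    by_cases hfar : ∃ i, 2 ≤ |g (v i)|
    · obtain ⟨i, hi⟩ := hfar
      obtain ⟨j, l, hij, hil, hjl⟩ : ∃ j l : Fin 3, i ≠ j ∧ i ≠ l ∧ j ≠ l := by
        clear hi; revert i; decide
      obtain ⟨-, -, -, hj⟩ := T.val_of_far hA hij hil hjl hi
      obtain ⟨-, -, -, hl⟩ := T.val_of_far hA hil hij hjl.symm hi
      have hpair : g (v j) = g (v l) → UnimodularlyBoxed A := by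
        intro e
        have hall : ∀ t, t ≠ i → g (v t) = g (v j) := by
          intro t ht
          rcases fin_three_eq hij hil hjl t with rfl | rfl | rfl
          · exact absurd rfl ht
          · rfl
          · exact e.symm
        refine T.unimodularlyBoxed_of_pair hA i ?_
        rcases hj with hj | hj
        · exact Or.inl fun t ht => Or.inr ((hall t ht).trans hj)
        · exact Or.inr fun t ht => Or.inr ((hall t ht).trans hj)
      have hopp : ∀ j l, i ≠ j → i ≠ l → j ≠ l → g (v j) = 1 → g (v l) = -1 →
          UnimodularlyBoxed A := by
        intro j l hij hil hjl hj hl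
        have hinj : Function.Injective ![i, j, l] := by
          intro a b
          fin_cases a <;> fin_cases b <;> simp [hij, hil, hjl, hij.symm, hil.symm, hjl.symm]
        let σ : Equiv.Perm (Fin 3) :=
          Equiv.ofBijective _ (Finite.injective_iff_bijective.1 hinj)
        refine (T.perm σ).unimodularlyBoxed_of_far ?_ hi hj hl
        intro y hy h
        exact hA y hy fun t => by simpa [val] using h (σ.symm t)
      rcases hj with hj | hj <;> rcases hl with hl | hl
      · exact hpair (hj.trans hl.symm)
      · exact hopp j l hij hil hjl hj hl
      · exact hopp l j hil hij hjl.symm hl hj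
      · exact hpair (hj.trans hl.symm)
    · push Not at hfar
      have hsmall : ∀ i, g (v i) = 0 ∨ g (v i) = 1 ∨ g (v i) = -1 := by
        intro i
        have := hfar i
        rcases abs_cases (g (v i)) with h | h <;> omega
      -- two of the three values have no opposite signs
      obtain ⟨l, hl⟩ : ∃ l : Fin 3, (∀ t, t ≠ l → g (v t) = 0 ∨ g (v t) = 1) ∨
          ∀ t, t ≠ l → g (v t) = 0 ∨ g (v t) = -1 := by
        have h0 := hsmall 0
        have h1 := hsmall 1
        have h2 := hsmall 2
        simp only [Fin.exists_fin_succ, Fin.forall_fin_succ]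
        rcases h0 with h0 | h0 | h0 <;> rcases h1 with h1 | h1 | h1 <;>
          rcases h2 with h2 | h2 | h2 <;> simp [h0, h1, h2]
      exact T.unimodularlyBoxed_of_pair hA l hl

end Tripod

section ProperBox

variable {A : Set (Fin 3 → ℤ)} {F : Fin 3 → Fin 3 → ℤ} {k : Fin 3 → ℤ} {v : Fin 3 → Fin 3 → ℤ}

/-- Three vertices of a cube, no three in a facet, are up to flips and permutations of the
coordinates `(0, 0, 1)`, `(1, 1, 0)`, `(1, 1, 1)` or a tripod: the three coordinates single out one
of the three points each, and two coordinates may or may not single out the same point. -/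
theorem ProperBox.unimodularlyBoxed_of_three (hb : ProperBox A F k v) {p : Fin 3 → Fin 3 → ℤ}
    (hp : ∀ i, p i ∈ A) (hinj : Function.Injective p) (hv : ∀ i t, p i ≠ v t) :
    UnimodularlyBoxed A := by
  have hU := fun i => hb.bits (hp i) (hv i)
  have hnot : ∀ i, ¬(val F k i (p 1) = val F k i (p 0) ∧ val F k i (p 2) = val F k i (p 0)) := by
    rintro i ⟨h1, h2⟩
    rcases hb.facet (hinj.ne (by decide : (0 : Fin 3) ≠ 1)) (hU 0) (hU 1) (hU 2) h1 h2 with h | h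
    · exact absurd (hinj h) (by decide)
    · exact absurd (hinj h) (by decide)
  -- `o i` is the point whose coordinate `i` differs from that of the other two; after a flip this
  -- coordinate is zero
  obtain ⟨ε, o, hε⟩ : ∃ (ε : Fin 3 → Bool) (o : Fin 3 → Fin 3), ∀ i t,
      (if ε i then 1 - val F k i (p t) else val F k i (p t)) = if o i = t then 0 else 1 := by
    have : ∀ i, ∃ (e : Bool) (o : Fin 3), ∀ t,
        (if e then 1 - val F k i (p t) else val F k i (p t)) = if o = t then 0 else 1 := by
      intro i
      have h := hnot i
      have h0 := hU 0 i
      have h1 := hU 1 i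
      have h2 := hU 2 i
      rw [Bool.exists_bool]
      simp only [Fin.forall_fin_succ, Fin.exists_fin_succ]
      rcases h0 with h0 | h0 <;> rcases h1 with h1 | h1 <;>
          rcases h2 with h2 | h2 <;> simp [h0, h1, h2] at h ⊢
    choose ε o h using this
    exact ⟨ε, o, h⟩
  have hb' := hb.flip ε
  have hval : ∀ i t, val (fun i => if ε i then -F i else F i) (fun i => if ε i then 1 - k i else k i)
      i (p t) = if o i = t then 0 else 1 := by
    intro i t
    rw [← hε]
    simp only [val]
    split_ifs
    · rw [neg_dotProduct]; ring
    · rfl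
  generalize (fun i => if ε i then -F i else F i) = F' at *
  generalize (fun i => if ε i then 1 - k i else k i) = k' at *
  have hshape : (o 1 = o 0 ∧ o 2 = o 0) ∨ Function.Injective o ∨
      ∃ i j l, i ≠ j ∧ i ≠ l ∧ j ≠ l ∧ o i = o j ∧ o l ≠ o i := by
    clear hε hval; revert o; decide
  rcases hshape with ⟨h1, h2⟩ | h | ⟨i, j, l, hij, hil, hjl, h1, h2⟩
  · exfalso
    obtain ⟨s, t, hst, hs, ht⟩ : ∃ s t : Fin 3, s ≠ t ∧ o 0 ≠ s ∧ o 0 ≠ t := by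
      generalize o 0 = x; revert x; decide
    refine hst (hinj (eq_of_val_eq hb'.det_ne_zero (k := k') fun i => ?_))
    have : o i = o 0 := by
      fin_cases i
      · rfl
      · exact h1
      · exact h2
    rw [hval, hval, this, if_neg hs, if_neg ht]
  · obtain ⟨g, T⟩ := hb'.exists_tripod (u := p ∘ o) (fun i => hp _) (fun i j => by
      simp only [Function.comp, hval]
      simp only [h.eq_iff])
    exact T.unimodularlyBoxed
  · have hperm : Function.Injective ![i, j, l] := by
      intro a b
      fin_cases a <;> fin_cases b <;> simp [hij, hil, hjl, hij.symm, hil.symm, hjl.symm]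
    obtain ⟨r, hr1, hr2⟩ : ∃ r, o i ≠ r ∧ o l ≠ r := by
      generalize o i = x at *; generalize o l = y at *; clear h1 h2; revert x y; decide
    refine (hb'.perm (Equiv.ofBijective _ (Finite.injective_iff_bijective.1 hperm))
      ).unimodularlyBoxed_of_edge (hp (o i)) (hp (o l)) (hp r) ?_ ?_ ?_ ?_ ?_ ?_ ?_ ?_ ?_
    · exact (hval i _).trans (by simp)
    · exact (hval j _).trans (by simp [h1])
    · exact (hval l _).trans (by simp [h2])
    · exact (hval i _).trans (by simp [h2.symm])
    · exact (hval j _).trans (by simp [← h1, h2.symm])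
    · exact (hval l _).trans (by simp)
    · exact (hval i _).trans (by simp [hr1])
    · exact (hval j _).trans (by simp [← h1, hr1])
    · exact (hval l _).trans (by simp [hr2])

end ProperBox

/-! ### Configurations of five lattice points -/

/-- A configuration of four lattice points has width at most one. -/
theorem not_wide_of_subset_four {A : Set (Fin 3 → ℤ)} (hW : Wide A) (hA : LatticeConvex A)
    {o a b c : Fin 3 → ℤ} (ho : o ∈ A) (ha : a ∈ A) (hb : b ∈ A) (hc : c ∈ A)
    (h : ∀ x ∈ A, x = o ∨ x = a ∨ x = b ∨ x = c) : False := by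
  have hn : ∀ n : Fin 3 → ℤ, n ≠ 0 → (n ⬝ᵥ (a - o) = 0 ∨ n ⬝ᵥ (a - o) = 1) →
      (n ⬝ᵥ (b - o) = 0 ∨ n ⬝ᵥ (b - o) = 1) → (n ⬝ᵥ (c - o) = 0 ∨ n ⬝ᵥ (c - o) = 1) → False := by
    intro n hn h1 h2 h3
    rw [dotProduct_sub] at h1 h2 h3
    refine hW.not_bit hn (-(n ⬝ᵥ o)) fun x hx => ?_
    rcases h x hx with rfl | rfl | rfl | rfl
    · left; ring
    · simpa [sub_eq_add_neg] using h1
    · simpa [sub_eq_add_neg] using h2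
    · simpa [sub_eq_add_neg] using h3
  by_cases hD : det3 (a - o) (b - o) (c - o) = 0
  · obtain ⟨n, hn0, h1, h2, h3⟩ := exists_ne_zero_of_det3_eq_zero _ _ _ hD
    exact hn n hn0 (Or.inl h1) (Or.inl h2) (Or.inl h3)
  · have hT : EmptyTetrahedron o a b c := fun w α β γ hw hα hβ hγ hpos z hz =>
      h z (hA o ho a ha b hb c hc w α β γ hw hα hβ hγ hpos z hz)
    have hne : ∀ n x : Fin 3 → ℤ, n ⬝ᵥ x = 1 → n ≠ 0 := by
      rintro n x h1 rfl; simp at h1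
    rcases hT.width_one hD with ⟨n, h1, h2, h3⟩ | ⟨n, h1, h2, h3⟩ | ⟨n, h1, h2, h3⟩
    · exact hn n (hne _ _ h2) (Or.inl h1) (Or.inr h2) (Or.inr h3)
    · exact hn n (hne _ _ h1) (Or.inr h1) (Or.inl h2) (Or.inr h3)
    · exact hn n (hne _ _ h1) (Or.inr h1) (Or.inr h2) (Or.inl h3)

/-- Five points that are all the lattice points of a set of width at least two, with a primitive
affine dependence `c` between them. -/
structure FivePoints (A : Set (Fin 3 → ℤ)) (p : Fin 5 → Fin 3 → ℤ) (c : Fin 5 → ℤ) : Prop where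
  wide : Wide A
  conv : LatticeConvex A
  range : Set.range p = A
  inj : Function.Injective p
  sum : ∑ i, c i = 0
  dep : ∀ t, ∑ i, c i * p i t = 0
  prim : ∀ d, (∀ i, d ∣ c i) → IsUnit d

theorem sum_five {i j k l m : Fin 5} (h : [i, j, k, l, m].Nodup) (f : Fin 5 → ℤ) :
    ∑ t, f t = f i + f j + f k + f l + f m := by
  have h1 : (Finset.univ : Finset (Fin 5)) = [i, j, k, l, m].toFinset := by
    revert i j k l m; decide +kernel
  rw [h1, List.sum_toFinset _ h]
  simp; ring

theorem fin_five_cases {i j k l m : Fin 5} (h : [i, j, k, l, m].Nodup) (t : Fin 5) :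
    t = i ∨ t = j ∨ t = k ∨ t = l ∨ t = m := by
  revert i j k l m t; decide +kernel

section FivePoints

variable {A : Set (Fin 3 → ℤ)} {p : Fin 5 → Fin 3 → ℤ} {c : Fin 5 → ℤ}

theorem FivePoints.mem (H : FivePoints A p c) (i : Fin 5) : p i ∈ A :=
  H.range ▸ Set.mem_range_self i

theorem FivePoints.exists_eq (H : FivePoints A p c) {x : Fin 3 → ℤ} (hx : x ∈ A) :
    ∃ i, x = p i := by
  rw [← H.range] at hx
  obtain ⟨i, rfl⟩ := hx
  exact ⟨i, rfl⟩

theorem FivePoints.perm (H : FivePoints A p c) (σ : Equiv.Perm (Fin 5)) :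
    FivePoints A (p ∘ σ) (c ∘ σ) := by
  refine ⟨H.wide, H.conv, ?_, H.inj.comp σ.injective, ?_, fun t => ?_, fun d hd => H.prim d fun i => ?_⟩
  · rw [Set.range_comp, σ.range_eq_univ, Set.image_univ, H.range]
  · rw [← H.sum]; exact Equiv.sum_comp σ c
  · rw [← H.dep t]; exact Equiv.sum_comp σ fun i => c i * p i t
  · simpa using hd (σ.symm i)

theorem FivePoints.neg (H : FivePoints A p c) : FivePoints A p fun i => -c i := by
  refine ⟨H.wide, H.conv, H.range, H.inj, ?_, fun t => ?_, fun d hd => H.prim d fun i => ?_⟩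
  · simp [H.sum]
  · simp [H.dep]
  · simpa using hd i

theorem FivePoints.sum_mul (H : FivePoints A p c) {h : (Fin 3 → ℤ) → ℤ} (hh : IsIntAffine h) :
    ∑ i, c i * h (p i) = 0 := by
  obtain ⟨n, κ, hn⟩ := hh
  have h0 := H.dep 0
  have h1 := H.dep 1
  have h2 := H.dep 2
  have hs := H.sum
  simp only [Fin.sum_univ_five] at *
  simp only [hn, dot3]
  linear_combination n 0 * h0 + n 1 * h1 + n 2 * h2 + κ * hs

/-- An integer functional that takes values in `{0, 1}` at all five points is constant. -/
theorem FivePoints.const_of_bits (H : FivePoints A p c) {h : (Fin 3 → ℤ) → ℤ} (hh : IsIntAffine h)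
    (hbit : ∀ i, h (p i) = 0 ∨ h (p i) = 1) (i j : Fin 5) : h (p i) = h (p j) := by
  obtain ⟨n, κ, hn⟩ := hh
  by_cases h0 : n = 0
  · simp [hn, h0]
  · refine absurd ?_ (H.wide.not_bit h0 κ)
    intro x hx
    obtain ⟨i, rfl⟩ := H.exists_eq hx
    rw [← hn]; exact hbit i

theorem FivePoints.det_ne_zero (H : FivePoints A p c) {i j k l m : Fin 5}
    (hn : [i, j, k, l, m].Nodup) (hc : c i ≠ 0) :
    det3 (p k - p j) (p l - p j) (p m - p j) ≠ 0 := by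
  intro h0
  obtain ⟨n, hn0, h1, h2, h3⟩ := exists_ne_zero_of_det3_eq_zero _ _ _ h0
  rw [dotProduct_sub] at h1 h2 h3
  have hs := H.sum_mul (h := fun x => n ⬝ᵥ x + -(n ⬝ᵥ p j)) ⟨n, _, fun _ => rfl⟩
  have hs' := sum_five hn c
  rw [sum_five hn] at hs
  rw [H.sum] at hs'
  have h4 : c i * (n ⬝ᵥ p i + -(n ⬝ᵥ p j)) = 0 := by
    linear_combination hs - c k * h1 - c l * h2 - c m * h3
  have h5 := (mul_eq_zero.1 h4).resolve_left hc
  refine H.wide.not_bit hn0 (-(n ⬝ᵥ p j)) fun x hx => Or.inl ?_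
  obtain ⟨t, rfl⟩ := H.exists_eq hx
  rcases fin_five_cases hn t with rfl | rfl | rfl | rfl | rfl <;> linarith

/-- The tetrahedron that omits the point `i` is empty unless `i` lies in it, that is, unless all
other coefficients of the dependence have the opposite sign. -/
theorem FivePoints.tetrahedron (H : FivePoints A p c) {i j k l m : Fin 5}
    (hn : [i, j, k, l, m].Nodup) (hs : ∃ t, t ≠ i ∧ 0 < c t * c i) :
    EmptyTetrahedron (p j) (p k) (p l) (p m) ∧
      det3 (p k - p j) (p l - p j) (p m - p j) ≠ 0 := by
  obtain ⟨s, hsi, hpos⟩ := hs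
  have hc : c i ≠ 0 := by rintro h; rw [h] at hpos; simp at hpos
  have hD := H.det_ne_zero hn hc
  refine ⟨?_, hD⟩
  intro w α β γ hw hα hβ hγ hS z hz
  obtain ⟨t, rfl⟩ := H.exists_eq (H.conv _ (H.mem j) _ (H.mem k) _ (H.mem l) _ (H.mem m) w α β γ hw
    hα hβ hγ hS z hz)
  rcases fin_five_cases hn t with rfl | rfl | rfl | rfl | rfl
  · exfalso
    have hsum := sum_five hn c
    rw [H.sum] at hsum
    have key := eq_zero_of_det3_ne_zero hD (α := c t * α + (w + α + β + γ) * c k)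
      (β := c t * β + (w + α + β + γ) * c l) (γ := c t * γ + (w + α + β + γ) * c m) (by
        intro x
        have h1 := H.dep x
        rw [sum_five hn] at h1
        have h2 := hz x
        simp only [Pi.sub_apply]
        linear_combination (w + α + β + γ) * h1 - c t * h2 + (w + α + β + γ) * p j x * hsum)
    obtain ⟨k1, k2, k3⟩ := key
    have k0 : c t * w + (w + α + β + γ) * c j = 0 := by
      linear_combination -(w + α + β + γ) * hsum - k1 - k2 - k3
    have hfin : ∀ (x : Fin 5) (ω : ℤ), 0 ≤ ω → c t * ω + (w + α + β + γ) * c x = 0 →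
        0 < c x * c t → False := by
      intro x ω hω h1 h2
      have h3 : (w + α + β + γ) * (c x * c t) = -(c t * c t * ω) := by linear_combination c t * h1
      have h4 := mul_pos hS h2
      have h5 := mul_nonneg (mul_self_nonneg (c t)) hω
      linarith
    rcases fin_five_cases hn s with rfl | rfl | rfl | rfl | rfl
    · exact hsi rfl
    · exact hfin _ _ hw k0 hpos
    · exact hfin _ _ hα k1 hpos
    · exact hfin _ _ hβ k2 hpos
    · exact hfin _ _ hγ k3 hpos
  · exact Or.inl rfl
  · exact Or.inr (Or.inl rfl)
  · exact Or.inr (Or.inr (Or.inl rfl))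
  · exact Or.inr (Or.inr (Or.inr rfl))

/-- A functional with given values on the tetrahedron that omits the point `i`; its value there is
determined by the dependence. -/
theorem FivePoints.of_hasValues (H : FivePoints A p c) {i j k l m : Fin 5}
    (hn : [i, j, k, l, m].Nodup) {α β γ : ℤ} (h : HasValues (p j) (p k) (p l) (p m) α β γ) :
    ∃ h, IsIntAffine h ∧ h (p j) = 0 ∧ h (p k) = α ∧ h (p l) = β ∧ h (p m) = γ ∧
      c i * h (p i) + c k * α + c l * β + c m * γ = 0 := by
  obtain ⟨n, h1, h2, h3⟩ := h
  rw [dotProduct_sub] at h1 h2 h3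
  have hh : IsIntAffine fun x => n ⬝ᵥ x + -(n ⬝ᵥ p j) := ⟨n, _, fun _ => rfl⟩
  refine ⟨_, hh, by ring, by linarith, by linarith, by linarith, ?_⟩
  have hs := H.sum_mul hh
  rw [sum_five hn] at hs
  linear_combination hs - c k * h1 - c l * h2 - c m * h3

/-- White's theorem for the tetrahedron that omits the point `i`: one of its points `k`, `l`, `m`
is at the level of `j`, and the other two are one level higher. Since the width is larger than one,
`i` lies on neither of the two levels. -/
theorem FivePoints.white (H : FivePoints A p c) {i j k l m : Fin 5}
    (hn : [i, j, k, l, m].Nodup) (hs : ∃ t, t ≠ i ∧ 0 < c t * c i) :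
    ∃ h, IsIntAffine h ∧ h (p j) = 0 ∧ ((h (p k) = 0 ∧ h (p l) = 1 ∧ h (p m) = 1) ∨
      (h (p k) = 1 ∧ h (p l) = 0 ∧ h (p m) = 1) ∨ (h (p k) = 1 ∧ h (p l) = 1 ∧ h (p m) = 0)) ∧
      c i * h (p i) + c k * h (p k) + c l * h (p l) + c m * h (p m) = 0 ∧
      h (p i) ≠ 0 ∧ h (p i) ≠ 1 := by
  obtain ⟨hT, hD⟩ := H.tetrahedron hn hs
  have hfin : ∀ h : (Fin 3 → ℤ) → ℤ, IsIntAffine h → h (p j) = 0 →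
      (h (p k) = 0 ∨ h (p k) = 1) → (h (p l) = 0 ∨ h (p l) = 1) → (h (p m) = 0 ∨ h (p m) = 1) →
      (h (p k) = 1 ∨ h (p l) = 1) → h (p i) ≠ 0 ∧ h (p i) ≠ 1 := by
    intro h hh h1 h2 h3 h4 h5
    have : ¬(h (p i) = 0 ∨ h (p i) = 1) := by
      intro h6
      have := H.const_of_bits hh (by
        intro t
        rcases fin_five_cases hn t with rfl | rfl | rfl | rfl | rfl
        · exact h6
        · exact Or.inl h1
        · exact h2
        · exact h3
        · exact h4)
      have e1 := this j k
      have e2 := this j l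
      omega
    tauto
  rcases hT.width_one hD with h | h | h <;>
    obtain ⟨h, hh, h1, h2, h3, h4, h5⟩ := H.of_hasValues hn h <;>
    refine ⟨h, hh, h1, ?_, by rw [h2, h3, h4]; exact h5, hfin h hh h1 (by simp [h2]) (by simp [h3])
      (by simp [h4]) (by simp [h2, h3])⟩ <;>
    simp [h2, h3, h4]

/-- A functional that vanishes at `j`, `k`, `l` is a multiple of the primitive normal functional of
the unimodular triangle with these vertices, whose value at `m` is the determinant. -/
theorem FivePoints.det_dvd (H : FivePoints A p c) {i j k l m : Fin 5}
    (hn : [i, j, k, l, m].Nodup) (hs : ∃ t, t ≠ i ∧ 0 < c t * c i) {h : (Fin 3 → ℤ) → ℤ}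
    (hh : IsIntAffine h) (hj : h (p j) = 0) (hk : h (p k) = 0) (hl : h (p l) = 0) :
    det3 (p k - p j) (p l - p j) (p m - p j) ∣ h (p m) := by
  obtain ⟨hT, hD⟩ := H.tetrahedron hn hs
  obtain ⟨q, hq⟩ := (hT.emptyTriangle hD).exists_det3_eq_one (cross3_ne_zero_of_det3_ne_zero hD)
  obtain ⟨x, y, hxy⟩ := exists_coords_of_det3_eq_one hq (p m - p j)
  obtain ⟨n, κ, hn⟩ := hh
  rw [hn, dot3] at hj hk hl ⊢
  have e0 := hxy 0
  have e1 := hxy 1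
  have e2 := hxy 2
  simp only [Pi.sub_apply] at e0 e1 e2
  refine ⟨n ⬝ᵥ q, ?_⟩
  rw [dot3]
  linear_combination hj + n 0 * e0 + n 1 * e1 + n 2 * e2 + x * (hk - hj) + y * (hl - hj)

end FivePoints

/-! ### Dependences with two or fewer coefficients of each sign, or three and two -/

section FivePoints

variable {A : Set (Fin 3 → ℤ)} {p : Fin 5 → Fin 3 → ℤ} {c : Fin 5 → ℤ}

/-- A dependence between two points only would make them equal. -/
theorem FivePoints.not_one_one (H : FivePoints A p c) (h1 : c 1 = 0) (h2 : c 2 = 0) (h3 : c 3 = 0)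
    (h0 : 0 < c 0) : False := by
  have hs := H.sum
  rw [Fin.sum_univ_five] at hs
  have : p 0 = p 4 := by
    funext t
    have hd := H.dep t
    rw [Fin.sum_univ_five] at hd
    simp only [h1, h2, h3] at hs hd
    have h4 : c 0 * (p 0 t - p 4 t) = 0 := by linear_combination hd - p 4 t * hs
    linarith [(mul_eq_zero.1 h4).resolve_left h0.ne']
  exact absurd (H.inj this) (by decide)

/-- Three coefficients are positive and two are negative. White's theorem is
applied to the tetrahedron that omits `0` or `4`, whichever has the larger coefficient in absolute
value. This point, too, then lies on one of the two levels of the tetrahedron. -/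
theorem FivePoints.not_three_two (H : FivePoints A p c) (h0 : 0 < c 0) (h1 : 0 < c 1) (h2 : 0 < c 2)
    (h3 : c 3 < 0) (h43 : c 4 ≤ c 3) : False := by
  have hs := H.sum
  rw [Fin.sum_univ_five] at hs
  by_cases hle : c 0 ≤ -c 4
  · obtain ⟨h, -, e3, hkl, heq, hn0, hn1⟩ := H.white (i := 4) (j := 3) (k := 0) (l := 1) (m := 2)
      (by decide) ⟨3, by decide, by nlinarith⟩
    have hge : 2 ≤ h (p 4) := by
      have : 0 < h (p 4) := by
        by_contra hneg
        rcases hkl with ⟨e0, e1, e2⟩ | ⟨e0, e1, e2⟩ | ⟨e0, e1, e2⟩ <;> rw [e0, e1, e2] at heq <;>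
          nlinarith
      omega
    rcases hkl with ⟨e0, e1, e2⟩ | ⟨e0, e1, e2⟩ | ⟨e0, e1, e2⟩ <;> rw [e0, e1, e2] at heq <;>
      nlinarith
  · obtain ⟨h, -, e1, hkl, heq, hn0, hn1⟩ := H.white (i := 0) (j := 1) (k := 2) (l := 3) (m := 4)
      (by decide) ⟨1, by decide, by nlinarith⟩
    rcases hkl with ⟨e2, e3, e4⟩ | ⟨e2, e3, e4⟩ | ⟨e2, e3, e4⟩ <;> rw [e2, e3, e4] at heq
    · have : h (p 0) < 2 := by nlinarith
      have : 0 < h (p 0) := by nlinarith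
      omega
    · have : h (p 0) < 1 := by nlinarith
      have : -1 < h (p 0) := by nlinarith
      omega
    · have : h (p 0) < 1 := by nlinarith
      have : -1 < h (p 0) := by nlinarith
      omega

/-- Two coefficients are positive, two are negative, and `2` is the apex over the quadrilateral
formed by the other points. White's theorem makes the quadrilateral a parallelogram. The functionals
for the tetrahedra that omit `0` and `1` add up to one that is constant on the parallelogram, and
this bounds the volume by two, so that all patterns of White's theorem are available. -/
theorem FivePoints.not_two_two (H : FivePoints A p c) (h1 : 0 < c 1) (h10 : c 1 ≤ c 0) (h2 : c 2 = 0)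
    (h3 : c 3 < 0) (h43 : c 4 ≤ c 3) (hmax : -c 4 ≤ c 0) : False := by
  have hs := H.sum
  rw [Fin.sum_univ_five, h2] at hs
  obtain ⟨h, hh, e2, hkl, heq, hn0, hn1⟩ := H.white (i := 0) (j := 2) (k := 1) (l := 3) (m := 4)
    (by decide) ⟨1, by decide, by nlinarith⟩
  -- the two diagonals of the quadrilateral `0`, `3`, `1`, `4` bisect each other
  obtain ⟨c10, c30, c40, hv⟩ : c 1 = c 0 ∧ c 3 = -c 0 ∧ c 4 = -c 0 ∧
      (h (p 0) = 2 ∧ h (p 1) = 0 ∧ h (p 3) = 1 ∧ h (p 4) = 1) := by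
    rcases hkl with ⟨e1, e3, e4⟩ | ⟨e1, e3, e4⟩ | ⟨e1, e3, e4⟩ <;> rw [e1, e3, e4] at heq
    · have hge : 2 ≤ h (p 0) := by
        have : 0 < h (p 0) := by nlinarith
        omega
      have hle : h (p 0) ≤ 2 := by
        by_contra hlt
        have : 3 ≤ h (p 0) := by omega
        nlinarith
      have heq2 : h (p 0) = 2 := le_antisymm hle hge
      rw [heq2] at heq
      refine ⟨?_, ?_, ?_, heq2, e1, e3, e4⟩ <;> linarith
    · exfalso
      have : h (p 0) < 1 := by nlinarith
      have : -1 < h (p 0) := by nlinarith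
      omega
    · exfalso
      have : h (p 0) < 1 := by nlinarith
      have : -1 < h (p 0) := by nlinarith
      omega
  have c0 : c 0 = 1 := by
    have := H.prim (c 0) (by
      intro i
      fin_cases i <;> simp [c10, c30, c40, h2])
    rcases Int.isUnit_iff.1 this with h | h <;> linarith
  rw [c0] at c10 c30 c40
  obtain ⟨g, hg, f2, hkl', heq', hn0', hn1'⟩ := H.white (i := 1) (j := 2) (k := 0) (l := 3) (m := 4)
    (by decide) ⟨0, by decide, by rw [c0, c10]; norm_num⟩
  rw [c0, c10, c30, c40] at heq'
  have hv' : g (p 0) = 0 ∧ g (p 1) = 2 ∧ g (p 3) = 1 ∧ g (p 4) = 1 := by omega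
  have hsum : IsIntAffine fun x => (-1) * (h x + g x) + 2 :=
    ((hh.add hg).const_mul (-1)).add (isIntAffine_const 2)
  have hdvd := H.det_dvd (i := 0) (j := 1) (k := 3) (l := 4) (m := 2) (by decide)
    ⟨1, by decide, by rw [c0, c10]; norm_num⟩ hsum (by simp [hv, hv']) (by simp [hv, hv'])
    (by simp [hv, hv'])
  simp only [e2, f2] at hdvd
  have hT := (H.tetrahedron (i := 0) (j := 1) (k := 3) (l := 4) (m := 2) (by decide)
    ⟨1, by decide, by rw [c0, c10]; norm_num⟩).1
  obtain ⟨f, hf, f1, f3, f4, f2, f0⟩ := H.of_hasValues (i := 0) (by decide)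
    (hT.hasValues_of_dvd_two (by simpa using hdvd)).1
  rw [c0, c30, c40, h2] at f0
  have := H.const_of_bits hf (by intro i; fin_cases i <;> simp [*]; omega) 1 2
  rw [f1, f2] at this
  norm_num at this

/-- The point `4` lies on the segment from `0` to `1`, and it is its midpoint by White's theorem.
The sum or the difference of the functionals for the tetrahedra that omit `0` and `1` either takes
two consecutive values or bounds the volume by two. -/
theorem FivePoints.not_two_one (H : FivePoints A p c) (h0 : 0 < c 0) (h1 : 0 < c 1) (h2 : c 2 = 0)
    (h3 : c 3 = 0) : False := by
  have hs := H.sum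
  rw [Fin.sum_univ_five, h2, h3] at hs
  have t0 : ∃ t, t ≠ 0 ∧ 0 < c t * c 0 := ⟨1, by decide, by nlinarith⟩
  have t1 : ∃ t, t ≠ 1 ∧ 0 < c t * c 1 := ⟨0, by decide, by nlinarith⟩
  obtain ⟨h, hh, e2, hkl, heq, hn0, hn1⟩ := H.white (i := 0) (j := 2) (k := 1) (l := 3) (m := 4)
    (by decide) t0
  obtain ⟨g, hg, f2, gkl, geq, gn0, gn1⟩ := H.white (i := 1) (j := 2) (k := 0) (l := 3) (m := 4)
    (by decide) t1
  have d01 : c 0 ∣ c 1 := by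
    rcases hkl with ⟨e1, e3, e4⟩ | ⟨e1, e3, e4⟩ | ⟨e1, e3, e4⟩ <;> rw [e1, e3, e4] at heq
    · exact ⟨h (p 0) - 1, by linarith⟩
    · exfalso; apply hn1
      have : c 0 * (h (p 0) - 1) = 0 := by linarith
      linarith [(mul_eq_zero.1 this).resolve_left h0.ne']
    · exact ⟨-h (p 0), by linarith⟩
  have d10 : c 1 ∣ c 0 := by
    rcases gkl with ⟨e1, e3, e4⟩ | ⟨e1, e3, e4⟩ | ⟨e1, e3, e4⟩ <;> rw [e1, e3, e4] at geq
    · exact ⟨g (p 1) - 1, by linarith⟩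
    · exfalso; apply gn1
      have : c 1 * (g (p 1) - 1) = 0 := by linarith
      linarith [(mul_eq_zero.1 this).resolve_left h1.ne']
    · exact ⟨-g (p 1), by linarith⟩
  have c10 : c 1 = c 0 := Int.dvd_antisymm h1.le h0.le d10 d01
  have c4 : c 4 = -2 * c 0 := by linarith
  have c0 : c 0 = 1 := by
    have := H.prim (c 0) (by
      intro i
      fin_cases i <;> simp [c10, h2, h3, c4])
    rcases Int.isUnit_iff.1 this with h | h <;> linarith
  rw [c0] at c10 c4
  norm_num at c4
  rw [c0, c10, c4, h3] at heq geq
  have hfin : ∀ x y : Fin 5, (x = 2 ∧ y = 3 ∨ x = 3 ∧ y = 2) → ∀ f, IsIntAffine f → f (p 0) = 0 →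
      f (p 1) = 0 → f (p x) = 2 → f (p y) = 0 → f (p 4) = 0 → False := by
    intro x y hxy f hf f0 f1 fx fy f4
    have hnd : [0, 1, y, 4, x].Nodup := by rcases hxy with ⟨rfl, rfl⟩ | ⟨rfl, rfl⟩ <;> decide
    have hdvd := H.det_dvd hnd t0 hf f1 fy f4
    rw [fx] at hdvd
    obtain ⟨f', hf', f1', fy', f4', fx', f0'⟩ := H.of_hasValues hnd
      ((H.tetrahedron hnd t0).1.hasValues_of_dvd_two hdvd).2.1
    have : c x = 0 ∧ c y = 0 := by rcases hxy with ⟨rfl, rfl⟩ | ⟨rfl, rfl⟩ <;> simp [h2, h3]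
    rw [c0, this.1, this.2] at f0'
    have := H.const_of_bits hf' (by
      intro i
      rcases fin_five_cases hnd i with rfl | rfl | rfl | rfl | rfl <;> omega) 1 x
    omega
  have hcase : (h (p 0) = 2 ∧ h (p 1) = 0 ∧ h (p 3) = 1 ∧ h (p 4) = 1) ∨
      (h (p 0) = -1 ∧ h (p 1) = 1 ∧ h (p 3) = 1 ∧ h (p 4) = 0) := by omega
  have gcase : (g (p 0) = 0 ∧ g (p 1) = 2 ∧ g (p 3) = 1 ∧ g (p 4) = 1) ∨
      (g (p 0) = 1 ∧ g (p 1) = -1 ∧ g (p 3) = 1 ∧ g (p 4) = 0) := by omega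
  have hneg := hh.const_mul (-1)
  have gneg := hg.const_mul (-1)
  rcases hcase with hv | hv <;> rcases gcase with gv | gv
  · exact hfin 2 3 (by simp) _ ((hneg.add gneg).add (isIntAffine_const 2)) (by simp [hv, gv])
      (by simp [hv, gv]) (by simp [e2, f2]) (by simp [hv, gv]) (by simp [hv, gv])
  · have := H.const_of_bits (hneg.add (hg.add (isIntAffine_const 1)))
      (by intro i; fin_cases i <;> simp [hv, gv, e2, f2]) 0 2
    simp [hv, gv, e2, f2] at this
  · have := H.const_of_bits (gneg.add (hh.add (isIntAffine_const 1)))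
      (by intro i; fin_cases i <;> simp [hv, gv, e2, f2]) 0 2
    simp [hv, gv, e2, f2] at this
  · exact hfin 3 2 (by simp) _ (hh.add hg) (by simp [hv, gv])
      (by simp [hv, gv]) (by simp [hv, gv]) (by simp [e2, f2]) (by simp [hv, gv])

/-- If the point `i` does not lie in the tetrahedron of the others, its coefficient is coprime to
every other one: the remaining three points form a unimodular triangle, on which integer functionals
take arbitrary values. -/
theorem FivePoints.isUnit_of_dvd (H : FivePoints A p c) {i j k l m : Fin 5}
    (hn : [i, j, k, l, m].Nodup) (hs : ∃ t, t ≠ i ∧ 0 < c t * c i) {d : ℤ} (hi : d ∣ c i)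
    (hm : d ∣ c m) : IsUnit d := by
  obtain ⟨hT, hD⟩ := H.tetrahedron hn hs
  obtain ⟨q, hq⟩ := (hT.emptyTriangle hD).exists_det3_eq_one (cross3_ne_zero_of_det3_ne_zero hD)
  have key : ∀ α β : ℤ, d ∣ c k * α + c l * β := by
    intro α β
    obtain ⟨n, n1, n2, -⟩ := exists_dot_eq_of_det3_eq_one hq α β 0
    rw [dotProduct_sub] at n1 n2
    have hsum := H.sum_mul (h := fun x => n ⬝ᵥ x + -(n ⬝ᵥ p j)) ⟨n, _, fun _ => rfl⟩
    rw [sum_five hn] at hsum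
    have : c k * α + c l * β = -(c i * (n ⬝ᵥ p i + -(n ⬝ᵥ p j)) + c m * (n ⬝ᵥ p m + -(n ⬝ᵥ p j))) := by
      rw [← n1, ← n2]; linear_combination hsum
    rw [this, dvd_neg]
    exact dvd_add (hi.mul_right _) (hm.mul_right _)
  have hk : d ∣ c k := by simpa using key 1 0
  have hl : d ∣ c l := by simpa using key 0 1
  have hj : d ∣ c j := by
    have := sum_five hn c
    rw [H.sum] at this
    have : c j = -(c i + c k + c l + c m) := by linarith
    rw [this, dvd_neg]
    exact dvd_add (dvd_add (dvd_add hi hk) hl) hm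
  refine H.prim d fun t => ?_
  rcases fin_five_cases hn t with rfl | rfl | rfl | rfl | rfl <;> assumption

/-- Three functionals of determinant one with values in `{0, 1}` at all but one point each give a
box: at the remaining points they cannot be in `{0, 1}`, since the width is larger than one. -/
theorem FivePoints.unimodularlyBoxed_of_bits (H : FivePoints A p c) {a : Fin 3 → Fin 5}
    (ha : Function.Injective a) (n : Fin 3 → Fin 3 → ℤ) (κ : Fin 3 → ℤ)
    (hbit : ∀ i t, t ≠ a i → n i ⬝ᵥ p t + κ i = 0 ∨ n i ⬝ᵥ p t + κ i = 1)
    (hu : IsUnit (det3 (n 0) (n 1) (n 2))) : UnimodularlyBoxed A := by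
  refine ⟨n, κ, p ∘ a, ⟨fun i => H.mem _, H.inj.comp ha, ?_, ?_⟩, hu⟩
  · intro i x hx hxi
    obtain ⟨t, rfl⟩ := H.exists_eq hx
    exact hbit i t fun e => hxi (by rw [e]; rfl)
  · intro i hi
    have hni : n i ≠ 0 := by
      intro h0
      apply hu.ne_zero
      fin_cases i <;> simp at h0 <;> simp [det3, h0]
    refine H.wide.not_bit hni (κ i) fun x hx => ?_
    obtain ⟨t, rfl⟩ := H.exists_eq hx
    by_cases e : t = a i
    · rw [e]; exact hi
    · exact hbit i t e

end FivePoints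

/-! ### Pyramids over a triangle with its barycentre -/

section FivePoints

variable {A : Set (Fin 3 → ℤ)} {p : Fin 5 → Fin 3 → ℤ} {c : Fin 5 → ℤ}

/-- The points `0`, `1`, `2` form a lattice triangle with barycentre `4`, and `3` is an apex. -/
structure Pyramid (A : Set (Fin 3 → ℤ)) (p : Fin 5 → Fin 3 → ℤ) (c : Fin 5 → ℤ) : Prop
    extends FivePoints A p c where
  eq_one : ∀ i, i ≠ 3 → i ≠ 4 → c i = 1
  apex : c 3 = 0

/-- There is a functional that puts `4` and `k` on one level, `j` and the apex one level higher,
and `i` one level lower. -/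
def Skew (p : Fin 5 → Fin 3 → ℤ) (i j k : Fin 5) : Prop :=
  ∃ h, IsIntAffine h ∧ h (p 4) = 0 ∧ h (p i) = -1 ∧ h (p j) = 1 ∧ h (p k) = 0 ∧ h (p 3) = 1

/-- There is a functional that puts the barycentre and the apex on one level, `j` and `k` one level
higher, and `i` two levels lower. -/
def Symm (p : Fin 5 → Fin 3 → ℤ) (i j k : Fin 5) : Prop :=
  ∃ h, IsIntAffine h ∧ h (p 4) = 0 ∧ h (p i) = -2 ∧ h (p j) = 1 ∧ h (p k) = 1 ∧ h (p 3) = 0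

theorem Symm.swap {i j k : Fin 5} (h : Symm p i j k) : Symm p i k j := by
  obtain ⟨h, h0, h1, h2, h3, h4, h5⟩ := h
  exact ⟨h, h0, h1, h2, h4, h3, h5⟩

/-- The point `k` of the base does not lie in the tetrahedron of the other four. -/
theorem Pyramid.exists_pos (H : Pyramid A p c) {i j k : Fin 5} (hn : [k, 4, i, j, 3].Nodup) :
    ∃ t, t ≠ k ∧ 0 < c t * c k := by
  refine ⟨i, ?_, ?_⟩
  · rintro rfl; simp at hn
  · rw [H.eq_one i, H.eq_one k]
    · norm_num
    all_goals rintro rfl; simp at hn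

theorem Pyramid.coeff (H : Pyramid A p c) {i j k : Fin 5} (hn : [k, 4, i, j, 3].Nodup) :
    c i = 1 ∧ c j = 1 ∧ c k = 1 := by
  refine ⟨H.eq_one i ?_ ?_, H.eq_one j ?_ ?_, H.eq_one k ?_ ?_⟩ <;> rintro rfl <;> simp at hn

/-- White's theorem for the tetrahedron that omits the point `i` of the base. -/
theorem Pyramid.patterns (H : Pyramid A p c) {i j k : Fin 5} (hn : [i, 4, j, k, 3].Nodup) :
    Skew p i j k ∨ Skew p i k j ∨ Symm p i j k := by
  obtain ⟨h, hh, h4, hkl, heq, -, -⟩ := H.white hn (H.exists_pos hn)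
  obtain ⟨cj, ck, ci⟩ := H.coeff hn
  rw [cj, ck, ci, H.apex] at heq
  rcases hkl with ⟨e1, e2, e3⟩ | ⟨e1, e2, e3⟩ | ⟨e1, e2, e3⟩ <;> rw [e1, e2, e3] at heq
  · exact Or.inr (Or.inl ⟨h, hh, h4, by linarith, e2, e1, e3⟩)
  · exact Or.inl ⟨h, hh, h4, by linarith, e1, e2, e3⟩
  · exact Or.inr (Or.inr ⟨h, hh, h4, by linarith, e1, e2, e3⟩)

theorem Pyramid.skew_of_hasValues (H : Pyramid A p c) {i j k : Fin 5}
    (hn : [i, 4, j, k, 3].Nodup) (h : HasValues (p 4) (p j) (p k) (p 3) 1 0 1) : Skew p i j k := by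
  obtain ⟨h, hh, h4, hj, hk, h3, heq⟩ := H.of_hasValues hn h
  obtain ⟨cj, ck, ci⟩ := H.coeff hn
  rw [cj, ck, ci, H.apex] at heq
  exact ⟨h, hh, h4, by linarith, hj, hk, h3⟩

theorem Pyramid.skew_of_hasValues' (H : Pyramid A p c) {i j k : Fin 5}
    (hn : [i, 4, j, k, 3].Nodup) (h : HasValues (p 4) (p j) (p k) (p 3) 0 1 1) : Skew p i k j := by
  obtain ⟨h, hh, h4, hj, hk, h3, heq⟩ := H.of_hasValues hn h
  obtain ⟨cj, ck, ci⟩ := H.coeff hn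
  rw [cj, ck, ci, H.apex] at heq
  exact ⟨h, hh, h4, by linarith, hk, hj, h3⟩

/-- A box for the exceptional points `i`, `j` and the apex, the third functional being the normal of
the base plane. -/
theorem Pyramid.unimodularlyBoxed_of_pair (H : Pyramid A p c) {i j k : Fin 5}
    (hn : [k, 4, i, j, 3].Nodup) {f g : (Fin 3 → ℤ) → ℤ} (hf : IsIntAffine f) (hg : IsIntAffine g)
    (hf4 : f (p 4) = 0) (hg4 : g (p 4) = 0)
    (hfb : ∀ t, t ≠ i → f (p t) = 0 ∨ f (p t) = 1) (hgb : ∀ t, t ≠ j → g (p t) = 0 ∨ g (p t) = 1)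
    (hu : IsUnit (f (p i) * g (p j) - f (p j) * g (p i))) : UnimodularlyBoxed A := by
  obtain ⟨hT, hD⟩ := H.tetrahedron hn (H.exists_pos hn)
  obtain ⟨q, hq⟩ := (hT.emptyTriangle hD).exists_det3_eq_one (cross3_ne_zero_of_det3_ne_zero hD)
  obtain ⟨ci, cj, ck⟩ := H.coeff hn
  obtain ⟨n, κ, hn'⟩ := hf
  obtain ⟨n', κ', hn''⟩ := hg
  set ν := cross3 (p i - p 4) (p j - p 4) with hν
  have hinj : Function.Injective ![i, j, 3] := by
    intro a b
    fin_cases a <;> fin_cases b <;> simp <;> rintro rfl <;> simp at hn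
  have νi : ν ⬝ᵥ (p i - p 4) = 0 := by rw [hν, cross3_dot]; unfold det3; ring
  have νj : ν ⬝ᵥ (p j - p 4) = 0 := by rw [hν, cross3_dot]; unfold det3; ring
  have νq : ν ⬝ᵥ q = 1 := by rw [hν, cross3_dot, hq]
  have hνaff : IsIntAffine fun x => ν ⬝ᵥ x + -(ν ⬝ᵥ p 4) := ⟨ν, _, fun _ => rfl⟩
  rw [dotProduct_sub] at νi νj
  refine H.unimodularlyBoxed_of_bits hinj ![n, n', ν] ![κ, κ', -(ν ⬝ᵥ p 4)] ?_ ?_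
  · intro a t ht
    fin_cases a
    · simpa [hn'] using hfb t (by simpa using ht)
    · simpa [hn''] using hgb t (by simpa using ht)
    · left
      simp at ht ⊢
      have hsum := H.sum_mul hνaff
      rw [sum_five hn, H.apex, ci, cj, ck] at hsum
      rcases fin_five_cases hn t with rfl | rfl | rfl | rfl | rfl
      · linarith
      · ring
      · linarith
      · linarith
      · exact absurd rfl ht
  · have h1 := det3_mul_det3 n n' ν (p i - p 4) (p j - p 4) q
    have e : ∀ t, n ⬝ᵥ (p t - p 4) = f (p t) ∧ n' ⬝ᵥ (p t - p 4) = g (p t) := by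
      intro t
      rw [dotProduct_sub, dotProduct_sub]
      have e1 := hn' (p t)
      have e2 := hn' (p 4)
      have e3 := hn'' (p t)
      have e4 := hn'' (p 4)
      constructor <;> linarith
    rw [hq, mul_one, νq, dotProduct_sub ν (p i), dotProduct_sub ν (p j), νi, νj, (e i).1, (e i).2,
      (e j).1, (e j).2] at h1
    convert hu using 1
    exact h1.trans (by simp [det3])

theorem Skew.bits {i j k : Fin 5} (hn : [i, 4, j, k, 3].Nodup) {h : (Fin 3 → ℤ) → ℤ}
    (h4 : h (p 4) = 0) (hj : h (p j) = 0 ∨ h (p j) = 1) (hk : h (p k) = 0 ∨ h (p k) = 1)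
    (h3 : h (p 3) = 0 ∨ h (p 3) = 1) (t : Fin 5) (ht : t ≠ i) : h (p t) = 0 ∨ h (p t) = 1 := by
  rcases fin_five_cases hn t with rfl | rfl | rfl | rfl | rfl
  · exact absurd rfl ht
  · exact Or.inl h4
  · exact hj
  · exact hk
  · exact h3

theorem nodup_pyramid {i j k : Fin 5} (hn : [i, 4, j, k, 3].Nodup) :
    [i, 4, k, j, 3].Nodup ∧ [j, 4, i, k, 3].Nodup ∧ [j, 4, k, i, 3].Nodup ∧
      [k, 4, i, j, 3].Nodup ∧ [k, 4, j, i, 3].Nodup := by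
  revert i j k; decide

/-- The two functionals have values `-1, 1` and `0, -1` at `i` and `j`. -/
theorem Pyramid.of_skew_skew (H : Pyramid A p c) {i j k : Fin 5} (hn : [i, 4, j, k, 3].Nodup)
    (hi : Skew p i j k) (hj : Skew p j k i) : UnimodularlyBoxed A := by
  obtain ⟨f, hf, f4, fi, fj, fk, f3⟩ := hi
  obtain ⟨g, hg, g4, gj, gk, gi, g3⟩ := hj
  have hs := nodup_pyramid hn
  exact H.unimodularlyBoxed_of_pair hs.2.2.2.1 hf hg f4 g4
    (Skew.bits hn f4 (by simp [fj]) (by simp [fk]) (by simp [f3]))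
    (Skew.bits hs.2.2.1 g4 (by simp [gk]) (by simp [gi]) (by simp [g3])) (by simp [*])

/-- The two functionals have values `-1, 0` and `0, -1` at `i` and `j`. -/
theorem Pyramid.of_skew_skew' (H : Pyramid A p c) {i j k : Fin 5} (hn : [i, 4, j, k, 3].Nodup)
    (hi : Skew p i k j) (hj : Skew p j k i) : UnimodularlyBoxed A := by
  obtain ⟨f, hf, f4, fi, fk, fj, f3⟩ := hi
  obtain ⟨g, hg, g4, gj, gk, gi, g3⟩ := hj
  have hs := nodup_pyramid hn
  exact H.unimodularlyBoxed_of_pair hs.2.2.2.1 hf hg f4 g4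
    (Skew.bits hn f4 (by simp [fj]) (by simp [fk]) (by simp [f3]))
    (Skew.bits hs.2.2.1 g4 (by simp [gk]) (by simp [gi]) (by simp [g3])) (by simp [*])

/-- The two functionals have values `-2, 1` and `1, -1` at `i` and `j`. -/
theorem Pyramid.of_symm_skew (H : Pyramid A p c) {i j k : Fin 5} (hn : [i, 4, j, k, 3].Nodup)
    (hi : Symm p i j k) (hj : Skew p j i k) : UnimodularlyBoxed A := by
  obtain ⟨f, hf, f4, fi, fj, fk, f3⟩ := hi
  obtain ⟨g, hg, g4, gj, gi, gk, g3⟩ := hj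
  have hs := nodup_pyramid hn
  exact H.unimodularlyBoxed_of_pair hs.2.2.2.1 hf hg f4 g4
    (Skew.bits hn f4 (by simp [fj]) (by simp [fk]) (by simp [f3]))
    (Skew.bits hs.2.2.1 g4 (by simp [gk]) (by simp [gi]) (by simp [g3])) (by simp [*])

/-- Two skew functionals give a box unless they exchange their points, and of three skew
functionals, for the three points of the base, there are two that do not. -/
theorem Pyramid.of_all_skew (H : Pyramid A p c) (h : ∀ i j k, [i, 4, j, k, 3].Nodup →
    Skew p i j k ∨ Skew p i k j) : UnimodularlyBoxed A := by
  rcases h 0 1 2 (by decide) with h0 | h0 <;> rcases h 1 0 2 (by decide) with h1 | h1 <;>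
    rcases h 2 0 1 (by decide) with h2 | h2
  · exact H.of_skew_skew (i := 2) (j := 0) (k := 1) (by decide) h2 h0
  · exact H.of_skew_skew (i := 2) (j := 1) (k := 0) (by decide) h2 h1
  · exact H.of_skew_skew (i := 0) (j := 1) (k := 2) (by decide) h0 h1
  · exact H.of_skew_skew (i := 0) (j := 1) (k := 2) (by decide) h0 h1
  · exact H.of_skew_skew (i := 1) (j := 0) (k := 2) (by decide) h1 h0
  · exact H.of_skew_skew (i := 1) (j := 0) (k := 2) (by decide) h1 h0
  · exact H.of_skew_skew' (i := 0) (j := 1) (k := 2) (by decide) h0 h1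
  · exact H.of_skew_skew' (i := 0) (j := 1) (k := 2) (by decide) h0 h1

/-- Two skew functionals that exchange their points add up to one that vanishes on the base and
has value two at the apex. The volume is then at most two, and all patterns occur. -/
theorem Pyramid.skew_of_skew_skew (H : Pyramid A p c) {i j k : Fin 5}
    (hn : [i, 4, j, k, 3].Nodup) (hj : Skew p j k i) (hk : Skew p k j i) {i' j' k' : Fin 5}
    (hn' : [i', 4, j', k', 3].Nodup) : Skew p i' j' k' := by
  obtain ⟨f, hf, f4, fj, fk, fi, f3⟩ := hj
  obtain ⟨g, hg, g4, gk, gj, gi, g3⟩ := hk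
  have hsum : ∀ t, t ≠ 3 → f (p t) + g (p t) = 0 := by
    intro t ht
    rcases fin_five_cases hn t with rfl | rfl | rfl | rfl | rfl
    · rw [fi, gi]; ring
    · rw [f4, g4]; ring
    · rw [fj, gj]; ring
    · rw [fk, gk]; ring
    · exact absurd rfl ht
  have hne : j' ≠ 3 ∧ k' ≠ 3 := by constructor <;> rintro rfl <;> simp at hn'
  have hdvd := H.det_dvd hn' (H.exists_pos hn') (hf.add hg) (hsum 4 (by decide)) (hsum j' hne.1)
    (hsum k' hne.2)
  simp only [f3, g3] at hdvd
  exact H.skew_of_hasValues hn'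
    ((H.tetrahedron hn' (H.exists_pos hn')).1.hasValues_of_dvd_two hdvd).2.1

/-- Two symmetric functionals have determinant three on the base and vanish on the edge from the
barycentre to the apex, which is primitive. The volume then divides three, and two of the three
patterns occur. -/
theorem Pyramid.skew_of_symm_symm (H : Pyramid A p c) {i j k : Fin 5}
    (hn : [i, 4, j, k, 3].Nodup) (hj : Symm p j k i) (hk : Symm p k j i) :
    Skew p i j k ∨ Skew p i k j := by
  obtain ⟨hT, hD⟩ := H.tetrahedron hn (H.exists_pos hn)
  have hdvd : det3 (p j - p 4) (p k - p 4) (p 3 - p 4) ∣ 3 := by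
    have hT' : EmptyTetrahedron (p 4) (p 3) (p j) (p k) := by
      intro w α β γ hw hα hβ hγ hpos z hz
      rcases hT w β γ α hw hβ hγ hα (by linarith) z (by
        intro t; linear_combination hz t) with h | h | h | h <;> simp [h]
    have hD' : det3 (p 3 - p 4) (p j - p 4) (p k - p 4) ≠ 0 := by
      intro h0; apply hD; rw [← h0]; unfold det3; ring
    obtain ⟨r, hr⟩ := (hT'.emptyTriangle hD').exists_det3_eq_one
      (cross3_ne_zero_of_det3_ne_zero hD')
    obtain ⟨m, hm, -, -⟩ := exists_dot_eq_of_det3_eq_one hr 1 0 0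
    obtain ⟨f, ⟨n, κ, hf⟩, f4, fj, fk, fi, f3⟩ := hj
    obtain ⟨g, ⟨n', κ', hg⟩, g4, gk, gj, gi, g3⟩ := hk
    rw [hf] at f4 fj fk f3
    rw [hg] at g4 gj gk g3
    have e := det3_mul_det3 n n' m (p j - p 4) (p k - p 4) (p 3 - p 4)
    rw [hm, dotProduct_sub n, dotProduct_sub n, dotProduct_sub n, dotProduct_sub n',
      dotProduct_sub n', dotProduct_sub n', show n ⬝ᵥ p j - n ⬝ᵥ p 4 = -2 by linarith,
      show n ⬝ᵥ p k - n ⬝ᵥ p 4 = 1 by linarith, show n ⬝ᵥ p 3 - n ⬝ᵥ p 4 = 0 by linarith,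
      show n' ⬝ᵥ p j - n' ⬝ᵥ p 4 = 1 by linarith,
      show n' ⬝ᵥ p k - n' ⬝ᵥ p 4 = -2 by linarith, show n' ⬝ᵥ p 3 - n' ⬝ᵥ p 4 = 0 by linarith] at e
    have e3 : det3 n n' m * det3 (p j - p 4) (p k - p 4) (p 3 - p 4) = 3 := by
      rw [e]; simp [det3]
    exact ⟨_, by rw [mul_comm]; exact e3.symm⟩
  rcases (hT.hasValues_of_dvd_three hdvd).1 with h | h
  · exact Or.inr (H.skew_of_hasValues' hn h)
  · exact Or.inl (H.skew_of_hasValues hn h)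

/-- If there were no box, a symmetric functional at one point of the base would force symmetric
functionals at all of them, and these would force a skew one. -/
theorem Pyramid.unimodularlyBoxed (H : Pyramid A p c) : UnimodularlyBoxed A := by
  by_contra hU
  have hs : ∀ i j k, [i, 4, j, k, 3].Nodup → Symm p i j k → ¬ Skew p j i k := fun i j k hn hi hj =>
    hU (H.of_symm_skew hn hi hj)
  have hone : ∀ i j k, [i, 4, j, k, 3].Nodup → Symm p i j k → Symm p j i k := by
    intro i j k hn hi
    obtain ⟨n1, n2, n3, n4, n5⟩ := nodup_pyramid hn
    rcases H.patterns n2 with h | h | h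
    · exact absurd h (hs i j k hn hi)
    · exfalso
      rcases H.patterns n4 with h' | h' | h'
      · exact hs i k j n1 hi.swap h'
      · exact hU (H.of_all_skew fun i' j' k' hn' =>
          Or.inl (H.skew_of_skew_skew hn h h' hn'))
      · exact hs k j i n5 h'.swap h
    · exact h
  have hno : ∀ i j k, [i, 4, j, k, 3].Nodup → ¬ Symm p i j k := by
    intro i j k hn hi
    apply hU
    obtain ⟨n1, n2, n3, n4, n5⟩ := nodup_pyramid hn
    have hj := hone i j k hn hi
    have hk := hone i k j n1 hi.swap
    rcases H.skew_of_symm_symm hn hj.swap hk.swap with h | h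
    · exact absurd h (hs j i k n2 hj)
    · exact absurd h (hs k i j n4 hk)
  refine hU (H.of_all_skew fun i j k hn => ?_)
  rcases H.patterns hn with h | h | h
  · exact Or.inl h
  · exact Or.inr h
  · exact absurd h (hno i j k hn)

end FivePoints

/-! ### A bound for the barycentric coordinates of an interior point -/

theorem le_two_of_dvd_add {a x y : ℤ} (hx : 0 < x) (hy : 0 < y) (hxa : x ≤ a) (hya : y ≤ a)
    (h : a ∣ x + y) : x + y = a ∨ (x = a ∧ y = a) := by
  obtain ⟨k, hk⟩ := h
  have h1 : 0 < k := by nlinarith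
  have h2 : k ≤ 2 := by
    by_contra! h3
    nlinarith
  obtain rfl | rfl : k = 1 ∨ k = 2 := by omega
  · left; linarith
  · right; constructor <;> linarith

theorem le_of_dvd_mul {c d : ℤ} (h : IsCoprime c d) {k : ℤ} (hk : 0 < k) (hdvd : c ∣ k * d) :
    c ≤ k :=
  Int.le_of_dvd hk (h.dvd_of_dvd_mul_right hdvd)

/-- The divisibilities that White's theorem forces between the barycentric coordinates of an
interior point bound them: the largest one is a sum of two others, hence the second one is small or
determined by the last two, and then the third one divides a small multiple of the last. -/
theorem barycentric_bound {a b c d : ℤ} (hd : 0 < d) (hdc : d ≤ c) (hcb : c ≤ b) (hba : b ≤ a)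
    (hab : IsCoprime a b) (hac : IsCoprime a c) (had : IsCoprime a d) (hbc : IsCoprime b c)
    (hbd : IsCoprime b d) (hcd : IsCoprime c d)
    (ha : a ∣ b + c ∨ a ∣ b + d ∨ a ∣ c + d) (hb : b ∣ a + c ∨ b ∣ a + d ∨ b ∣ c + d)
    (hc : c ∣ a + b ∨ c ∣ a + d ∨ c ∣ b + d) : a ≤ 12 := by
  have hone : ∀ x : ℤ, IsCoprime x x → x ≤ 12 := by
    intro x hx
    have := Int.isUnit_iff.1 (isCoprime_self.1 hx)
    omega
  have hA : a ≤ 12 ∨ a = b + c ∨ a = b + d ∨ a = c + d := by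
    rcases ha with h | h | h
    · rcases le_two_of_dvd_add (by linarith) (by linarith) hba (by linarith) h with h | ⟨rfl, h⟩
      · right; left; exact h.symm
      · left; exact hone _ hab
    · rcases le_two_of_dvd_add (by linarith) (by linarith) hba (by linarith) h with h | ⟨rfl, h⟩
      · right; right; left; exact h.symm
      · left; exact hone _ hab
    · rcases le_two_of_dvd_add (by linarith) (by linarith) (by linarith) (by linarith) h with
        h | ⟨rfl, h⟩
      · right; right; right; exact h.symm
      · left; exact hone _ hac
  rcases hA with h | hA
  · exact h
  -- either `b ≤ 2`, or `b` is determined by `c` and `d`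
  have hB : a ≤ 12 ∨ b = c + d ∨ (a = c + d ∧ (2 * b = 2 * c + d ∨ 2 * b = c + 2 * d)) := by
    have h1 : b ∣ c + d → a ≤ 12 ∨ b = c + d := by
      intro h
      rcases le_two_of_dvd_add (by linarith) (by linarith) hcb (by linarith) h with h | ⟨rfl, h⟩
      · exact Or.inr h.symm
      · have := Int.isUnit_iff.1 (isCoprime_self.1 hbc)
        left; omega
    have h2 : b ≤ 2 → a ≤ 12 := by intro h; omega
    have h3 : ∀ x y : ℤ, 0 < x → 0 < y → x ≤ b → y ≤ b → x + y = a → b ∣ 2 * x + y →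
        (a ≤ 12 ∨ 2 * b = 2 * x + y) := by
      rintro x y hx hy hxb hyb hxy ⟨k, hk⟩
      have k1 : 1 < k := by nlinarith
      have k2 : k ≤ 3 := by
        by_contra! h3
        nlinarith
      obtain rfl | rfl : k = 2 ∨ k = 3 := by omega
      · right; linarith
      · left
        have hx : x = b := by linarith
        have hy : y = b := by linarith
        have : b ∣ a := ⟨2, by linarith⟩
        have := Int.isUnit_iff.1 (hab.isUnit_of_dvd' this dvd_rfl)
        omega
    have hor : a ≤ 12 ∨ b = c + d → a ≤ 12 ∨ b = c + d ∨
        (a = c + d ∧ (2 * b = 2 * c + d ∨ 2 * b = c + 2 * d)) := Or.imp_right Or.inl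
    rcases hA with e | e | e
    · rcases hb with h | h | h
      · left
        refine h2 (le_of_dvd_mul hbc two_pos ?_)
        have : 2 * c = a + c - b := by linarith
        rw [this]; exact dvd_sub h dvd_rfl
      · have : c + d = a + d - b := by linarith
        exact hor (h1 (by rw [this]; exact dvd_sub h dvd_rfl))
      · exact hor (h1 h)
    · rcases hb with h | h | h
      · have : c + d = a + c - b := by linarith
        exact hor (h1 (by rw [this]; exact dvd_sub h dvd_rfl))
      · left
        refine h2 (le_of_dvd_mul hbd two_pos ?_)
        have : 2 * d = a + d - b := by linarith
        rw [this]; exact dvd_sub h dvd_rfl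
      · exact hor (h1 h)
    · rcases hb with h | h | h
      · rcases h3 c d (by linarith) hd hcb (by linarith) e.symm (by
          have : 2 * c + d = a + c := by linarith
          rwa [this]) with h | h
        · exact Or.inl h
        · exact Or.inr (Or.inr ⟨e, Or.inl h⟩)
      · rcases h3 d c hd (by linarith) (by linarith) hcb (by linarith) (by
          have : 2 * d + c = a + d := by linarith
          rwa [this]) with h | h
        · exact Or.inl h
        · exact Or.inr (Or.inr ⟨e, Or.inr (by linarith)⟩)
      · exact hor (h1 h)
  rcases hB with h | hB
  · exact h
  have hcle : c ≤ 4 := by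
    -- in each case `c` divides a small multiple of `d`
    have hfin : ∀ k x y : ℤ, 0 < k → k ≤ 4 → c ∣ x → (∃ n, x * y = k * d + n * c) → c ≤ 4 := by
      rintro k x y hk hk4 hx ⟨n, hn⟩
      refine (le_of_dvd_mul hcd hk ?_).trans hk4
      have : k * d = x * y - n * c := by linarith
      rw [this]
      exact dvd_sub (hx.mul_right _) (dvd_mul_left _ _)
    rcases hB with hB | ⟨e, hB | hB⟩
    · rcases hA with e | e | e
      · rcases hc with h | h | h
        · exact hfin 2 _ 1 (by norm_num) (by norm_num) h ⟨3, by linarith⟩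
        · exact hfin 2 _ 1 (by norm_num) (by norm_num) h ⟨2, by linarith⟩
        · exact hfin 2 _ 1 (by norm_num) (by norm_num) h ⟨1, by linarith⟩
      · rcases hc with h | h | h
        · exact hfin 3 _ 1 (by norm_num) (by norm_num) h ⟨2, by linarith⟩
        · exact hfin 3 _ 1 (by norm_num) (by norm_num) h ⟨1, by linarith⟩
        · exact hfin 2 _ 1 (by norm_num) (by norm_num) h ⟨1, by linarith⟩
      · rcases hc with h | h | h
        · exact hfin 2 _ 1 (by norm_num) (by norm_num) h ⟨2, by linarith⟩
        · exact hfin 2 _ 1 (by norm_num) (by norm_num) h ⟨1, by linarith⟩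
        · exact hfin 2 _ 1 (by norm_num) (by norm_num) h ⟨1, by linarith⟩
    · rcases hc with h | h | h
      · exact hfin 3 _ 2 (by norm_num) (by norm_num) h ⟨4, by linarith⟩
      · exact hfin 2 _ 1 (by norm_num) (by norm_num) h ⟨1, by linarith⟩
      · exact hfin 3 _ 2 (by norm_num) (by norm_num) h ⟨2, by linarith⟩
    · rcases hc with h | h | h
      · exact hfin 4 _ 2 (by norm_num) (by norm_num) h ⟨3, by linarith⟩
      · exact hfin 2 _ 1 (by norm_num) (by norm_num) h ⟨1, by linarith⟩
      · exact hfin 4 _ 2 (by norm_num) (by norm_num) h ⟨1, by linarith⟩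
  omega

/-! ### Finite tables of barycentric coordinates and patterns -/

theorem barycentric_table : ∀ a ∈ List.range 13, ∀ b ∈ List.range (a + 1), ∀ c ∈ List.range (b + 1),
    ∀ d ∈ List.range (c + 1), 0 < d → Nat.gcd a b = 1 → Nat.gcd a c = 1 → Nat.gcd a d = 1 →
    Nat.gcd b c = 1 → Nat.gcd b d = 1 → Nat.gcd c d = 1 →
    ((b + c) % a = 0 ∨ (b + d) % a = 0 ∨ (c + d) % a = 0) →
    ((a + c) % b = 0 ∨ (a + d) % b = 0 ∨ (c + d) % b = 0) →
    ((a + b) % c = 0 ∨ (a + d) % c = 0 ∨ (b + d) % c = 0) →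
    ((a + b) % d = 0 ∨ (a + c) % d = 0 ∨ (b + c) % d = 0) →
    [a, b, c, d] ∈ [[1, 1, 1, 1], [2, 1, 1, 1], [3, 2, 1, 1], [5, 3, 2, 1], [5, 4, 3, 1],
      [7, 5, 3, 2], [7, 5, 4, 3]] := by
  decide +kernel

/-- The possible barycentric coordinates of an interior point. -/
theorem barycentric_classification {a b c d : ℤ} (hd : 0 < d) (hdc : d ≤ c) (hcb : c ≤ b)
    (hba : b ≤ a) (hab : IsCoprime a b) (hac : IsCoprime a c) (had : IsCoprime a d)
    (hbc : IsCoprime b c) (hbd : IsCoprime b d) (hcd : IsCoprime c d)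
    (ha : a ∣ b + c ∨ a ∣ b + d ∨ a ∣ c + d) (hb : b ∣ a + c ∨ b ∣ a + d ∨ b ∣ c + d)
    (hc : c ∣ a + b ∨ c ∣ a + d ∨ c ∣ b + d) (hd' : d ∣ a + b ∨ d ∣ a + c ∨ d ∣ b + c) :
    ![a, b, c, d] ∈ [![(1 : ℤ), 1, 1, 1], ![2, 1, 1, 1], ![3, 2, 1, 1], ![5, 3, 2, 1],
      ![5, 4, 3, 1], ![7, 5, 3, 2], ![7, 5, 4, 3]] := by
  have hbound := barycentric_bound hd hdc hcb hba hab hac had hbc hbd hcd ha hb hc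
  lift a to ℕ using by linarith
  lift b to ℕ using by linarith
  lift c to ℕ using by linarith
  lift d to ℕ using by linarith
  simp only [← Nat.cast_add, Int.natCast_dvd_natCast, Nat.isCoprime_iff_coprime, Nat.Coprime,
    Nat.cast_le, Nat.dvd_iff_mod_eq_zero] at ha hb hc hd' hab hac had hbc hbd hcd hdc hcb hba
  have := barycentric_table a (by rw [List.mem_range]; omega) b (by rw [List.mem_range]; omega) c
    (by rw [List.mem_range]; omega) d (by rw [List.mem_range]; omega) (by omega) hab hac had hbc hbd
    hcd ha hb hc hd'
  simp only [List.mem_cons, List.cons.injEq, List.not_mem_nil, or_false, and_true] at this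
  rcases this with h | h | h | h | h | h | h <;> obtain ⟨rfl, rfl, rfl, rfl⟩ := h <;> simp

/-- The sum of the two barycentric coordinates other than `i` and `l`. -/
def pairSum (C : Fin 4 → ℤ) (i l : Fin 4) : ℤ := C 0 + C 1 + C 2 + C 3 - C i - C l

/-- The values at the vertices of a functional that vanishes at the interior point and at the
vertex `l` and is one at the two vertices other than `i` and `l`. It is meant for `l ≠ i` and for
`C i` a divisor of `pairSum C i l`. -/
def pairRow (C : Fin 4 → ℤ) (i l j : Fin 4) : ℤ :=
  if j = i then -(pairSum C i l / C i) else if j = l then 0 else 1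

/-- The principal minor of a `4 × 4` matrix that omits row and column `l`. -/
def minor (R : Fin 4 → Fin 4 → ℤ) (l : Fin 4) : ℤ :=
  det3 (fun j => R (l.succAbove 0) (l.succAbove j)) (fun j => R (l.succAbove 1) (l.succAbove j))
    (fun j => R (l.succAbove 2) (l.succAbove j))

/-- Whichever patterns of White's theorem occur at the four vertices, some minor of the matrix of
their values is, up to sign, the barycentric coordinate `C l`, except possibly for the first three
lists of coordinates; and for these, if all minors are divisible by `τ * C l` with `τ` equal to `4`,
`5` or `6`, then some minor is `τ * C l` up to sign. -/
theorem pairRow_table : ∀ C ∈ [![(1 : ℤ), 1, 1, 1], ![2, 1, 1, 1], ![3, 2, 1, 1], ![5, 3, 2, 1],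
      ![5, 4, 3, 1], ![7, 5, 3, 2], ![7, 5, 4, 3]],
    ∀ a b c d : Fin 4, a ≠ 0 → b ≠ 1 → c ≠ 2 → d ≠ 3 →
    pairSum C 0 a % C 0 = 0 → pairSum C 1 b % C 1 = 0 → pairSum C 2 c % C 2 = 0 →
    pairSum C 3 d % C 3 = 0 →
    (∃ l, (minor (fun i => pairRow C i (![a, b, c, d] i)) l).natAbs = (C l).natAbs) ∨
    (C = ![1, 1, 1, 1] ∨ C = ![2, 1, 1, 1] ∨ C = ![3, 2, 1, 1]) ∧
    ∀ τ ∈ [4, 5, 6],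
      (∀ l, (minor (fun i => pairRow C i (![a, b, c, d] i)) l).natAbs % (τ * (C l).natAbs) = 0) →
      ∃ l, (minor (fun i => pairRow C i (![a, b, c, d] i)) l).natAbs = τ * (C l).natAbs := by
  decide +kernel

set_option synthInstance.maxSize 1000 in
/-- For the first three lists of coordinates some minor is at most `6 * C l`, so that it can be
divisible by `τ * C l` only for `τ ≤ 6`. -/
theorem pairRow_table_bound : ∀ C ∈ [![(1 : ℤ), 1, 1, 1], ![2, 1, 1, 1], ![3, 2, 1, 1]],
    ∀ a b c d : Fin 4, a ≠ 0 → b ≠ 1 → c ≠ 2 → d ≠ 3 →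
    pairSum C 0 a % C 0 = 0 → pairSum C 1 b % C 1 = 0 → pairSum C 2 c % C 2 = 0 →
    pairSum C 3 d % C 3 = 0 →
    (∃ l, (minor (fun i => pairRow C i (![a, b, c, d] i)) l).natAbs = (C l).natAbs) ∨
    ∃ l, minor (fun i => pairRow C i (![a, b, c, d] i)) l ≠ 0 ∧
      (minor (fun i => pairRow C i (![a, b, c, d] i)) l).natAbs ≤ 6 * (C l).natAbs := by
  decide +kernel

set_option synthInstance.maxSize 1000 in
/-- If the volumes are `2 * C l`, all patterns occur at the vertices with barycentric coordinate
one, and they can be chosen such that the minor that omits the last vertex is two or violates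
divisibility by two. Where all patterns occur, the given pattern is irrelevant and set to a fixed
value. -/
theorem pairRow_table_two : ∀ C ∈ [![(1 : ℤ), 1, 1, 1], ![2, 1, 1, 1], ![3, 2, 1, 1]],
    ∀ a b c : Fin 4, (if C 0 = 1 then a = 0 else a ≠ 0 ∧ pairSum C 0 a % C 0 = 0) →
      (if C 1 = 1 then b = 1 else b ≠ 1 ∧ pairSum C 1 b % C 1 = 0) →
      (if C 2 = 1 then c = 2 else c ≠ 2 ∧ pairSum C 2 c % C 2 = 0) →
    ∃ a' b' c' : Fin 4, (if C 0 = 1 then a' ≠ 0 else a' = a) ∧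
      (if C 1 = 1 then b' ≠ 1 else b' = b) ∧ (if C 2 = 1 then c' ≠ 2 else c' = c) ∧
      ((minor (fun i => pairRow C i (![a', b', c', 0] i)) 3).natAbs = 2 ∨
        (minor (fun i => pairRow C i (![a', b', c', 0] i)) 3).natAbs % 2 ≠ 0) := by
  decide +kernel

set_option synthInstance.maxSize 1000 in
/-- If the volumes are `3 * C l`, all patterns but one occur at the vertices with barycentric
coordinate one, and they can be chosen such that the minor that omits the last vertex is three or
violates divisibility by three. -/
theorem pairRow_table_three : ∀ C ∈ [![(1 : ℤ), 1, 1, 1], ![2, 1, 1, 1], ![3, 2, 1, 1]],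
    ∀ a b c : Fin 4, a ≠ 0 → b ≠ 1 → c ≠ 2 → (C 0 = 1 ∨ pairSum C 0 a % C 0 = 0) →
      (C 1 = 1 ∨ pairSum C 1 b % C 1 = 0) → (C 2 = 1 ∨ pairSum C 2 c % C 2 = 0) →
    ∃ a' b' c' : Fin 4, (if C 0 = 1 then a' ≠ 0 ∧ a' ≠ a else a' = a) ∧
      (if C 1 = 1 then b' ≠ 1 ∧ b' ≠ b else b' = b) ∧
      (if C 2 = 1 then c' ≠ 2 ∧ c' ≠ c else c' = c) ∧
      ((minor (fun i => pairRow C i (![a', b', c', 0] i)) 3).natAbs = 3 ∨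
        (minor (fun i => pairRow C i (![a', b', c', 0] i)) 3).natAbs % 3 ≠ 0) := by
  decide +kernel

/-! ### Tetrahedra with one interior lattice point -/

/-- The point `4` lies in the interior of the tetrahedron spanned by the other four points, with
barycentric coordinates proportional to `C`. -/
structure InteriorPoint (A : Set (Fin 3 → ℤ)) (p : Fin 5 → Fin 3 → ℤ) (C : Fin 4 → ℤ) : Prop
    extends FivePoints A p (Fin.snoc C (-∑ i, C i)) where
  pos : ∀ i, 0 < C i

section InteriorPoint

variable {A : Set (Fin 3 → ℤ)} {p : Fin 5 → Fin 3 → ℤ} {C : Fin 4 → ℤ}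

theorem nodup_castSucc {i j k l : Fin 4} (h : [i, j, k, l].Nodup) :
    [i.castSucc, 4, j.castSucc, k.castSucc, l.castSucc].Nodup := by
  revert i j k l; decide +kernel

theorem snoc_castSucc (x : ℤ) (i : Fin 4) :
    (Fin.snoc C x : Fin 5 → ℤ) i.castSucc = C i := by
  simp

theorem InteriorPoint.exists_pos (H : InteriorPoint A p C) (i : Fin 4) :
    ∃ t : Fin 5, t ≠ i.castSucc ∧ 0 < (Fin.snoc C (-∑ i, C i) : Fin 5 → ℤ) t *
      (Fin.snoc C (-∑ i, C i) : Fin 5 → ℤ) i.castSucc := by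
  obtain ⟨j, hj⟩ : ∃ j : Fin 4, j.castSucc ≠ i.castSucc := by revert i; decide
  refine ⟨j.castSucc, hj, ?_⟩
  rw [snoc_castSucc, snoc_castSucc]
  exact mul_pos (H.pos j) (H.pos i)

theorem sum_four {i j k l : Fin 4} (h : [i, j, k, l].Nodup) (f : Fin 4 → ℤ) :
    f 0 + f 1 + f 2 + f 3 = f i + f j + f k + f l := by
  have h1 : (Finset.univ : Finset (Fin 4)) = [i, j, k, l].toFinset := by
    revert i j k l; decide +kernel
  rw [← Fin.sum_univ_four, h1, List.sum_toFinset _ h]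
  simp; ring

theorem fin_four_cases {i j k l : Fin 4} (h : [i, j, k, l].Nodup) (t : Fin 4) :
    t = i ∨ t = j ∨ t = k ∨ t = l := by
  revert i j k l t; decide +kernel

/-- The vector `e` consists of the values at the four vertices of an integer affine functional
that vanishes at the interior point. -/
def Realized (p : Fin 5 → Fin 3 → ℤ) (e : Fin 4 → ℤ) : Prop :=
  ∃ h, IsIntAffine h ∧ h (p 4) = 0 ∧ ∀ j : Fin 4, h (p j.castSucc) = e j

theorem InteriorPoint.realized_of_eq (H : InteriorPoint A p C) {i j k l : Fin 4}
    (hn : [i, j, k, l].Nodup) {h : (Fin 3 → ℤ) → ℤ} (hh : IsIntAffine h) (h4 : h (p 4) = 0)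
    (hj : h (p j.castSucc) = 0) (hk : h (p k.castSucc) = 1) (hl : h (p l.castSucc) = 1)
    (hi : C i * h (p i.castSucc) + C k + C l = 0) :
    C i ∣ pairSum C i j ∧ Realized p (pairRow C i j) := by
  have hs : pairSum C i j = C k + C l := by
    unfold pairSum; rw [sum_four hn]; ring
  have hs' : pairSum C i j = C i * -h (p i.castSucc) := by rw [hs]; linarith
  refine ⟨⟨_, hs'⟩, h, hh, h4, fun t => ?_⟩
  have hq : pairSum C i j / C i = -h (p i.castSucc) := by
    rw [hs', Int.mul_ediv_cancel_left _ (H.pos i).ne']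
  simp only [List.nodup_cons, List.mem_cons, not_or] at hn
  rcases fin_four_cases (i := i) (j := j) (k := k) (l := l) (by simp; tauto) t with
    rfl | rfl | rfl | rfl
  · simp [pairRow, hq]
  · simp [pairRow, hj, Ne.symm hn.1.1]
  · simp [pairRow, hk, Ne.symm hn.1.2.1, Ne.symm hn.2.1.1]
  · simp [pairRow, hl, Ne.symm hn.1.2.2.1, Ne.symm hn.2.1.2.1]

theorem InteriorPoint.realized_of_hasValues (H : InteriorPoint A p C) {i j k l : Fin 4}
    (hn : [i, j, k, l].Nodup)
    (h : HasValues (p 4) (p j.castSucc) (p k.castSucc) (p l.castSucc) 0 1 1) :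
    C i ∣ pairSum C i j ∧ Realized p (pairRow C i j) := by
  obtain ⟨h, hh, h4, hj, hk, hl, heq⟩ := H.of_hasValues (nodup_castSucc hn) h
  simp only [snoc_castSucc] at heq
  exact H.realized_of_eq hn hh h4 hj hk hl (by linarith)

theorem HasValues.rotate {o a b c : Fin 3 → ℤ} {α β γ : ℤ} (h : HasValues o a b c α β γ) :
    HasValues o b a c β α γ := by
  obtain ⟨n, h1, h2, h3⟩ := h
  exact ⟨n, h2, h1, h3⟩

theorem HasValues.rotate' {o a b c : Fin 3 → ℤ} {α β γ : ℤ} (h : HasValues o a b c α β γ) :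
    HasValues o c a b γ α β := by
  obtain ⟨n, h1, h2, h3⟩ := h
  exact ⟨n, h3, h1, h2⟩

theorem nodup_four {i j k l : Fin 4} (h : [i, j, k, l].Nodup) :
    [i, k, j, l].Nodup ∧ [i, l, j, k].Nodup := by
  revert i j k l; decide +kernel

theorem exists_nodup_four (i : Fin 4) : ∃ j k l, [i, j, k, l].Nodup := by
  revert i; decide +kernel

/-- White's theorem for the tetrahedron that omits the vertex `i`. -/
theorem InteriorPoint.exists_realized (H : InteriorPoint A p C) (i : Fin 4) :
    ∃ l, l ≠ i ∧ C i ∣ pairSum C i l ∧ Realized p (pairRow C i l) := by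
  obtain ⟨j, k, l, hn⟩ := exists_nodup_four i
  obtain ⟨n1, n2⟩ := nodup_four hn
  obtain ⟨hT, hD⟩ := H.tetrahedron (nodup_castSucc hn) (H.exists_pos i)
  have hne : j ≠ i ∧ k ≠ i ∧ l ≠ i := by
    simp at hn; exact ⟨Ne.symm hn.1.1, Ne.symm hn.1.2.1, Ne.symm hn.1.2.2⟩
  rcases hT.width_one hD with h | h | h
  · exact ⟨j, hne.1, H.realized_of_hasValues hn h⟩
  · exact ⟨k, hne.2.1, H.realized_of_hasValues n1 h.rotate⟩
  · exact ⟨l, hne.2.2, H.realized_of_hasValues n2 h.rotate'⟩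

theorem InteriorPoint.isCoprime (H : InteriorPoint A p C) {i j : Fin 4} (hij : i ≠ j) :
    IsCoprime (C i) (C j) := by
  obtain ⟨k, l, hn⟩ : ∃ k l, [i, k, l, j].Nodup := by revert i j; decide +kernel
  rw [← isRelPrime_iff_isCoprime]
  intro d hi hj
  exact H.isUnit_of_dvd (nodup_castSucc hn) (H.exists_pos i) (by rwa [snoc_castSucc])
    (by rwa [snoc_castSucc])

/-- The edge vectors from the interior point. -/
def spoke (p : Fin 5 → Fin 3 → ℤ) (i : Fin 4) : Fin 3 → ℤ := p i.castSucc - p 4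

theorem InteriorPoint.sum_spoke (H : InteriorPoint A p C) (t : Fin 3) :
    C 0 * spoke p 0 t + C 1 * spoke p 1 t + C 2 * spoke p 2 t + C 3 * spoke p 3 t = 0 := by
  have h1 := H.dep t
  rw [Fin.sum_univ_castSucc] at h1
  simp only [snoc_castSucc, Fin.snoc_last, Fin.sum_univ_four] at h1
  have : (Fin.last 4) = (4 : Fin 5) := rfl
  rw [this] at h1
  simp only [spoke, Pi.sub_apply]
  linear_combination h1

/-- The normalized volumes of the four tetrahedra with apex at the interior point are proportional
to its barycentric coordinates. -/
theorem InteriorPoint.exists_volume (H : InteriorPoint A p C) : ∃ τ : ℕ, 0 < τ ∧ ∀ l : Fin 4,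
    (det3 (spoke p (l.succAbove 0)) (spoke p (l.succAbove 1)) (spoke p (l.succAbove 2))).natAbs =
      τ * (C l).natAbs := by
  have e0 := H.sum_spoke 0
  have e1 := H.sum_spoke 1
  have e2 := H.sum_spoke 2
  set u := spoke p with hu
  have v1 : C 0 * det3 (u 0) (u 2) (u 3) = -(C 1 * det3 (u 1) (u 2) (u 3)) := by
    unfold det3
    linear_combination (u 2 1 * u 3 2 - u 2 2 * u 3 1) * e0 - (u 2 0 * u 3 2 - u 2 2 * u 3 0) * e1 +
      (u 2 0 * u 3 1 - u 2 1 * u 3 0) * e2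
  have v2 : C 0 * det3 (u 0) (u 1) (u 3) = C 2 * det3 (u 1) (u 2) (u 3) := by
    unfold det3
    linear_combination (u 1 1 * u 3 2 - u 1 2 * u 3 1) * e0 - (u 1 0 * u 3 2 - u 1 2 * u 3 0) * e1 +
      (u 1 0 * u 3 1 - u 1 1 * u 3 0) * e2
  have v3 : C 0 * det3 (u 0) (u 1) (u 2) = -(C 3 * det3 (u 1) (u 2) (u 3)) := by
    unfold det3
    linear_combination (u 1 1 * u 2 2 - u 1 2 * u 2 1) * e0 - (u 1 0 * u 2 2 - u 1 2 * u 2 0) * e1 +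
      (u 1 0 * u 2 1 - u 1 1 * u 2 0) * e2
  have hD : det3 (u 1) (u 2) (u 3) ≠ 0 :=
    (H.tetrahedron (nodup_castSucc (i := 0) (j := 1) (k := 2) (l := 3) (by decide))
      (H.exists_pos 0)).2
  obtain ⟨t, ht⟩ : C 0 ∣ det3 (u 1) (u 2) (u 3) := by
    refine (H.isCoprime (i := 0) (j := 1) (by decide)).dvd_of_dvd_mul_left ?_
    exact ⟨-det3 (u 0) (u 2) (u 3), by linarith⟩
  have hc := (H.pos 0).ne'
  rw [ht] at v1 v2 v3 hD
  have w1 : det3 (u 0) (u 2) (u 3) = -(t * C 1) := mul_left_cancel₀ hc (by linarith)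
  have w2 : det3 (u 0) (u 1) (u 3) = t * C 2 := mul_left_cancel₀ hc (by linarith)
  have w3 : det3 (u 0) (u 1) (u 2) = -(t * C 3) := mul_left_cancel₀ hc (by linarith)
  refine ⟨t.natAbs, Int.natAbs_pos.2 (right_ne_zero_of_mul hD), fun l => ?_⟩
  rw [← Int.natAbs_mul]
  fin_cases l
  · show (det3 (u 1) (u 2) (u 3)).natAbs = _
    rw [ht, mul_comm]; rfl
  · show (det3 (u 0) (u 2) (u 3)).natAbs = _
    rw [w1, Int.natAbs_neg]; rfl
  · show (det3 (u 0) (u 1) (u 3)).natAbs = _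
    rw [w2]; rfl
  · show (det3 (u 0) (u 1) (u 2)).natAbs = _
    rw [w3, Int.natAbs_neg]; rfl

/-- Realized vectors, one for each vertex other than `l`, that have values in `{0, 1}` off the
diagonal are the values of three functionals. Their determinant is the quotient of the minor by the
volume, and if it is one, they form a box. -/
theorem InteriorPoint.minor_eq (H : InteriorPoint A p C) {τ : ℕ}
    (hτ : ∀ l : Fin 4, (det3 (spoke p (l.succAbove 0)) (spoke p (l.succAbove 1))
      (spoke p (l.succAbove 2))).natAbs = τ * (C l).natAbs) {R : Fin 4 → Fin 4 → ℤ} (l : Fin 4)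
    (hR : ∀ i, i ≠ l → Realized p (R i)) (hbit : ∀ i j, i ≠ l → j ≠ i → R i j = 0 ∨ R i j = 1) :
    τ * (C l).natAbs ∣ (minor R l).natAbs ∧
      (0 < τ → (minor R l).natAbs = τ * (C l).natAbs → UnimodularlyBoxed A) := by
  have hR' : ∀ i : Fin 3, Realized p (R (l.succAbove i)) := fun i => hR _ (Fin.succAbove_ne l i)
  choose h hh h4 hv using hR'
  choose n κ hn using hh
  have hval : ∀ (i : Fin 3) (j : Fin 4), n i ⬝ᵥ spoke p j = R (l.succAbove i) j := by
    intro i j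
    have h1 := hn i (p j.castSucc)
    have h2 := hn i (p 4)
    rw [hv] at h1
    rw [h4] at h2
    rw [spoke, dotProduct_sub]
    linarith
  have key : det3 (n 0) (n 1) (n 2) * det3 (spoke p (l.succAbove 0)) (spoke p (l.succAbove 1))
      (spoke p (l.succAbove 2)) = minor R l := by
    rw [det3_mul_det3]
    simp only [hval, minor]
    simp [det3]
  have key' := congrArg Int.natAbs key
  rw [Int.natAbs_mul, hτ] at key'
  refine ⟨⟨_, by rw [← key', mul_comm]⟩, fun hpos heq => ?_⟩
  rw [heq] at key'
  have hC : 0 < τ * (C l).natAbs := Nat.mul_pos hpos (Int.natAbs_pos.2 (H.pos l).ne')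
  have hu : IsUnit (det3 (n 0) (n 1) (n 2)) := by
    rw [Int.isUnit_iff_natAbs_eq]
    exact Nat.eq_of_mul_eq_mul_right hC (by rw [key', one_mul])
  refine H.unimodularlyBoxed_of_bits (a := fun i => (l.succAbove i).castSucc)
    (fun i j hij => Fin.succAbove_right_injective (Fin.castSucc_injective _ hij)) n κ ?_ hu
  intro i t ht
  rw [← hn]
  induction t using Fin.lastCases with
  | last => exact Or.inl (h4 i)
  | cast j =>
    rw [hv]
    exact hbit _ _ (Fin.succAbove_ne l i) fun e => ht (by rw [e])

theorem pairRow_bit (i l j : Fin 4) (hj : j ≠ i) : pairRow C i l j = 0 ∨ pairRow C i l j = 1 := by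
  simp only [pairRow, if_neg hj]
  split_ifs <;> simp

/-- If the tetrahedron that omits the vertex `3` is unimodular, then every vector orthogonal to the
dependence is realized. -/
theorem InteriorPoint.realized_of_one (H : InteriorPoint A p C)
    (hD : IsUnit (det3 (spoke p 0) (spoke p 1) (spoke p 2))) (h3 : C 3 = 1) {e : Fin 4 → ℤ}
    (he : C 0 * e 0 + C 1 * e 1 + C 2 * e 2 + e 3 = 0) : Realized p e := by
  have hnd := nodup_castSucc (i := 3) (j := 0) (k := 1) (l := 2) (by decide)
  obtain ⟨h, hh, h4, h0, h1, h2, heq⟩ := H.of_hasValues hnd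
    ((H.tetrahedron hnd (H.exists_pos 3)).1.hasValues_of_isUnit hD (e 0) (e 1) (e 2))
  simp only [snoc_castSucc] at heq
  rw [h3] at heq
  refine ⟨h, hh, h4, fun j => ?_⟩
  fin_cases j
  · exact h0
  · exact h1
  · exact h2
  · show h (p (Fin.castSucc 3)) = e 3
    linarith

theorem InteriorPoint.barycentric (H : InteriorPoint A p C) (h : Antitone C) :
    C ∈ [![(1 : ℤ), 1, 1, 1], ![2, 1, 1, 1], ![3, 2, 1, 1], ![5, 3, 2, 1],
      ![5, 4, 3, 1], ![7, 5, 3, 2], ![7, 5, 4, 3]] := by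
  have hdiv : ∀ i j k l, [i, j, k, l].Nodup →
      C i ∣ C j + C k ∨ C i ∣ C j + C l ∨ C i ∣ C k + C l := by
    intro i j k l hn
    obtain ⟨t, hti, hdvd, -⟩ := H.exists_realized i
    unfold pairSum at hdvd
    rw [sum_four hn] at hdvd
    rcases fin_four_cases hn t with rfl | rfl | rfl | rfl
    · exact absurd rfl hti
    · right; right; convert hdvd using 1; ring
    · right; left; convert hdvd using 1; ring
    · left; convert hdvd using 1; ring
  have key := barycentric_classification (H.pos 3) (h (by decide : (2 : Fin 4) ≤ 3))
    (h (by decide : (1 : Fin 4) ≤ 2)) (h (by decide : (0 : Fin 4) ≤ 1))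
    (H.isCoprime (by decide)) (H.isCoprime (by decide)) (H.isCoprime (by decide))
    (H.isCoprime (by decide)) (H.isCoprime (by decide)) (H.isCoprime (by decide))
    (hdiv 0 1 2 3 (by decide)) (hdiv 1 0 2 3 (by decide)) (hdiv 2 0 1 3 (by decide))
    (hdiv 3 0 1 2 (by decide))
  have hC : C = ![C 0, C 1, C 2, C 3] := by
    funext i
    fin_cases i <;> rfl
  rwa [← hC] at key

end InteriorPoint

/-! ### The box of five points -/

section InteriorPoint

variable {A : Set (Fin 3 → ℤ)} {p : Fin 5 → Fin 3 → ℤ} {C : Fin 4 → ℤ}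

theorem nodup_succAbove (i : Fin 4) : [i, i.succAbove 0, i.succAbove 1, i.succAbove 2].Nodup := by
  revert i; decide +kernel

/-- In volume two all patterns of White's theorem are realized. -/
theorem InteriorPoint.realized_of_two (H : InteriorPoint A p C) {i : Fin 4}
    (hD : (det3 (spoke p (i.succAbove 0)) (spoke p (i.succAbove 1))
      (spoke p (i.succAbove 2))).natAbs = 2) {l : Fin 4} (hl : l ≠ i) :
    Realized p (pairRow C i l) := by
  have hn := nodup_succAbove i
  obtain ⟨n1, n2⟩ := nodup_four hn
  have hT := (H.tetrahedron (nodup_castSucc hn) (H.exists_pos i)).1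
  obtain ⟨h0, h1, h2⟩ := hT.hasValues_of_dvd_two (Int.natAbs_dvd_natAbs.1 (dvd_of_eq hD))
  rcases fin_four_cases hn l with h | h | h | h
  · exact absurd h hl
  · rw [h]; exact (H.realized_of_hasValues hn h0).2
  · rw [h]; exact (H.realized_of_hasValues n1 h1.rotate).2
  · rw [h]; exact (H.realized_of_hasValues n2 h2.rotate').2

/-- In volume three all patterns of White's theorem but one are realized. -/
theorem InteriorPoint.realized_of_three (H : InteriorPoint A p C) {i : Fin 4}
    (hD : (det3 (spoke p (i.succAbove 0)) (spoke p (i.succAbove 1))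
      (spoke p (i.succAbove 2))).natAbs = 3) :
    ∃ x, x ≠ i ∧ ∀ l, l ≠ i → l ≠ x → Realized p (pairRow C i l) := by
  have hn := nodup_succAbove i
  obtain ⟨n1, n2⟩ := nodup_four hn
  have hT := (H.tetrahedron (nodup_castSucc hn) (H.exists_pos i)).1
  obtain ⟨h01, h02, h12⟩ := hT.hasValues_of_dvd_three (Int.natAbs_dvd_natAbs.1 (dvd_of_eq hD))
  have k0 := fun h => (H.realized_of_hasValues hn h).2
  have k1 := fun h => (H.realized_of_hasValues n1 (HasValues.rotate h)).2
  have k2 := fun h => (H.realized_of_hasValues n2 (HasValues.rotate' h)).2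
  have hne := fun j => Fin.succAbove_ne i j
  by_cases h0 : Realized p (pairRow C i (i.succAbove 0))
  · by_cases h1 : Realized p (pairRow C i (i.succAbove 1))
    · refine ⟨_, hne 2, fun l hl hx => ?_⟩
      rcases fin_four_cases hn l with rfl | rfl | rfl | rfl
      · exact absurd rfl hl
      · exact h0
      · exact h1
      · exact absurd rfl hx
    · refine ⟨_, hne 1, fun l hl hx => ?_⟩
      rcases fin_four_cases hn l with rfl | rfl | rfl | rfl
      · exact absurd rfl hl
      · exact h0
      · exact absurd rfl hx
      · exact k2 (h12.resolve_left fun h => h1 (k1 h))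
  · refine ⟨_, hne 0, fun l hl hx => ?_⟩
    rcases fin_four_cases hn l with rfl | rfl | rfl | rfl
    · exact absurd rfl hl
    · exact absurd rfl hx
    · exact k1 (h01.resolve_left fun h => h0 (k0 h))
    · exact k2 (h02.resolve_left fun h => h0 (k0 h))

/-- If the volumes are equal to the barycentric coordinates, every vector orthogonal to the
dependence is realized, and a box can be given explicitly. -/
theorem InteriorPoint.unimodularlyBoxed_of_one (H : InteriorPoint A p C)
    (hC : C ∈ [![(1 : ℤ), 1, 1, 1], ![2, 1, 1, 1], ![3, 2, 1, 1]])
    (hτ : ∀ l : Fin 4, (det3 (spoke p (l.succAbove 0)) (spoke p (l.succAbove 1))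
      (spoke p (l.succAbove 2))).natAbs = 1 * (C l).natAbs) : UnimodularlyBoxed A := by
  have hC3 : C 3 = 1 := by
    simp only [List.mem_cons, List.not_mem_nil, or_false] at hC
    rcases hC with rfl | rfl | rfl <;> rfl
  have hD : IsUnit (det3 (spoke p 0) (spoke p 1) (spoke p 2)) := by
    rw [Int.isUnit_iff_natAbs_eq]
    have := hτ 3
    rw [hC3] at this
    exact this
  have key : ∀ R : Fin 4 → Fin 4 → ℤ, (∀ i, C 0 * R i 0 + C 1 * R i 1 + C 2 * R i 2 + R i 3 = 0) →
      (∀ i j, j ≠ i → R i j = 0 ∨ R i j = 1) → (minor R 3).natAbs = 1 → UnimodularlyBoxed A := by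
    intro R h0 hbit h1
    refine (H.minor_eq hτ 3 (fun i _ => H.realized_of_one hD hC3 (h0 i))
      fun i j _ => hbit i j).2 one_pos ?_
    rw [h1, hC3]; rfl
  simp only [List.mem_cons, List.not_mem_nil, or_false] at hC
  rcases hC with rfl | rfl | rfl
  · exact key ![![-1, 0, 0, 1], ![0, -1, 0, 1], ![0, 0, -1, 1], 0] (by decide) (by decide)
      (by decide)
  · exact key ![![-1, 1, 1, 0], ![0, -1, 0, 1], ![0, 0, -1, 1], 0] (by decide) (by decide)
      (by decide)
  · exact key ![![-1, 1, 1, 0], ![0, -1, 1, 1], ![0, 0, -1, 1], 0] (by decide) (by decide)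
      (by decide)

/-- A choice of patterns for which the minor that omits the last vertex is the volume `τ` or is not
divisible by it; the latter is impossible. -/
theorem InteriorPoint.unimodularlyBoxed_of_choice (H : InteriorPoint A p C) {τ : ℕ} (hpos : 0 < τ)
    (hτ : ∀ l : Fin 4, (det3 (spoke p (l.succAbove 0)) (spoke p (l.succAbove 1))
      (spoke p (l.succAbove 2))).natAbs = τ * (C l).natAbs) (hC3 : C 3 = 1) {L : Fin 4 → Fin 4}
    (hL : ∀ i, i ≠ 3 → Realized p (pairRow C i (L i)))
    (h : (minor (fun i => pairRow C i (L i)) 3).natAbs = τ ∨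
      (minor (fun i => pairRow C i (L i)) 3).natAbs % τ ≠ 0) : UnimodularlyBoxed A := by
  obtain ⟨h1, h2⟩ := H.minor_eq hτ (R := fun i => pairRow C i (L i)) 3 hL
    (fun i j _ hj => pairRow_bit i _ j hj)
  rw [hC3, Int.natAbs_one, mul_one] at h1 h2
  rcases h with h | h
  · exact h2 hpos h
  · exact absurd (Nat.mod_eq_zero_of_dvd h1) h

theorem InteriorPoint.unimodularlyBoxed (H : InteriorPoint A p C) (hanti : Antitone C) :
    UnimodularlyBoxed A := by
  have hC := H.barycentric hanti
  obtain ⟨τ, hpos, hτ⟩ := H.exists_volume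
  choose L hLne hLdvd hL using H.exists_realized
  have hLv : ![L 0, L 1, L 2, L 3] = L := by
    funext i
    fin_cases i <;> rfl
  have hmod := fun i => Int.emod_eq_zero_of_dvd (hLdvd i)
  have hminor := fun l => H.minor_eq hτ (R := fun i => pairRow C i (L i)) l (fun i _ => hL i)
    (fun i j _ hj => pairRow_bit i _ j hj)
  have hCpos := fun l => Int.natAbs_pos.2 (H.pos l).ne'
  -- by divisibility, such a minor forces `τ = 1` and is the volume
  have hone : (∃ l, (minor (fun i => pairRow C i (L i)) l).natAbs = (C l).natAbs) →
      UnimodularlyBoxed A := by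
    rintro ⟨l, hl⟩
    have h1 := (hminor l).1
    rw [hl] at h1
    have h2 := Nat.le_of_dvd (hCpos l) h1
    have h3 : τ = 1 := by
      have := hCpos l
      nlinarith
    exact (hminor l).2 hpos (by rw [hl, h3, one_mul])
  have htable := pairRow_table C hC (L 0) (L 1) (L 2) (L 3) (hLne 0) (hLne 1) (hLne 2) (hLne 3)
    (hmod 0) (hmod 1) (hmod 2) (hmod 3)
  rw [hLv] at htable
  rcases htable with h | ⟨hC', hbig⟩
  · exact hone h
  replace hC' : C ∈ [![(1 : ℤ), 1, 1, 1], ![2, 1, 1, 1], ![3, 2, 1, 1]] := by simpa using hC'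
  have hC3 : C 3 = 1 := by
    simp only [List.mem_cons, List.not_mem_nil, or_false] at hC'
    rcases hC' with rfl | rfl | rfl <;> rfl
  have hbound := pairRow_table_bound C hC' (L 0) (L 1) (L 2) (L 3) (hLne 0) (hLne 1) (hLne 2)
    (hLne 3) (hmod 0) (hmod 1) (hmod 2) (hmod 3)
  rw [hLv] at hbound
  rcases hbound with h | ⟨l, h0, hle⟩
  · exact hone h
  have hτ6 : τ ≤ 6 := by
    have h1 := Nat.le_of_dvd (Int.natAbs_pos.2 h0) (hminor l).1
    exact Nat.le_of_mul_le_mul_right (h1.trans hle) (hCpos l)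
  by_cases h4 : 4 ≤ τ
  · obtain ⟨l, hl⟩ := hbig τ (by simp; omega) fun l => Nat.mod_eq_zero_of_dvd (hminor l).1
    exact (hminor l).2 hpos hl
  have hspoke : ∀ i, C i = 1 → (det3 (spoke p (i.succAbove 0)) (spoke p (i.succAbove 1))
      (spoke p (i.succAbove 2))).natAbs = τ := by
    intro i hi
    rw [hτ, hi, Int.natAbs_one, mul_one]
  obtain rfl | rfl | rfl : τ = 1 ∨ τ = 2 ∨ τ = 3 := by omega
  · exact H.unimodularlyBoxed_of_one hC' hτ
  · obtain ⟨a', b', c', ha, hb, hc, h⟩ := pairRow_table_two C hC' (if C 0 = 1 then 0 else L 0)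
      (if C 1 = 1 then 1 else L 1) (if C 2 = 1 then 2 else L 2)
      (by split_ifs; exacts [rfl, ⟨hLne 0, hmod 0⟩]) (by split_ifs; exacts [rfl, ⟨hLne 1, hmod 1⟩])
      (by split_ifs; exacts [rfl, ⟨hLne 2, hmod 2⟩])
    refine H.unimodularlyBoxed_of_choice hpos hτ hC3 (L := ![a', b', c', 0]) ?_ h
    have hreal : ∀ i x, (if C i = 1 then x ≠ i else x = if C i = 1 then i else L i) →
        Realized p (pairRow C i x) := by
      intro i x hx
      split_ifs at hx with hi
      · exact H.realized_of_two (hspoke i hi) hx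
      · rw [hx]; exact hL i
    intro i hi
    fin_cases i
    · exact hreal 0 a' ha
    · exact hreal 1 b' hb
    · exact hreal 2 c' hc
    · exact absurd rfl hi
  · have hex : ∀ i, ∃ x, x ≠ i ∧ (C i = 1 ∨ pairSum C i x % C i = 0) ∧
        ∀ l, (if C i = 1 then l ≠ i ∧ l ≠ x else l = x) → Realized p (pairRow C i l) := by
      intro i
      by_cases hi : C i = 1
      · obtain ⟨x, hx, h⟩ := H.realized_of_three (hspoke i hi)
        exact ⟨x, hx, Or.inl hi, fun l hl => by rw [if_pos hi] at hl; exact h l hl.1 hl.2⟩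
      · exact ⟨L i, hLne i, Or.inr (hmod i), fun l hl => by rw [if_neg hi] at hl; rw [hl]; exact hL i⟩
    choose y hy hy' hyR using hex
    obtain ⟨a', b', c', ha, hb, hc, h⟩ := pairRow_table_three C hC' (y 0) (y 1) (y 2) (hy 0) (hy 1)
      (hy 2) (hy' 0) (hy' 1) (hy' 2)
    refine H.unimodularlyBoxed_of_choice hpos hτ hC3 (L := ![a', b', c', 0]) ?_ h
    intro i hi
    fin_cases i
    · exact hyR 0 a' ha
    · exact hyR 1 b' hb
    · exact hyR 2 c' hc
    · exact absurd rfl hi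

end InteriorPoint

/-- The numbers of positive and of negative coefficients of the dependence are `(1, 1)`, `(2, 1)`,
`(2, 2)`, `(3, 1)`, `(3, 2)` or `(4, 1)`, and only a pyramid or an interior point is possible. The
hypothesis on the signs can always be achieved by negating the dependence. -/
theorem FivePoints.unimodularlyBoxed_of_antitone {A : Set (Fin 3 → ℤ)} {p : Fin 5 → Fin 3 → ℤ}
    {c : Fin 5 → ℤ} (H : FivePoints A p c) (hc : Antitone c)
    (h2 : 0 < c 2 ∨ (c 2 = 0 ∧ (c 3 = 0 ∨ (0 < c 1 ∧ -c 4 ≤ c 0)))) : UnimodularlyBoxed A := by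
  have h10 : c 1 ≤ c 0 := hc (by decide)
  have h21 : c 2 ≤ c 1 := hc (by decide)
  have h32 : c 3 ≤ c 2 := hc (by decide)
  have h43 : c 4 ≤ c 3 := hc (by decide)
  have hsum := H.sum
  rw [Fin.sum_univ_five] at hsum
  rcases h2 with h2 | ⟨h2, hmax⟩
  · rcases lt_trichotomy (c 3) 0 with h3 | h3 | h3
    · exact (H.not_three_two (by linarith) (by linarith) h2 h3 h43).elim
    · have c0 : IsUnit (c 0) := H.isUnit_of_dvd (i := 0) (j := 4) (k := 1) (l := 2) (m := 3)
        (by decide) ⟨1, by decide, mul_pos (by linarith) (by linarith)⟩ dvd_rfl (by simp [h3])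
      have c1 : IsUnit (c 1) := H.isUnit_of_dvd (i := 1) (j := 4) (k := 0) (l := 2) (m := 3)
        (by decide) ⟨0, by decide, mul_pos (by linarith) (by linarith)⟩ dvd_rfl (by simp [h3])
      have c2 : IsUnit (c 2) := H.isUnit_of_dvd (i := 2) (j := 4) (k := 0) (l := 1) (m := 3)
        (by decide) ⟨0, by decide, mul_pos (by linarith) (by linarith)⟩ dvd_rfl (by simp [h3])
      rw [Int.isUnit_iff] at c0 c1 c2
      have P : Pyramid A p c := by
        refine ⟨H, fun i hi hi' => ?_, h3⟩
        fin_cases i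
        · exact c0.resolve_right (by linarith)
        · exact c1.resolve_right (by linarith)
        · exact c2.resolve_right (by linarith)
        · exact absurd rfl hi
        · exact absurd rfl hi'
      exact P.unimodularlyBoxed
    · have hcC : Fin.snoc (fun i : Fin 4 => c i.castSucc) (-∑ i : Fin 4, c i.castSucc) = c := by
        funext t
        induction t using Fin.lastCases with
        | last =>
          rw [Fin.snoc_last]
          have := H.sum
          rw [Fin.sum_univ_castSucc] at this
          linarith
        | cast i => simp
      have P : InteriorPoint A p fun i => c i.castSucc := by
        refine ⟨by rw [hcC]; exact H, fun i => ?_⟩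
        fin_cases i
        · exact lt_of_lt_of_le h2 (h21.trans h10)
        · exact lt_of_lt_of_le h2 h21
        · exact h2
        · exact h3
      exact P.unimodularlyBoxed fun i j hij => hc (Fin.castSucc_le_castSucc_iff.2 hij)
  · have h0 : 0 < c 0 := by
      by_contra hneg
      have h : ∀ i, (0 : ℤ) ∣ c i := by
        intro i
        rw [zero_dvd_iff]
        fin_cases i
        · show c 0 = 0; linarith
        · show c 1 = 0; linarith
        · show c 2 = 0; linarith
        · show c 3 = 0; linarith
        · show c 4 = 0; linarith
      exact not_isUnit_zero (H.prim 0 h)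
    rcases hmax with h3 | ⟨h1, hmax⟩
    · rcases (show c 1 = 0 ∨ 0 < c 1 by omega) with h1 | h1
      · exact (H.not_one_one h1 h2 h3 h0).elim
      · exact (H.not_two_one h0 h1 h2 h3).elim
    · rcases (show c 3 = 0 ∨ c 3 < 0 by omega) with h3 | h3
      · exact (H.not_two_one h0 h1 h2 h3).elim
      · exact (H.not_two_two h1 h10 h2 h3 h43 hmax).elim

theorem FivePoints.unimodularlyBoxed {A : Set (Fin 3 → ℤ)} {p : Fin 5 → Fin 3 → ℤ}
    {c : Fin 5 → ℤ} (H : FivePoints A p c) : UnimodularlyBoxed A := by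
  have hmain : ∀ c : Fin 5 → ℤ, FivePoints A p c →
      (∀ σ : Equiv.Perm (Fin 5), Antitone (c ∘ σ) →
        (0 < c (σ 2) ∨ (c (σ 2) = 0 ∧ (c (σ 3) = 0 ∨ (0 < c (σ 1) ∧ -c (σ 4) ≤ c (σ 0))))) →
          UnimodularlyBoxed A) :=
    fun c H σ hσ h => (H.perm σ).unimodularlyBoxed_of_antitone hσ h
  have hmono := Tuple.monotone_sort fun i => -c i
  set σ := Tuple.sort fun i => -c i
  have hanti : Antitone (c ∘ σ) := fun i j hij => neg_le_neg_iff.1 (hmono hij)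
  by_cases h : 0 < c (σ 2) ∨ (c (σ 2) = 0 ∧ (c (σ 3) = 0 ∨ (0 < c (σ 1) ∧ -c (σ 4) ≤ c (σ 0))))
  · exact hmain c H σ hanti h
  · refine hmain _ H.neg (Fin.revPerm.trans σ) ?_ ?_
    · intro i j hij
      exact neg_le_neg_iff.2 (hanti (Fin.rev_le_rev.2 hij))
    · have e0 : (Fin.revPerm.trans σ) 0 = σ 4 := rfl
      have e2 : (Fin.revPerm.trans σ) 2 = σ 2 := rfl
      have e4 : (Fin.revPerm.trans σ) 4 = σ 0 := rfl
      have e1 : (Fin.revPerm.trans σ) 1 = σ 3 := rfl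
      have e3 : (Fin.revPerm.trans σ) 3 = σ 1 := rfl
      have h21 : c (σ 2) ≤ c (σ 1) := hanti (by decide)
      have h32 : c (σ 3) ≤ c (σ 2) := hanti (by decide)
      rw [e0, e1, e2, e3, e4]
      omega

/-! ### Boxed sets of lattice points -/

/-- Five lattice points in `ℤ³` have a primitive affine dependence. -/
theorem exists_fivePoints {A : Set (Fin 3 → ℤ)} (hW : Wide A) (hA : LatticeConvex A)
    {p : Fin 5 → Fin 3 → ℤ} (hinj : Function.Injective p) (hr : Set.range p = A) :
    ∃ c, FivePoints A p c := by
  -- five equations, one of them trivial, express affine dependence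
  let M : Matrix (Fin 5) (Fin 5) ℤ :=
    Matrix.of ![fun i => p i 0, fun i => p i 1, fun i => p i 2, 1, 0]
  have hM : M.det = 0 := Matrix.det_eq_zero_of_row_eq_zero 4 fun j => rfl
  obtain ⟨c, hc, h0⟩ := Matrix.exists_mulVec_eq_zero_iff.2 hM
  obtain ⟨g, hg, hgcd⟩ := Finset.extract_gcd c (Finset.univ_nonempty (α := Fin 5))
  set d := Finset.univ.gcd c
  have hg' : ∀ i, c i = d * g i := fun i => hg i (Finset.mem_univ i)
  have hd : d ≠ 0 := by
    intro h
    apply hc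
    funext i
    rw [hg', h, zero_mul]; rfl
  have hsum : ∀ r : Fin 5, ∑ i, M r i * g i = 0 := by
    intro r
    have h1 := congrFun h0 r
    simp only [Matrix.mulVec, dotProduct, hg', Pi.zero_apply] at h1
    refine (mul_eq_zero.1 (?_ : d * _ = 0)).resolve_left hd
    rw [Finset.mul_sum, ← h1]
    exact Finset.sum_congr rfl fun i _ => by ring
  refine ⟨g, hW, hA, hr, hinj, ?_, fun t => ?_, fun x hx => ?_⟩
  · simpa [M] using hsum 3
  · have : ∑ i, p i t * g i = 0 := by
      fin_cases t
      · exact hsum 0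
      · exact hsum 1
      · exact hsum 2
    rw [← this]
    exact Finset.sum_congr rfl fun i _ => mul_comm _ _
  · rw [isUnit_iff_dvd_one, ← hgcd]
    exact Finset.dvd_gcd fun i _ => hx i

/-- The statement in terms of integer data. Besides the exceptional points, `A` contains only
vertices of the parallelepiped; if there are at least three of them, they are used for an exchange,
and otherwise `A` has at most five points. -/
theorem BoxedBy.unimodularlyBoxed {A : Set (Fin 3 → ℤ)} {F k v} (hb : BoxedBy A F k v)
    (hW : Wide A) (hA : LatticeConvex A) (hprim : ∀ i, ∃ c, F i ⬝ᵥ c = 1)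
    (hD : det3 (F 0) (F 1) (F 2) ≠ 0) : UnimodularlyBoxed A := by
  by_cases hu : IsUnit (det3 (F 0) (F 1) (F 2))
  · exact ⟨F, k, v, hb, hu⟩
  have hP : ProperBox A F k v := by
    refine ⟨hb, hW, hA, hprim, ?_⟩
    rw [Int.isUnit_iff_abs_eq] at hu
    have := Int.one_le_abs hD
    omega
  have hv : ∀ x ∈ A, (∃ t, x = v t) ∨ ∀ t, x ≠ v t := by
    intro x _
    by_cases h : ∃ t, x = v t
    · exact Or.inl h
    · exact Or.inr (not_exists.1 h)
  have hfin : ∀ x t, x = v t → x = v 0 ∨ x = v 1 ∨ x = v 2 := by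
    intro x t h
    fin_cases t
    · exact Or.inl h
    · exact Or.inr (Or.inl h)
    · exact Or.inr (Or.inr h)
  by_cases h1 : ∃ s ∈ A, ∀ t, s ≠ v t
  swap
  · exfalso
    refine not_wide_of_subset_four hW hA (hb.mem 0) (hb.mem 1) (hb.mem 2) (hb.mem 2) fun x hx => ?_
    rcases hv x hx with ⟨t, h⟩ | h
    · rcases hfin x t h with h | h | h <;> simp [h]
    · exact absurd ⟨x, hx, h⟩ h1
  obtain ⟨s, hs, hsv⟩ := h1
  by_cases h2 : ∃ r ∈ A, r ≠ s ∧ ∀ t, r ≠ v t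
  swap
  · exfalso
    refine not_wide_of_subset_four hW hA (hb.mem 0) (hb.mem 1) (hb.mem 2) hs fun x hx => ?_
    rcases hv x hx with ⟨t, h⟩ | h
    · rcases hfin x t h with h | h | h <;> simp [h]
    · by_cases hxs : x = s
      · simp [hxs]
      · exact absurd ⟨x, hx, hxs, h⟩ h2
  obtain ⟨r, hr, hrs, hrv⟩ := h2
  by_cases h3 : ∃ q ∈ A, q ≠ s ∧ q ≠ r ∧ ∀ t, q ≠ v t
  · obtain ⟨q, hq, hqs, hqr, hqv⟩ := h3
    refine hP.unimodularlyBoxed_of_three (p := ![s, r, q]) ?_ ?_ ?_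
    · intro i; fin_cases i <;> assumption
    · intro i j
      fin_cases i <;> fin_cases j <;> simp [hrs, hqs, hqr, hrs.symm, hqs.symm, hqr.symm]
    · intro i; fin_cases i <;> assumption
  · obtain ⟨c, H⟩ := exists_fivePoints hW hA (p := ![v 0, v 1, v 2, s, r]) (by
      have h01 : v 0 ≠ v 1 := hb.inj.ne (by decide)
      have h02 : v 0 ≠ v 2 := hb.inj.ne (by decide)
      have h12 : v 1 ≠ v 2 := hb.inj.ne (by decide)
      intro i j
      fin_cases i <;> fin_cases j <;>
        simp [hrs, hrs.symm, hsv, hrv, h01, h02, h12, h01.symm, h02.symm, h12.symm,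
          (hsv _).symm, (hrv _).symm]) (by
      ext x
      constructor
      · rintro ⟨i, rfl⟩
        fin_cases i
        · exact hb.mem 0
        · exact hb.mem 1
        · exact hb.mem 2
        · exact hs
        · exact hr
      · intro hx
        rcases hv x hx with ⟨t, h⟩ | h
        · rcases hfin x t h with h | h | h
          · exact ⟨0, h.symm⟩
          · exact ⟨1, h.symm⟩
          · exact ⟨2, h.symm⟩
        · by_cases hxs : x = s
          · exact ⟨3, hxs.symm⟩
          · by_cases hxr : x = r
            · exact ⟨4, hxr.symm⟩
            · exact absurd ⟨x, hx, hxs, hxr, h⟩ h3)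
    exact H.unimodularlyBoxed

/-! ### From real functionals to integer data -/

/-- The inclusion of `ℤ³` into `ℝ³`. -/
def intVec (z : Fin 3 → ℤ) : Fin 3 → ℝ := fun i => z i

theorem mem_integerLattice {x : Fin 3 → ℝ} : x ∈ integerLattice 3 ↔ ∃ z, intVec z = x := by
  constructor
  · intro h
    choose z hz using h
    exact ⟨z, funext fun i => (hz i).symm⟩
  · rintro ⟨z, rfl⟩ i
    exact ⟨z i, rfl⟩

theorem intVec_injective : Function.Injective intVec := fun _ _ h =>
  funext fun i => Int.cast_injective (congrFun h i)

/-- The affine functional on `ℝ³` with integer coefficients `n` and constant term `κ`. -/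
noncomputable def intFunctional (n : Fin 3 → ℤ) (κ : ℤ) : (Fin 3 → ℝ) →ᵃ[ℝ] ℝ :=
  (∑ i, (n i : ℝ) • LinearMap.proj (R := ℝ) (φ := fun _ : Fin 3 => ℝ) i).toAffineMap +
    AffineMap.const ℝ _ (κ : ℝ)

theorem intFunctional_apply (n : Fin 3 → ℤ) (κ : ℤ) (x : Fin 3 → ℝ) :
    intFunctional n κ x = n 0 * x 0 + n 1 * x 1 + n 2 * x 2 + κ := by
  simp [intFunctional, Fin.sum_univ_three]

theorem intFunctional_linear_apply (n : Fin 3 → ℤ) (κ : ℤ) (x : Fin 3 → ℝ) :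
    (intFunctional n κ).linear x = n 0 * x 0 + n 1 * x 1 + n 2 * x 2 := by
  simp [intFunctional, Fin.sum_univ_three]

theorem intFunctional_intVec (n : Fin 3 → ℤ) (κ : ℤ) (z : Fin 3 → ℤ) :
    intFunctional n κ (intVec z) = ((n ⬝ᵥ z + κ : ℤ) : ℝ) := by
  rw [intFunctional_apply, dot3]
  simp [intVec]

theorem isIntegerFunctional_intFunctional (n : Fin 3 → ℤ) (κ : ℤ) :
    IsIntegerFunctional (intFunctional n κ) := by
  rintro _ ⟨x, hx, rfl⟩
  obtain ⟨z, rfl⟩ := mem_integerLattice.1 hx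
  exact ⟨_, (intFunctional_intVec n κ z).symm⟩

theorem isPrimitiveFunctional_intFunctional {n : Fin 3 → ℤ} (κ : ℤ) (h : ∃ c, n ⬝ᵥ c = 1) :
    IsPrimitiveFunctional (intFunctional n κ) := by
  refine Set.Subset.antisymm (isIntegerFunctional_intFunctional n κ) ?_
  rintro _ ⟨m, rfl⟩
  obtain ⟨c, hc⟩ := h
  refine ⟨intVec ((m - κ) • c), mem_integerLattice.2 ⟨_, rfl⟩, ?_⟩
  rw [intFunctional_intVec, dotProduct_smul, hc]
  simp

/-- A primitive functional has integer coefficients, and its linear part takes the value one. -/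
theorem exists_eq_intFunctional {f : (Fin 3 → ℝ) →ᵃ[ℝ] ℝ} (hf : IsPrimitiveFunctional f) :
    ∃ n κ, f = intFunctional n κ ∧ ∃ c, n ⬝ᵥ c = 1 := by
  have hint : ∀ z, ∃ m : ℤ, (m : ℝ) = f (intVec z) := by
    intro z
    have : f (intVec z) ∈ f '' integerLattice 3 := ⟨_, mem_integerLattice.2 ⟨z, rfl⟩, rfl⟩
    rw [hf] at this
    exact this
  obtain ⟨κ, hκ⟩ := hint 0
  choose m hm using fun i : Fin 3 => hint (Pi.single i 1)
  have h0 : intVec 0 = 0 := by funext i; simp [intVec]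
  have h1 : ∀ i, intVec (Pi.single i 1) = Pi.single i 1 := by
    intro i
    funext j
    by_cases h : j = i
    · subst h; simp [intVec]
    · simp [intVec, h]
  have hfx : ∀ x, f x = f.linear x + f 0 := fun x => congrFun f.decomp x
  have heq : f = intFunctional (fun i => m i - κ) κ := by
    refine AffineMap.ext fun x => ?_
    rw [intFunctional_apply, hfx]
    have hx : f.linear x = ∑ i, x i * f.linear (Pi.single i 1) := by
      conv_lhs => rw [pi_eq_sum_univ' x]
      simp [map_sum, map_smul]
    have hl : ∀ i, f.linear (Pi.single i 1) = m i - κ := by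
      intro i
      have := hfx (Pi.single i 1)
      rw [← h1, ← hm, h1, ← h0, ← hκ] at this
      linarith
    rw [hx, ← h0, ← hκ, Fin.sum_univ_three, hl, hl, hl]
    push_cast
    ring
  refine ⟨_, κ, heq, ?_⟩
  have : ((κ + 1 : ℤ) : ℝ) ∈ f '' integerLattice 3 := by rw [hf]; exact ⟨_, rfl⟩
  obtain ⟨x, hx, hfx1⟩ := this
  obtain ⟨z, rfl⟩ := mem_integerLattice.1 hx
  rw [heq, intFunctional_intVec] at hfx1
  exact ⟨z, by have := Int.cast_injective hfx1; linarith⟩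

theorem det3_transpose (a b c : Fin 3 → ℤ) :
    det3 ![a 0, b 0, c 0] ![a 1, b 1, c 1] ![a 2, b 2, c 2] = det3 a b c := by
  simp [det3]; ring

theorem linearIndependent_intFunctional_iff (F : Fin 3 → Fin 3 → ℤ) (k : Fin 3 → ℤ) :
    LinearIndependent ℝ (fun i => (intFunctional (F i) (k i)).linear) ↔
      det3 (F 0) (F 1) (F 2) ≠ 0 := by
  rw [Fintype.linearIndependent_iff]
  constructor
  · intro h h0
    rw [← det3_transpose] at h0
    obtain ⟨n, hn, h1, h2, h3⟩ := exists_ne_zero_of_det3_eq_zero _ _ _ h0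
    rw [dot3] at h1 h2 h3
    change n 0 * F 0 0 + n 1 * F 1 0 + n 2 * F 2 0 = 0 at h1
    change n 0 * F 0 1 + n 1 * F 1 1 + n 2 * F 2 1 = 0 at h2
    change n 0 * F 0 2 + n 1 * F 1 2 + n 2 * F 2 2 = 0 at h3
    apply hn
    funext i
    have := h (fun i => n i) (by
      ext j
      have e1 : (n 0 * F 0 0 + n 1 * F 1 0 + n 2 * F 2 0 : ℝ) = 0 := by exact_mod_cast h1
      have e2 : (n 0 * F 0 1 + n 1 * F 1 1 + n 2 * F 2 1 : ℝ) = 0 := by exact_mod_cast h2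
      have e3 : (n 0 * F 0 2 + n 1 * F 1 2 + n 2 * F 2 2 : ℝ) = 0 := by exact_mod_cast h3
      fin_cases j <;> simp [Fin.sum_univ_three, intFunctional_linear_apply, e1, e2, e3]) i
    exact_mod_cast this
  · intro hD g hg
    have key : ∀ t : Fin 3, g 0 * F 0 t + g 1 * F 1 t + g 2 * F 2 t = 0 := by
      intro t
      have := LinearMap.congr_fun hg (Pi.single t 1)
      fin_cases t <;> simpa [Fin.sum_univ_three, intFunctional_linear_apply] using this
    have hD' : (det3 (F 0) (F 1) (F 2) : ℝ) ≠ 0 := by exact_mod_cast hD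
    have e0 := key 0
    have e1 := key 1
    have e2 := key 2
    intro i
    refine (mul_eq_zero.1 ?_).resolve_right hD'
    unfold det3
    push_cast
    fin_cases i
    · show g 0 * _ = 0
      linear_combination (F 1 1 * F 2 2 - F 1 2 * F 2 1 : ℝ) * e0 -
        (F 1 0 * F 2 2 - F 1 2 * F 2 0 : ℝ) * e1 + (F 1 0 * F 2 1 - F 1 1 * F 2 0 : ℝ) * e2
    · show g 1 * _ = 0
      linear_combination (F 2 1 * F 0 2 - F 2 2 * F 0 1 : ℝ) * e0 -
        (F 2 0 * F 0 2 - F 2 2 * F 0 0 : ℝ) * e1 + (F 2 0 * F 0 1 - F 2 1 * F 0 0 : ℝ) * e2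
    · show g 2 * _ = 0
      linear_combination (F 0 1 * F 1 2 - F 0 2 * F 1 1 : ℝ) * e0 -
        (F 0 0 * F 1 2 - F 0 2 * F 1 0 : ℝ) * e1 + (F 0 0 * F 1 1 - F 0 1 * F 1 0 : ℝ) * e2

/-- The lattice points of `P`. -/
def latticePoints (P : Set (Fin 3 → ℝ)) : Set (Fin 3 → ℤ) := {z | intVec z ∈ P}

theorem latticeConvex_latticePoints {P : Set (Fin 3 → ℝ)} (hP : Convex ℝ P) :
    LatticeConvex (latticePoints P) := by
  intro o ho a ha b hb c hc w α β γ hw hα hβ hγ hpos z hz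
  have hS : (0 : ℝ) < w + α + β + γ := by exact_mod_cast hpos
  have h := hP.sum_mem (t := Finset.univ)
    (w := ![(w : ℝ) / (w + α + β + γ), α / (w + α + β + γ), β / (w + α + β + γ),
      γ / (w + α + β + γ)]) (z := ![intVec o, intVec a, intVec b, intVec c]) (by
      intro i _
      have : (0 : ℝ) ≤ w ∧ (0 : ℝ) ≤ α ∧ (0 : ℝ) ≤ β ∧ (0 : ℝ) ≤ γ := by
        refine ⟨?_, ?_, ?_, ?_⟩ <;> assumption_mod_cast
      fin_cases i
      · exact div_nonneg this.1 hS.le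
      · exact div_nonneg this.2.1 hS.le
      · exact div_nonneg this.2.2.1 hS.le
      · exact div_nonneg this.2.2.2 hS.le) (by
      simp [Fin.sum_univ_four]
      field_simp) (by
      intro i _
      fin_cases i
      · exact ho
      · exact ha
      · exact hb
      · exact hc)
  show intVec z ∈ P
  convert h using 1
  funext i
  have hi : ((w + α + β + γ) * z i : ℝ) = w * o i + α * a i + β * b i + γ * c i := by
    exact_mod_cast hz i
  simp [Fin.sum_univ_four, intVec]
  field_simp
  linarith

theorem widthAlong_nonneg {K : Set (Fin 3 → ℝ)} (hK : IsCompact K) (f : (Fin 3 → ℝ) →ᵃ[ℝ] ℝ) :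
    0 ≤ widthAlong f K := by
  have h := hK.image (f.continuous_of_finiteDimensional)
  exact sub_nonneg.2 (Real.sInf_le_sSup _ h.bddBelow h.bddAbove)

theorem widthAlong_le {K : Set (Fin 3 → ℝ)} {f : (Fin 3 → ℝ) →ᵃ[ℝ] ℝ} {r : ℝ} (hr : 0 ≤ r)
    (h : ∀ x ∈ K, ∀ y ∈ K, f x ≤ f y + r) : widthAlong f K ≤ r := by
  unfold widthAlong
  rcases K.eq_empty_or_nonempty with rfl | hK
  · simpa using hr
  · have h1 : ∀ y ∈ K, sSup (f '' K) ≤ f y + r := by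
      intro y hy
      refine csSup_le (hK.image f) ?_
      rintro _ ⟨x, hx, rfl⟩
      exact h x hx y hy
    have h2 : sSup (f '' K) - r ≤ sInf (f '' K) := by
      refine le_csInf (hK.image f) ?_
      rintro _ ⟨y, hy, rfl⟩
      linarith [h1 y hy]
    linarith

/-- Width larger than one is width at least two, since integer functionals have integer values at
lattice points. -/
theorem wide_latticePoints {P : Set (Fin 3 → ℝ)} (hfin : (P ∩ integerLattice 3).Finite)
    (hw : 1 < latticeWidth (convexHull ℝ (P ∩ integerLattice 3))) : Wide (latticePoints P) := by
  intro n hn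
  by_contra! hcon
  have hlin : (intFunctional n 0).linear ≠ 0 := by
    intro h0
    apply hn
    funext i
    have := LinearMap.congr_fun h0 (Pi.single i 1)
    rw [intFunctional_linear_apply] at this
    fin_cases i <;> simpa using this
  have hlat : ∀ x ∈ P ∩ integerLattice 3, ∀ y ∈ P ∩ integerLattice 3,
      intFunctional n 0 x ≤ intFunctional n 0 y + 1 := by
    rintro x ⟨hx, hx'⟩ y ⟨hy, hy'⟩
    obtain ⟨x, rfl⟩ := mem_integerLattice.1 hx'
    obtain ⟨y, rfl⟩ := mem_integerLattice.1 hy'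
    rw [intFunctional_intVec, intFunctional_intVec]
    have := hcon x hx y hy
    exact_mod_cast (by linarith : n ⬝ᵥ x + 0 ≤ n ⬝ᵥ y + 0 + 1)
  have h1 : ∀ x ∈ convexHull ℝ (P ∩ integerLattice 3), ∀ y ∈ P ∩ integerLattice 3,
      intFunctional n 0 x ≤ intFunctional n 0 y + 1 := by
    intro x hx y hy
    have : convexHull ℝ (P ∩ integerLattice 3) ⊆
        (intFunctional n 0) ⁻¹' Set.Iic (intFunctional n 0 y + 1) :=
      convexHull_min (fun x hx => hlat x hx y hy) ((convex_Iic _).affine_preimage _)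
    exact this hx
  have h2 : ∀ x ∈ convexHull ℝ (P ∩ integerLattice 3), ∀ y ∈ convexHull ℝ (P ∩ integerLattice 3),
      intFunctional n 0 x ≤ intFunctional n 0 y + 1 := by
    intro x hx y hy
    have : convexHull ℝ (P ∩ integerLattice 3) ⊆
        (intFunctional n 0) ⁻¹' Set.Ici (intFunctional n 0 x - 1) :=
      convexHull_min (fun y hy => by
        have := h1 x hx y hy
        simp only [Set.mem_preimage, Set.mem_Ici]
        linarith) ((convex_Ici _).affine_preimage _)
    have := this hy
    simp only [Set.mem_preimage, Set.mem_Ici] at this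
    linarith
  have hle : latticeWidth (convexHull ℝ (P ∩ integerLattice 3)) ≤
      widthAlong (intFunctional n 0) (convexHull ℝ (P ∩ integerLattice 3)) := by
    refine csInf_le ⟨0, ?_⟩ ⟨_, isIntegerFunctional_intFunctional n 0, hlin, rfl⟩
    rintro _ ⟨f, -, -, rfl⟩
    exact widthAlong_nonneg (hfin.isCompact_convexHull ℝ) f
  linarith [widthAlong_le zero_le_one h2]

/-- The parallelepiped of a boxing is determined by integer data. -/
theorem exists_boxedBy {P Q : Set (Fin 3 → ℝ)} (h : IsBoxedWith (P ∩ integerLattice 3) Q) :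
    ∃ F k v, BoxedBy (latticePoints P) F k v ∧ (∀ i, ∃ c, F i ⬝ᵥ c = 1) ∧
      det3 (F 0) (F 1) (F 2) ≠ 0 := by
  obtain ⟨-, -, -, f, hprim, hli, rfl, v, hv, hfv⟩ := h
  choose F k hf hc using fun i => exists_eq_intFunctional (hprim i)
  have hvmem : ∀ j, v j ∈ (P ∩ integerLattice 3) \ ⋂ i, f i ⁻¹' Set.Icc 0 1 := fun j => by
    rw [hv]; exact ⟨j, rfl⟩
  choose w hw using fun j => mem_integerLattice.1 (hvmem j).1.2
  have hval : ∀ i z, f i (intVec z) = (val F k i z : ℝ) := by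
    intro i z
    rw [hf, intFunctional_intVec]; rfl
  have hbit : ∀ i z, f i (intVec z) ∈ ({0, 1} : Set ℝ) ↔ val F k i z = 0 ∨ val F k i z = 1 := by
    intro i z
    rw [hval, Set.mem_insert_iff, Set.mem_singleton_iff]
    norm_cast
  refine ⟨F, k, w, ⟨fun i => ?_, ?_, ?_, ?_⟩, hc, ?_⟩
  · show intVec (w i) ∈ P
    rw [hw]; exact (hvmem i).1.1
  · intro i j hij
    have : v i = v j := by rw [← hw, ← hw, hij]
    exact (hfv i j).1 (this ▸ (hfv i i).2 rfl)
  · intro i x hx hxi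
    rw [← hbit]
    by_cases hQ : intVec x ∈ ⋂ i, f i ⁻¹' Set.Icc 0 1
    · have := Set.mem_iInter.1 hQ i
      rw [Set.mem_preimage, hval] at this
      rw [hbit]
      have h0 : 0 ≤ val F k i x := by exact_mod_cast this.1
      have h1 : val F k i x ≤ 1 := by exact_mod_cast this.2
      omega
    · have : intVec x ∈ Set.range v := by
        rw [← hv]; exact ⟨⟨hx, mem_integerLattice.2 ⟨x, rfl⟩⟩, hQ⟩
      obtain ⟨j, hj⟩ := this
      by_contra hout
      rw [← hj, hfv] at hout
      subst hout
      rw [← hw] at hj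
      exact hxi (intVec_injective hj.symm)
  · intro i
    rw [← hbit, hw]
    exact (hfv i i).2 rfl
  · rw [← linearIndependent_intFunctional_iff F k]
    simpa only [← hf] using hli

/-- The rows of a unimodular matrix are primitive. -/
theorem exists_dot_eq_one_of_isUnit {F : Fin 3 → Fin 3 → ℤ}
    (hu : IsUnit (det3 (F 0) (F 1) (F 2))) (i : Fin 3) : ∃ c, F i ⬝ᵥ c = 1 := by
  obtain ⟨e, he⟩ := isUnit_iff_exists_inv.1 hu
  unfold det3 at he
  fin_cases i
  · refine ⟨e • cross3 (F 1) (F 2), ?_⟩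
    change F 0 ⬝ᵥ _ = 1
    rw [dotProduct_smul, smul_eq_mul, dot3]
    change e * (F 0 0 * (F 1 1 * F 2 2 - F 1 2 * F 2 1) +
      F 0 1 * (F 1 2 * F 2 0 - F 1 0 * F 2 2) +
      F 0 2 * (F 1 0 * F 2 1 - F 1 1 * F 2 0)) = 1
    linear_combination he
  · refine ⟨e • cross3 (F 2) (F 0), ?_⟩
    change F 1 ⬝ᵥ _ = 1
    rw [dotProduct_smul, smul_eq_mul, dot3]
    change e * (F 1 0 * (F 2 1 * F 0 2 - F 2 2 * F 0 1) +
      F 1 1 * (F 2 2 * F 0 0 - F 2 0 * F 0 2) +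
      F 1 2 * (F 2 0 * F 0 1 - F 2 1 * F 0 0)) = 1
    linear_combination he
  · refine ⟨e • cross3 (F 0) (F 1), ?_⟩
    change F 2 ⬝ᵥ _ = 1
    rw [dotProduct_smul, smul_eq_mul, dot3]
    change e * (F 2 0 * (F 0 1 * F 1 2 - F 0 2 * F 1 1) +
      F 2 1 * (F 0 2 * F 1 0 - F 0 0 * F 1 2) +
      F 2 2 * (F 0 0 * F 1 1 - F 0 1 * F 1 0)) = 1
    linear_combination he

/-- A parallelepiped cut out by integer functionals of determinant one is a unimodular copy of the
unit cube: the functionals are the coordinates. -/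
theorem unimodularlyEquivalent_unitCube {F : Fin 3 → Fin 3 → ℤ} (k : Fin 3 → ℤ)
    (hu : IsUnit (det3 (F 0) (F 1) (F 2))) :
    UnimodularlyEquivalent (⋂ i, intFunctional (F i) (k i) ⁻¹' Set.Icc 0 1) (unitCube 3) := by
  let M : Matrix (Fin 3) (Fin 3) ℤ := Matrix.of F
  have hM : IsUnit M.det := by
    convert hu using 1
    rw [Matrix.det_fin_three]
    simp only [M, det3, Matrix.of_apply]
    ring
  have h1 : M * M⁻¹ = 1 := Matrix.mul_nonsing_inv M hM
  have h2 : M⁻¹ * M = 1 := Matrix.nonsing_inv_mul M hM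
  have h1' : M.map (Int.castRingHom ℝ) * M⁻¹.map (Int.castRingHom ℝ) = 1 := by
    rw [← Matrix.map_mul, h1, Matrix.map_one _ (map_zero _) (map_one _)]
  have h2' : M⁻¹.map (Int.castRingHom ℝ) * M.map (Int.castRingHom ℝ) = 1 := by
    rw [← Matrix.map_mul, h2, Matrix.map_one _ (map_zero _) (map_one _)]
  let t : (Fin 3 → ℝ) ≃ᵃ[ℝ] (Fin 3 → ℝ) :=
    (Matrix.toLin'OfInv h2' h1').toAffineEquiv.trans
      (AffineEquiv.constVAdd ℝ (Fin 3 → ℝ) (intVec k))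
  have ht : ∀ x i, t x i = intFunctional (F i) (k i) x := by
    intro x i
    rw [intFunctional_apply]
    simp [t, M, Matrix.toLin'OfInv, Matrix.mulVec, dotProduct, Fin.sum_univ_three, intVec]
    ring
  have htz : ∀ z, t (intVec z) = intVec fun i => F i ⬝ᵥ z + k i := by
    intro z
    funext i
    rw [ht, intFunctional_intVec]; rfl
  refine ⟨t, ?_, ?_⟩
  · ext y
    simp only [Set.mem_image, mem_integerLattice]
    constructor
    · rintro ⟨_, ⟨z, rfl⟩, rfl⟩
      exact ⟨_, (htz z).symm⟩
    · rintro ⟨w, rfl⟩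
      refine ⟨_, ⟨M⁻¹ *ᵥ (w - k), rfl⟩, ?_⟩
      rw [htz]
      congr 1
      funext i
      have : M *ᵥ (M⁻¹ *ᵥ (w - k)) = w - k := by
        rw [Matrix.mulVec_mulVec, h1, Matrix.one_mulVec]
      have := congrFun this i
      simp only [Pi.sub_apply] at this
      show F i ⬝ᵥ _ + k i = w i
      have e : F i ⬝ᵥ (M⁻¹ *ᵥ (w - k)) = w i - k i := this
      rw [e]; ring
  · ext y
    obtain ⟨x, rfl⟩ := t.surjective y
    rw [t.injective.mem_set_image]
    simp only [Set.mem_iInter, Set.mem_preimage, unitCube, ← ht]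
    simp only [Set.mem_Icc, Pi.le_def, Pi.zero_apply, Pi.one_apply, forall_and]

theorem mainTheorem10 (P : Set (Fin 3 → ℝ)) (hP : IsLatticePolytope P) (hbox : IsBoxed P) :
    ∃ Q : Set (Fin 3 → ℝ),
      UnimodularlyEquivalent Q (unitCube 3) ∧ IsBoxedWith (P ∩ integerLattice 3) Q := by
  obtain ⟨Q₀, hQ₀⟩ := hbox
  obtain ⟨F₀, k₀, v₀, hb₀, hprim₀, hD₀⟩ := exists_boxedBy hQ₀
  have hconv : Convex ℝ P := by
    obtain ⟨⟨S, -, -, rfl⟩, -⟩ := hP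
    exact convex_convexHull ℝ S
  obtain ⟨F, k, v, hb, hu⟩ := hb₀.unimodularlyBoxed (wide_latticePoints hQ₀.1 hQ₀.2.2.1)
    (latticeConvex_latticePoints hconv) hprim₀ hD₀
  have hval : ∀ i z, intFunctional (F i) (k i) (intVec z) = (val F k i z : ℝ) :=
    fun i z => intFunctional_intVec _ _ _
  have hbit : ∀ i z, intFunctional (F i) (k i) (intVec z) ∈ ({0, 1} : Set ℝ) ↔
      val F k i z = 0 ∨ val F k i z = 1 := by
    intro i z
    rw [hval, Set.mem_insert_iff, Set.mem_singleton_iff]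
    norm_cast
  refine ⟨⋂ i, intFunctional (F i) (k i) ⁻¹' Set.Icc 0 1, unimodularlyEquivalent_unitCube k hu,
    hQ₀.1, hQ₀.2.1, hQ₀.2.2.1, fun i => intFunctional (F i) (k i),
    fun i => isPrimitiveFunctional_intFunctional _ (exists_dot_eq_one_of_isUnit hu i),
    (linearIndependent_intFunctional_iff F k).2 hu.ne_zero, rfl, fun j => intVec (v j), ?_, ?_⟩
  · ext x
    constructor
    · rintro ⟨⟨hxP, hxL⟩, hxQ⟩
      obtain ⟨z, rfl⟩ := mem_integerLattice.1 hxL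
      by_contra hne
      apply hxQ
      refine Set.mem_iInter.2 fun i => ?_
      have := hb.bit i z hxP fun e => hne ⟨i, by rw [e]⟩
      rw [Set.mem_preimage, hval]
      rcases this with h | h <;> rw [h] <;> simp
    · rintro ⟨j, rfl⟩
      refine ⟨⟨hb.mem j, mem_integerLattice.2 ⟨_, rfl⟩⟩, fun hQ => hb.out j ?_⟩
      have := Set.mem_iInter.1 hQ j
      rw [Set.mem_preimage, hval] at this
      have h0 : 0 ≤ val F k j (v j) := by exact_mod_cast this.1
      have h1 : val F k j (v j) ≤ 1 := by exact_mod_cast this.2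
      omega
  · intro i j
    rw [hbit]
    constructor
    · intro h
      by_contra hij
      exact h (hb.bit i _ (hb.mem j) fun e => hij (hb.inj e).symm)
    · rintro rfl
      exact hb.out i
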